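/- Let $F$ be a number field of degree $d$ with $r_2$ complex places, discriminant $d_F$, different $\mathfrak d_F$, and let $n_\sigma=[F_\sigma:\mathbb R]$ for an archimedean place $\sigma$. Put $F_\infty=F\otimes\mathbb R=\prod_\sigma F_\sigma$ and $\mathfrak h_F^n=GL_n(F_\infty)/F_\infty^\times K$, where $K=\prod_\sigma K_\sigma$ with $K_\sigma=O(n)$ or $U(n)$. On $F_\sigma^n$ let $\|x\|=(\sum_i|x_i|^2)^{1/2}$, where $|x+iy|=(x^2+y^2)^{1/2}$ at the complex places. A fractional ideal is called anti-integral if it contains $1$. For an $\mathcal O_F$-lattice $L\subset F^n$ and a fractional ideal $\mathfrak b$ let $L_{\mathfrak b}=\{x\in L-\{0\}: Fx\cap L=\mathfrak b x\}$ and $$E_{\mathfrak b\to L}([g],s)=\sum_{x\in\mathcal O_F^\times\backslash L_{\mathfrak b}}\prod_\sigma\frac{|\det g_\sigma|^{n_\sigma s}}{\|xg_\sigma\|^{nn_\sigma s}},\qquad E_{L,\mathscr A}(z,s)=\sum_{\mathfrak b\in\mathscr A\ \text{anti-integral}}E_{\mathfrak b\to L}(z,s)\qquad(\mathscr A\in Cl_F,\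 \mathrm{Re}\,s>1).$$ Let $\zeta_F(\mathfrak c,s)=\sum_{\mathfrak b\subset\mathcal O_F,\,[\mathfrak b]=[\mathfrak c]}N\mathfrak b^{-s}$, $\varphi(\mathfrak m)=\#(\mathcal O_F/\mathfrak m)^\times$, and for $\mathfrak b\subset\mathfrak d_F^{-1}$ let $\tau(\mathfrak m,\mathfrak b)=\sum_x e^{2\pi i\,Tr_{F/\mathbb Q}(x)}$, where $x$ runs over representatives of the generators of the $\mathcal O_F$-module $\mathfrak b\mathfrak m^{-1}/\mathfrak b$. Put $\Gamma_F(s)=\prod_\sigma\Gamma(n_\sigma s/2)$, $K_s(x)=\frac12\int_0^\infty e^{-\frac x2(u+\frac1u)}u^s\frac{du}u$ and $K_F(s,(x_\sigma)_\sigma)=\prod_\sigma K_{n_\sigma s/2}(x_\sigma)$. Let $n\ge2$, let $\mathfrak a_1,\dots,\mathfrak a_n$ be fractional ideals, $L=\mathfrak a_1\oplus\cdots\oplus\mathfrak a_n$, $L^{(1)}=\mathfrak a_1\oplus\cdots\oplus\mathfrak a_{n-1}$, and let $\mathfrak a$ be an anti-integral ideal. Identify $\xi\in F_\infty^{n-1}$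 with the unipotent matrix in $GL_n(F_\infty)$ with last column ${}^t(\xi_1,\dots,\xi_{n-1},1)$ and identity upper left block; this group is $N(\mathbb R)$. Let $N=\bigoplus_{i<n}\mathfrak a_i^{-1}\mathfrak a_n$, $\langle x,y\rangle=\sum_iTr_{F_\infty/\mathbb R}(x_iy_i)$, $N^\vee=\{y\in F_\infty^{n-1}:\langle x,y\rangle\in\mathbb Z\ \forall x\in N\}$, and for a fractional ideal $\mathfrak b$ let $(N^\vee)_{\mathfrak b}=\{\nu\in N^\vee-\{0\}:F\nu\cap N^\vee=\mathfrak b\nu\}$. For $\nu\in N^\vee$ put $$\mathscr I_\nu(z,s)=\frac1{vol(N\backslash N(\mathbb R))}\int_{N\backslash N(\mathbb R)}E_{L,[\mathfrak a]}(\xi z,s)e^{-2\pi i\langle\nu,\xi\rangle}d\xi .$$ Write $z=[g]$ in Iwasawa form $g=XY$, where $X$ is upper triangular over $F_\infty$ with diagonal entries $1$ and $Y=\mathrm{diag}(y_1\cdots y_{n-1},\,y_2\cdots y_{n-1},\dots,y_{n-1},1)$ with $y_i\in\prod_\sigma\mathbb R_{>0}$. Let $g^{(1)}$ be the upper left $(n-1)\times(n-1)$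 block of $g$ and let $\mathbf x_n\in F_\infty^{n-1}$ be the last column of $X$ without its last entry. For $\mathrm{Re}\,s>1$ all the series and integrals above and below converge ($E_{L^{(1)},\mathscr A}$ being taken at $([g^{(1)}],\frac{ns-1}{n-1})$), and the following hold. (1) (Constant term) $$\frac{\mathscr I_0(z,s)}{\zeta_F(\mathfrak a^{-1},ns)}=\delta_{[\mathfrak a],[\mathfrak a_n]}(N\mathfrak a_n)^{-ns}\prod_\sigma|\det g^{(1)}_\sigma|^{n_\sigma s}+\frac{2^{r_2}\pi^{d/2}}{\sqrt{|d_F|}\,N\mathfrak a_n}\frac{\Gamma_F(ns-1)}{\Gamma_F(ns)}\prod_\sigma|\det g^{(1)}_\sigma|^{n_\sigma\frac{1-s}{n-1}}\sum_{0\ne\mathfrak m\subset\mathcal O_F}\frac{\varphi(\mathfrak m)}{N\mathfrak m^{ns}}\,\frac{E_{L^{(1)},[\mathfrak a\mathfrak m^{-1}]}([g^{(1)}],\frac{ns-1}{n-1})}{\zeta_F(\mathfrak a^{-1}\mathfrak m,ns-1)} .$$ (2) (Non-constant terms) $$\sum_{\nu\in N^\vee-\{0\}}\frac{\mathscr I_\nu(z,s)}{\zeta_F(\mathfrak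 a^{-1},ns)}=\frac{2^{d+r_2(ns-1)}\pi^{\frac{dns}2}}{\sqrt{|d_F|}\,(N\mathfrak a_n)^{ns}}\sum_{0\ne\mathfrak n\subset\mathcal O_F}N(\mathfrak n\mathfrak d_F^{-1})^{ns-1}\sum_{\substack{\mathfrak m\subset\mathcal O_F\\ \mathfrak m\in[\mathfrak a\mathfrak a_n^{-1}\mathfrak n\mathfrak d_F^{-1}]}}\frac{\tau(\mathfrak m,\mathfrak n\mathfrak d_F^{-1})}{N\mathfrak m^{ns}}$$ $$\times\sum_{\nu\in(N^\vee)_{\mathfrak n^{-1}}}e^{2\pi i\langle\nu,\mathbf x_n\rangle}\,\frac{K_F(ns-1,(2\pi n_\sigma\|\nu g^{(1)}_\sigma\|)_\sigma)}{\Gamma_F(ns)}\prod_\sigma\frac{|\det g^{(1)}_\sigma|^{n_\sigma s}}{\|\nu g^{(1)}_\sigma\|^{\frac{n_\sigma}2(ns-1)}} .$$ Here, since a partial zeta function may have zeros, division by $\zeta_F(\mathfrak a^{-1},ns)$ on the left-hand sides means that the right-hand side multiplied by $\zeta_F(\mathfrak a^{-1},ns)$ equals $\mathscr I_0$, respectively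 $\sum_{\nu\neq 0}\mathscr I_\nu$; and the last quotient in (1) stands for $N(\mathfrak a\mathfrak m^{-1})^{-(ns-1)}E_{\mathfrak a\mathfrak m^{-1}\to L^{(1)}}([g^{(1)}],\frac{ns-1}{n-1})$, whose product with $\zeta_F(\mathfrak a^{-1}\mathfrak m,ns-1)$ is $E_{L^{(1)},[\mathfrak a\mathfrak m^{-1}]}([g^{(1)}],\frac{ns-1}{n-1})$. When none of these zeta values vanishes, (1) holds as literally written. -/

import Mathlib

open NumberField NumberField.InfinitePlace NumberField.mixedEmbedding MeasureTheory
open scoped nonZeroDivisors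

noncomputable section

set_option linter.unusedSectionVars false

namespace EisFourier

variable (F : Type*) [Field F] [NumberField F] {n : ℕ}

/-! The archimedean algebra `F_∞ = F ⊗ ℝ = ∏_σ F_σ` is Mathlib's `mixedSpace F` (a copy of `ℝ` for each
real place, a copy of `ℂ` for each complex place), `normAtPlace σ` is the absolute value `|x_σ|`
(with `|x + i y| = √(x² + y²)` at the complex places), and `σ.mult` is `n_σ = [F_σ : ℝ]`. -/

/-- The group of non-zero fractional ideals of `F`. -/
abbrev Frac : Type _ := (FractionalIdeal (𝓞 F)⁰ F)ˣ

variable {F}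

/-- The ideal class `[𝔞]` of a fractional ideal. -/
abbrev idealClass (a : Frac F) : ClassGroup (𝓞 F) := ClassGroup.mk (K := F) a

/-! ### The generalized upper half space -/

/-- The Hermitian norm `‖v_σ‖ = (∑ |v_{i,σ}|²)^{1/2}` of the `σ`-component of `v ∈ F_∞^n`. -/
def rowNorm (σ : InfinitePlace F) (v : Fin n → mixedSpace F) : ℝ :=
  Real.sqrt (∑ i, normAtPlace σ (v i) ^ 2)

/-- The image of `x ∈ F^n` in `F_∞^n`. -/
def emb (x : Fin n → F) : Fin n → mixedSpace F := fun i => mixedEmbedding F (x i)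

variable (F n) in
/-- The centre `F_∞^×` of `GL_n(F_∞)`. -/
def scalars : Subgroup (GL (Fin n) (mixedSpace F)) :=
  (Units.map (Matrix.scalar (Fin n) : mixedSpace F →+* _).toMonoidHom).range

variable (F n) in
/-- The maximal compact subgroup `K = ∏_σ K_σ` of `GL_n(F_∞)`, with `K_σ = O(n)` at the real places
and `K_σ = U(n)` at the complex ones: the star operation of `mixedSpace F` is trivial at the real
places and complex conjugation at the complex places. -/
def maxCompact : Subgroup (GL (Fin n) (mixedSpace F)) :=
  (Unitary.toUnits : Matrix.unitaryGroup (Fin n) (mixedSpace F) →* _).range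

variable (F n) in
/-- The generalized upper half space `𝔥_F^n = GL_n(F_∞) / F_∞^× K`, with the left action of
`GL_n(F_∞)`. -/
abbrev UpperSpace : Type _ := GL (Fin n) (mixedSpace F) ⧸ (scalars F n ⊔ maxCompact F n)

/-- `∏_σ |det g_σ|^{n_σ} / ‖x g_σ‖^{n n_σ}` for a row vector `x ∈ F^n`. -/
def detAux (x : Fin n → F) (g : GL (Fin n) (mixedSpace F)) : ℝ :=
  ∏ σ : InfinitePlace F, normAtPlace σ (g : Matrix (Fin n) (Fin n) (mixedSpace F)).det ^ σ.mult /
    rowNorm σ (Matrix.vecMul (emb x) (g : Matrix (Fin n) (Fin n) (mixedSpace F))) ^ (n * σ.mult)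

lemma normAtPlace_dotProduct_star (σ : InfinitePlace F) (v : Fin n → mixedSpace F) :
    normAtPlace σ (v ⬝ᵥ star v) = ∑ i, normAtPlace σ (v i) ^ 2 := by
  rcases σ.isReal_or_isComplex with h | h
  · simp_rw [normAtPlace_apply_of_isReal h]
    have : (v ⬝ᵥ star v).1 ⟨σ, h⟩ = ∑ i, (v i).1 ⟨σ, h⟩ ^ 2 := by
      simp [dotProduct, Prod.fst_sum, Finset.sum_apply, sq]
    rw [this, Real.norm_of_nonneg (Finset.sum_nonneg fun i _ => sq_nonneg _)]
    simp
  · simp_rw [normAtPlace_apply_of_isComplex h]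
    have : (v ⬝ᵥ star v).2 ⟨σ, h⟩ = ((∑ i, ‖(v i).2 ⟨σ, h⟩‖ ^ 2 : ℝ) : ℂ) := by
      simp [dotProduct, Prod.snd_sum, Finset.sum_apply, Complex.mul_conj, Complex.normSq_eq_norm_sq]
    rw [this, Complex.norm_real,
      Real.norm_of_nonneg (Finset.sum_nonneg fun i _ => sq_nonneg _)]

lemma normAtPlace_star (σ : InfinitePlace F) (x : mixedSpace F) :
    normAtPlace σ (star x) = normAtPlace σ x := by
  rcases σ.isReal_or_isComplex with h | h
  · simp [normAtPlace_apply_of_isReal h]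
  · simp [normAtPlace_apply_of_isComplex h]

lemma detAux_mul_scalars (x : Fin n → F) (g h : GL (Fin n) (mixedSpace F)) (hh : h ∈ scalars F n) :
    detAux x (g * h) = detAux x g := by
  obtain ⟨c, rfl⟩ := hh
  unfold detAux
  refine Finset.prod_congr rfl fun σ _ => ?_
  have hc : normAtPlace σ (c : mixedSpace F) ≠ 0 := (c.isUnit.map (normAtPlace σ)).ne_zero
  have h1 : ((g * (Units.map (Matrix.scalar (Fin n) : mixedSpace F →+* _).toMonoidHom) c :
      GL (Fin n) (mixedSpace F)) : Matrix (Fin n) (Fin n) (mixedSpace F)) =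
      (c : mixedSpace F) • (g : Matrix (Fin n) (Fin n) (mixedSpace F)) := by
    simp [← Matrix.smul_eq_mul_diagonal]
  have h2 : rowNorm σ (Matrix.vecMul (emb x)
      ((c : mixedSpace F) • (g : Matrix (Fin n) (Fin n) (mixedSpace F)))) =
      normAtPlace σ (c : mixedSpace F) * rowNorm σ (Matrix.vecMul (emb x)
      (g : Matrix (Fin n) (Fin n) (mixedSpace F))) := by
    simp only [rowNorm, Matrix.vecMul_smul, Pi.smul_apply, smul_eq_mul, map_mul, mul_pow,
      ← Finset.mul_sum]
    rw [Real.sqrt_mul (sq_nonneg _), Real.sqrt_sq (normAtPlace_nonneg _ _)]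
  rw [h1, h2, Matrix.det_smul, map_mul, map_pow, Fintype.card_fin, mul_pow, mul_pow, ← pow_mul,
    mul_div_mul_left _ _ (pow_ne_zero _ hc)]

lemma detAux_mul_maxCompact (x : Fin n → F) (g h : GL (Fin n) (mixedSpace F))
    (hh : h ∈ maxCompact F n) : detAux x (g * h) = detAux x g := by
  obtain ⟨u, rfl⟩ := hh
  set k : Matrix (Fin n) (Fin n) (mixedSpace F) := u.1 with hk
  have hu : k * star k = 1 := Unitary.mul_star_self_of_mem u.2
  have h1 : ((g * Unitary.toUnits u : GL (Fin n) (mixedSpace F)) :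
      Matrix (Fin n) (Fin n) (mixedSpace F)) =
      (g : Matrix (Fin n) (Fin n) (mixedSpace F)) * k := by simp [hk]
  unfold detAux
  refine Finset.prod_congr rfl fun σ _ => ?_
  have h2 : normAtPlace σ k.det = 1 := by
    have := congrArg (fun M => normAtPlace σ (Matrix.det M)) hu
    simp only [Matrix.det_mul, Matrix.det_one, map_mul, map_one, Matrix.star_eq_conjTranspose,
      Matrix.det_conjTranspose, normAtPlace_star] at this
    nlinarith [normAtPlace_nonneg σ k.det]
  have h3 (v : Fin n → mixedSpace F) : rowNorm σ (Matrix.vecMul v k) = rowNorm σ v := by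
    rw [rowNorm, rowNorm, ← normAtPlace_dotProduct_star, ← normAtPlace_dotProduct_star,
      Matrix.star_vecMul, Matrix.dotProduct_mulVec, Matrix.vecMul_vecMul,
      ← Matrix.star_eq_conjTranspose, hu, Matrix.vecMul_one]
  rw [h1, ← Matrix.vecMul_vecMul, h3, Matrix.det_mul, map_mul, h2, mul_one]

lemma detAux_mul_right (x : Fin n → F) (g h : GL (Fin n) (mixedSpace F))
    (hh : h ∈ scalars F n ⊔ maxCompact F n) : detAux x (g * h) = detAux x g := by
  let S : Subgroup (GL (Fin n) (mixedSpace F)) :=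
    { carrier := {h | ∀ g, detAux x (g * h) = detAux x g}
      one_mem' := fun g => by rw [mul_one]
      mul_mem' := fun {a b} ha hb g => by rw [← mul_assoc, hb, ha]
      inv_mem' := fun {a} ha g => by rw [← ha (g * a⁻¹), inv_mul_cancel_right] }
  have hS : scalars F n ⊔ maxCompact F n ≤ S :=
    sup_le (fun h hh g => detAux_mul_scalars x g h hh)
      (fun h hh g => detAux_mul_maxCompact x g h hh)
  exact hS hh g

lemma detAux_unit_smul (u : (𝓞 F)ˣ) (x : Fin n → F) (g : GL (Fin n) (mixedSpace F)) :
    detAux (u • x) g = detAux x g := by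
  have h1 (σ : InfinitePlace F) : rowNorm σ (Matrix.vecMul (emb (u • x))
      (g : Matrix (Fin n) (Fin n) (mixedSpace F))) = σ (((u : 𝓞 F) : F)) *
      rowNorm σ (Matrix.vecMul (emb x) (g : Matrix (Fin n) (Fin n) (mixedSpace F))) := by
    have : emb (u • x) = mixedEmbedding F ((u : 𝓞 F) : F) • emb x := by
      funext i
      simp [emb, Units.smul_def, Algebra.smul_def]
    rw [this, Matrix.smul_vecMul]
    simp only [rowNorm, Pi.smul_apply, smul_eq_mul, map_mul, mul_pow, ← Finset.mul_sum]
    rw [Real.sqrt_mul (sq_nonneg _), Real.sqrt_sq (normAtPlace_nonneg _ _), normAtPlace_apply]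
  have h2 : ∏ σ : InfinitePlace F, σ (((u : 𝓞 F) : F)) ^ (n * σ.mult) = 1 := by
    simp_rw [mul_comm n, pow_mul]
    rw [Finset.prod_pow, prod_eq_abs_norm]
    have := (NumberField.isUnit_iff_norm.mp u.isUnit)
    rw [RingOfIntegers.coe_norm] at this
    simp only [Rat.cast_abs] at *
    rw [← Rat.cast_abs, this]
    simp
  unfold detAux
  simp_rw [h1, mul_pow, Finset.prod_div_distrib, Finset.prod_mul_distrib, h2, one_mul]

/-- The function `([g], x) ↦ ∏_σ |det g_σ|^{n_σ} / ‖x g_σ‖^{n n_σ}` on `𝔥_F^n`, for `x ∈ F^n` taken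
modulo `𝓞_F^×`. -/
def detFun (q : MulAction.orbitRel.Quotient (𝓞 F)ˣ (Fin n → F)) (z : UpperSpace F n) : ℝ :=
  Quotient.liftOn q
    (fun x => Quotient.liftOn' z (detAux x) fun g g' h => by
      have := detAux_mul_right x g _ (QuotientGroup.leftRel_apply.mp h)
      rw [mul_inv_cancel_left] at this
      exact this.symm)
    fun x y h => by
      obtain ⟨u, rfl⟩ := h
      induction z using Quotient.inductionOn'
      exact detAux_unit_smul u y _

/-! ### Lattices and Eisenstein series -/

/-- The `𝓞_F`-lattice `𝔞_1 ⊕ ⋯ ⊕ 𝔞_n ⊂ F^n`. -/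
def sumLattice (a : Fin n → Frac F) : Submodule (𝓞 F) (Fin n → F) :=
  Submodule.pi Set.univ fun i => ((a i : FractionalIdeal (𝓞 F)⁰ F) : Submodule (𝓞 F) F)

/-- `L_𝔞 = {x ∈ L - {0} | F x ∩ L = 𝔞 x}`. -/
def primVec (L : Submodule (𝓞 F) (Fin n → F)) (a : Frac F) : Set (Fin n → F) :=
  {x | x ∈ L ∧ x ≠ 0 ∧ ∀ α : F, α • x ∈ L ↔ α ∈ (a : FractionalIdeal (𝓞 F)⁰ F)}

/-- `𝓞_F^× \ L_𝔞`. -/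
def primOrbits (L : Submodule (𝓞 F) (Fin n → F)) (a : Frac F) :
    Set (MulAction.orbitRel.Quotient (𝓞 F)ˣ (Fin n → F)) :=
  (fun x => (Quotient.mk _ x : MulAction.orbitRel.Quotient (𝓞 F)ˣ (Fin n → F))) '' primVec L a

/-- `E_{𝔞 → L}(z, s) = ∑_{x ∈ 𝓞_F^× \ L_𝔞} ∏_σ |det g_σ|^{n_σ s} / ‖x g_σ‖^{n n_σ s}`. -/
def eisIdeal (L : Submodule (𝓞 F) (Fin n → F)) (a : Frac F) (z : UpperSpace F n) (s : ℂ) : ℂ :=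
  ∑' q : primOrbits L a, (detFun q.1 z : ℂ) ^ s

/-- The anti-integral ideals (the fractional ideals containing `1`) in the ideal class `A`. -/
def antiIntegral (A : ClassGroup (𝓞 F)) : Set (Frac F) :=
  {b : Frac F | (1 : F) ∈ (b : FractionalIdeal (𝓞 F)⁰ F) ∧ idealClass b = A}

/-- `E_{L,A}(z, s) = ∑_{𝔟 ∈ A anti-integral} E_{𝔟 → L}(z, s)`. -/
def eisClass (L : Submodule (𝓞 F) (Fin n → F)) (A : ClassGroup (𝓞 F)) (z : UpperSpace F n)
    (s : ℂ) : ℂ :=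
  ∑' b : antiIntegral A, eisIdeal L b.1 z s

/-- Absolute convergence of the double series defining `E_{L,A}(z, s)`. -/
def EisConverges (L : Submodule (𝓞 F) (Fin n → F)) (A : ClassGroup (𝓞 F)) (z : UpperSpace F n)
    (s : ℂ) : Prop :=
  Summable fun p : (b : antiIntegral A) × primOrbits L b.1 => ‖(detFun p.2.1 z : ℂ) ^ s‖

/-! ### Arithmetic functions -/

/-- The norm of a non-zero fractional ideal, as a complex number. -/
def idealNorm (a : Frac F) : ℂ := ((FractionalIdeal.absNorm (a : FractionalIdeal (𝓞 F)⁰ F) : ℚ) : ℂ)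

/-- A non-zero integral ideal as a fractional ideal. -/
abbrev toFrac (m : (Ideal (𝓞 F))⁰) : Frac F := FractionalIdeal.mk0 F m

variable (F) in
/-- The different ideal `𝔡_F`. -/
def different : Frac F :=
  FractionalIdeal.mk0 F ⟨differentIdeal ℤ (𝓞 F),
    mem_nonZeroDivisors_iff_ne_zero.mpr differentIdeal_ne_bot⟩

/-- The terms `N𝔟^{-s}`, for `𝔟` a non-zero integral ideal in the class `A`. -/
def zetaTerm (A : ClassGroup (𝓞 F)) (s : ℂ) (b : {b : (Ideal (𝓞 F))⁰ // ClassGroup.mk0 b = A}) : ℂ :=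
  idealNorm (toFrac b.1) ^ (-s)

/-- The partial zeta function `ζ_F(A, s) = ∑_{𝔟 ∈ A, 𝔟 ⊂ 𝓞_F} N𝔟^{-s}`. -/
def partialZeta (A : ClassGroup (𝓞 F)) (s : ℂ) : ℂ := ∑' b, zetaTerm A s b

/-- Euler's totient `φ(𝔪) = #(𝓞_F / 𝔪)^×`. -/
def totient (m : (Ideal (𝓞 F))⁰) : ℕ := Nat.card (𝓞 F ⧸ (m : Ideal (𝓞 F)))ˣ

/-- The fractional ideal `𝔟𝔪⁻¹` as a submodule of `F`. -/
abbrev ramModule (m : (Ideal (𝓞 F))⁰) (b : Frac F) : Submodule (𝓞 F) F :=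
  (((b * (toFrac m)⁻¹ : Frac F) : FractionalIdeal (𝓞 F)⁰ F) : Submodule (𝓞 F) F)

/-- The finite module `𝔟𝔪⁻¹ / 𝔟`. -/
abbrev RamQuot (m : (Ideal (𝓞 F))⁰) (b : Frac F) : Type _ :=
  ramModule m b ⧸
    Submodule.submoduleOf (((b : FractionalIdeal (𝓞 F)⁰ F) : Submodule (𝓞 F) F)) (ramModule m b)

/-- The Ramanujan sum `τ(𝔪, 𝔟) = ∑ e^{2πi Tr(x)}`, over a system of representatives `x` of the
generators of the module `𝔟𝔪⁻¹ / 𝔟` (for `𝔟 ⊂ 𝔡_F⁻¹` the choice does not matter). -/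
def ramanujanSum (m : (Ideal (𝓞 F))⁰) (b : Frac F) : ℂ :=
  ∑ᶠ q : {q : RamQuot m b // Submodule.span (𝓞 F) {q} = ⊤},
    Complex.exp (2 * Real.pi * Complex.I *
      ((Algebra.trace ℚ F (Function.surjInv (Submodule.mkQ_surjective _) q.1 : ramModule m b) : ℚ) :
        ℂ))

open Classical in
/-- The Kronecker delta of two ideal classes. -/
def classDelta (A B : ClassGroup (𝓞 F)) : ℂ := if A = B then 1 else 0

/-! ### Gamma and Bessel functions -/

variable (F) in
/-- `Γ_F(s) = ∏_σ Γ(n_σ s / 2)`. -/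
def gammaF (s : ℂ) : ℂ := ∏ σ : InfinitePlace F, Complex.Gamma (σ.mult * s / 2)

/-- The `K`-Bessel function `K_s(x) = (1/2) ∫_0^∞ e^{-x(u + 1/u)/2} u^s du/u`. -/
def besselK (s : ℂ) (x : ℝ) : ℂ :=
  (1 / 2) * ∫ u in Set.Ioi (0 : ℝ), (Real.exp (-(1 / 2) * x * (u + 1 / u)) : ℂ) * (u : ℂ) ^ s / u

/-- `K_F(s, x) = ∏_σ K_{n_σ s / 2}(x_σ)`. -/
def besselKF (s : ℂ) (x : InfinitePlace F → ℝ) : ℂ :=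
  ∏ σ : InfinitePlace F, besselK (σ.mult * s / 2) (x σ)

/-! ### The unipotent radical and Fourier coefficients -/

open Classical in
/-- The `ℝ`-linear extension `F_∞ → ℝ` of the trace of `F / ℚ`. -/
def traceInf (x : mixedSpace F) : ℝ := ∑ σ, x.1 σ + ∑ σ, 2 * (x.2 σ).re

/-- The pairing `⟨x, y⟩ = ∑ Tr(x_i y_i)` on `F_∞^n`. -/
def pairing (x y : Fin n → mixedSpace F) : ℝ := ∑ i, traceInf (x i * y i)

/-- The matrix of `N(ℝ)` with last column `(ξ_1, …, ξ_{n-1}, 1)` (here of size `n + 1`). -/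
def unipMatrix (ξ : Fin n → mixedSpace F) : Matrix (Fin (n + 1)) (Fin (n + 1)) (mixedSpace F) :=
  fun i j => if i = j then 1 else
    if j = Fin.last n then Fin.lastCases (motive := fun _ => mixedSpace F) 0 ξ i else 0

lemma det_unipMatrix (ξ : Fin n → mixedSpace F) : (unipMatrix ξ).det = 1 := by
  rw [Matrix.det_of_isUpperTriangular]
  · simp [unipMatrix]
  · intro i j hij
    have hij' : j < i := hij
    have h1 : i ≠ j := hij'.ne'
    have h2 : j ≠ Fin.last n := (lt_of_lt_of_le hij' (Fin.le_last i)).ne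
    simp [unipMatrix, h1, h2]

/-- The element of `N(ℝ) ⊂ GL_{n+1}(F_∞)` with coordinates `ξ ∈ F_∞^n`. -/
def unip (ξ : Fin n → mixedSpace F) : GL (Fin (n + 1)) (mixedSpace F) :=
  Matrix.GeneralLinearGroup.mk'' (unipMatrix ξ) (by rw [det_unipMatrix]; exact isUnit_one)

/-- For `L = 𝔞_1 ⊕ ⋯ ⊕ 𝔞_{n+1}`, the lattice `N = ⊕_{i ≤ n} 𝔞_i⁻¹ 𝔞_{n+1}` in `N(ℝ) = F_∞^n`. -/
def unipLattice (a : Fin (n + 1) → Frac F) : AddSubgroup (Fin n → mixedSpace F) :=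
  AddSubgroup.pi Set.univ fun i =>
    ((((a i.castSucc)⁻¹ * a (Fin.last n) : Frac F) : FractionalIdeal (𝓞 F)⁰ F) :
      Submodule (𝓞 F) F).toAddSubgroup.map (mixedEmbedding F).toAddMonoidHom

/-- The dual lattice `N^∨ = {y ∈ F_∞^n | ⟨x, y⟩ ∈ ℤ for all x ∈ N}`. -/
def dualLattice (a : Fin (n + 1) → Frac F) : Set (Fin n → mixedSpace F) :=
  {y | ∀ x ∈ unipLattice a, ∃ k : ℤ, pairing x y = k}

/-- `(N^∨)_𝔟 = {ν ∈ N^∨ - {0} | F ν ∩ N^∨ = 𝔟 ν}`. -/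
def dualPrimVec (a : Fin (n + 1) → Frac F) (b : Frac F) : Set (Fin n → mixedSpace F) :=
  {ν | ν ∈ dualLattice a ∧ ν ≠ 0 ∧
    ∀ α : F, mixedEmbedding F α • ν ∈ dualLattice a ↔ α ∈ (b : FractionalIdeal (𝓞 F)⁰ F)}

open Classical in
/-- `D ⊂ N(ℝ) = F_∞^n` is a fundamental domain of `N \ N(ℝ)`. -/
def IsFundDomain (a : Fin (n + 1) → Frac F) (D : Set (Fin n → mixedSpace F)) : Prop :=
  IsAddFundamentalDomain (unipLattice a) D volume

/-- The function `ξ ↦ E(ξ z) e^{-2πi⟨ν,ξ⟩}` on `N(ℝ) = F_∞^n`. -/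
def fourierIntegrand (E : UpperSpace F (n + 1) → ℂ) (ν : Fin n → mixedSpace F)
    (z : UpperSpace F (n + 1)) (ξ : Fin n → mixedSpace F) : ℂ :=
  E (unip ξ • z) * Complex.exp (-(2 * Real.pi * Complex.I * (pairing ν ξ : ℂ)))

open Classical in
/-- The Fourier coefficient `vol(N\N(ℝ))⁻¹ ∫_{N\N(ℝ)} E(ξ z) e^{-2πi⟨ν,ξ⟩} dξ`, the integral taken
over a fundamental domain `D`. (It does not depend on the normalization of the Haar measure.) -/
def fourierCoeff (D : Set (Fin n → mixedSpace F)) (E : UpperSpace F (n + 1) → ℂ)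
    (ν : Fin n → mixedSpace F) (z : UpperSpace F (n + 1)) : ℂ :=
  (((volume D).toReal : ℝ) : ℂ)⁻¹ * ∫ ξ in D, fourierIntegrand E ν z ξ

open Classical in
/-- The integral that defines the Fourier coefficient is absolutely convergent. -/
def FourierIntegrable (D : Set (Fin n → mixedSpace F)) (E : UpperSpace F (n + 1) → ℂ)
    (ν : Fin n → mixedSpace F) (z : UpperSpace F (n + 1)) : Prop :=
  IntegrableOn (fourierIntegrand E ν z) D volume

/-! ### Iwasawa normal form -/

/-- The entry `y'_i = y_i y_{i+1} ⋯ y_{n-1} ∈ F_∞` (with `y_j ∈ T_F = ∏_σ ℝ_{>0}`). -/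
def iwasawaDiag (y : Fin n → InfinitePlace F → ℝ) (i : Fin n) : mixedSpace F :=
  mixedSpaceOfRealSpace (∏ j ∈ Finset.Ici i, y j)

/-- The Iwasawa normal form `X Y`, with `Y = diag(y'_1, …, y'_n, 1)` (here of size `n + 1`). -/
def iwasawa (X : Matrix (Fin (n + 1)) (Fin (n + 1)) (mixedSpace F))
    (y : Fin n → InfinitePlace F → ℝ) : Matrix (Fin (n + 1)) (Fin (n + 1)) (mixedSpace F) :=
  X * Matrix.diagonal (Fin.lastCases (motive := fun _ => mixedSpace F) 1 (iwasawaDiag y))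

/-- The matrix `X^{(1)} Y^{(1)}`: `X^{(1)}` is the upper left block of `X`, and
`Y^{(1)} = diag(y'_1, …, y'_n)`. -/
def iwasawa₁ (X : Matrix (Fin (n + 1)) (Fin (n + 1)) (mixedSpace F))
    (y : Fin n → InfinitePlace F → ℝ) : Matrix (Fin n) (Fin n) (mixedSpace F) :=
  X.submatrix Fin.castSucc Fin.castSucc * Matrix.diagonal (iwasawaDiag y)

end EisFourier

end

open EisFourier

noncomputable section

set_option linter.unusedSectionVars false

namespace EisFourier
open scoped Classical
variable {F : Type*} [Field F] [NumberField F] {n : ℕ}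

/-! ### Contents of vectors -/

/-! The method is unfolding along the last coordinate. Multiplying a vector by `α` scales its term
by a power of `N(α)`. Hence every `E_{𝔟'→L}` with `𝔟'` in the class of `𝔟` is a norm power times
`E_{𝔟→L}`, and the sum over anti-integral ideals splits off `ζ_F(𝔟⁻¹, ns)` (`eisClass_eq`). So only
`E_{𝔟→L}` has to be expanded, and the identities are obtained without dividing by a zeta value.

A vector `(x, y)` of `L` lies in `L_𝔟` exactly when `∑ x_i 𝔞_i⁻¹ + y 𝔞_n⁻¹ = 𝔟⁻¹` (`mem_primVec`).
If `x = 0`, then `y` generates `𝔞_n 𝔟⁻¹`: this is one orbit when the classes of `𝔟` and `𝔞_n` agree,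
and its term does not depend on `ξ`. If `x ≠ 0`, then `x ∈ L^{(1)}_{𝔟𝔪⁻¹}` for a unique integral
`𝔪`, and `y` runs over the elements that generate `𝔠𝔪⁻¹/𝔠`, where `𝔠 = 𝔟⁻¹𝔪𝔞_n` (`snocVec_mem_iff`,
`decompEquiv`). Acting by `ξ` replaces `y` by `y + x·ξ` in a product over places of powers of `‖x
g^{(1)}_σ‖² + |·|²`. As `ξ ↦ x·ξ` is surjective and maps `N` into `𝔠`, summing `y` over a coset of
`𝔠` and integrating over `N\N(ℝ)` gives an integral over `F_∞` (`unfoldMeasure_eq`, `unfold_ideal`).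
If `ν` is not a multiple of `x`, the character is non-trivial on the kernel of the form and the
contribution vanishes (`hasSum_ideal_of_ne`).

For `ν = 0` every `x` contributes, with `φ(𝔪)` equal cosets. The local integrals are Gamma quotients
times `‖x g^{(1)}_σ‖^{-n_σ(ns-1)}`, which reassemble to Eisenstein series of `L^{(1)}` at
`(ns-1)/(n-1)` (`headSum_zero`). For `ν = μx ≠ 0` the cosets carry the weights `e^{2πi Tr(μr)}`,
which add up to `τ(𝔪, μ𝔠)`; here `μ𝔠 = 𝔫𝔡⁻¹` when `ν ∈ (N^∨)_{𝔫⁻¹}`, because contents in `N^∨` and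
in `L^{(1)}` differ by the fixed ideal `𝔞_n𝔡` (`princ_mul_stepIdeal`). Given `ν`, an ideal `𝔪` in
the right class admits exactly one orbit of such `x`, any other `𝔪` none (`exists_head`,
`head_unique`, `idealClass_head`). The local integrals are K-Bessel functions (`integral_rad_char`).

For convergence, each orbit modulo units has a representative with balanced coordinates, so the
series is dominated by a lattice sum (`summable_detFun`). The same bound in rank `n - 1`, with `φ(𝔪)
≤ N𝔪`, justifies integrating termwise, and the exponential decay of the K-Bessel function controls
the sum over `ν`. In the code the number of head coordinates is `n`, so the matrices have size `n +
1` there. -/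

/-- The fractional ideal `∑ x_i 𝔞_i⁻¹`, the inverse of `{α | α x ∈ ⊕ 𝔞_i}`. -/
def contentInv (a : Fin n → Frac F) (x : Fin n → F) : FractionalIdeal (𝓞 F)⁰ F :=
  ∑ i, FractionalIdeal.spanSingleton (𝓞 F)⁰ (x i) * ((a i)⁻¹ : Frac F)

/-- Invertibility of `b` turns membership into an inequality between ideals, so that all lattice
conditions below can be multiplied and added as ideals. -/
lemma mem_frac_iff (b : Frac F) (α : F) : α ∈ (b : FractionalIdeal (𝓞 F)⁰ F) ↔
    FractionalIdeal.spanSingleton (𝓞 F)⁰ α * ((b⁻¹ : Frac F) : FractionalIdeal (𝓞 F)⁰ F) ≤ 1 := by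
  rw [← FractionalIdeal.spanSingleton_le_iff_mem]
  constructor
  · intro h
    calc _ ≤ (b : FractionalIdeal (𝓞 F)⁰ F) * ((b⁻¹ : Frac F) : FractionalIdeal (𝓞 F)⁰ F) := by
          gcongr
      _ = 1 := Units.mul_inv b
  · intro h
    calc _ = FractionalIdeal.spanSingleton (𝓞 F)⁰ α *
        ((b⁻¹ : Frac F) : FractionalIdeal (𝓞 F)⁰ F) * (b : FractionalIdeal (𝓞 F)⁰ F) := by
          rw [mul_assoc, Units.inv_mul, mul_one]
      _ ≤ 1 * (b : FractionalIdeal (𝓞 F)⁰ F) := by gcongr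
      _ = _ := one_mul _

lemma mem_sumLattice {a : Fin n → Frac F} {x : Fin n → F} :
    x ∈ sumLattice a ↔ ∀ i, x i ∈ (a i : FractionalIdeal (𝓞 F)⁰ F) := by
  simp [sumLattice, Submodule.mem_pi]

lemma sum_le_iff {ι : Type*} (s : Finset ι) (f : ι → FractionalIdeal (𝓞 F)⁰ F)
    (J : FractionalIdeal (𝓞 F)⁰ F) : ∑ i ∈ s, f i ≤ J ↔ ∀ i ∈ s, f i ≤ J := by
  induction s using Finset.induction_on with
  | empty => simp
  | insert i s hi ih =>
    rw [Finset.sum_insert hi, ← FractionalIdeal.sup_eq_add, sup_le_iff, ih]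
    simp

/-- The coordinatewise conditions merge into one because a sum of fractional ideals is their
supremum. -/
lemma smul_mem_sumLattice {a : Fin n → Frac F} {x : Fin n → F} {α : F} :
    α • x ∈ sumLattice a ↔
      FractionalIdeal.spanSingleton (𝓞 F)⁰ α * contentInv a x ≤ 1 := by
  rw [mem_sumLattice, contentInv, Finset.mul_sum, sum_le_iff]
  simp only [mem_frac_iff, Finset.mem_univ, true_imp_iff, Pi.smul_apply, smul_eq_mul,
    ← FractionalIdeal.spanSingleton_mul_spanSingleton, mul_assoc]

lemma contentInv_ne_zero {a : Fin n → Frac F} {x : Fin n → F} (hx : x ≠ 0) :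
    contentInv a x ≠ 0 := by
  obtain ⟨i, hi⟩ := Function.ne_iff.mp hx
  intro h
  have h1 : FractionalIdeal.spanSingleton (𝓞 F)⁰ (x i) * ((a i)⁻¹ : Frac F) ≤ 0 := by
    rw [← h, contentInv]
    exact (sum_le_iff (F := F) Finset.univ (fun i => FractionalIdeal.spanSingleton (𝓞 F)⁰ (x i) *
      ((a i)⁻¹ : Frac F)) _).mp le_rfl i (Finset.mem_univ _)
  have h2 := le_antisymm h1 (FractionalIdeal.zero_le _)
  simp only [mul_eq_zero, FractionalIdeal.spanSingleton_eq_zero_iff, Units.ne_zero, or_false] at h2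
  exact hi h2

lemma frac_ext {b c : Frac F} (h : ∀ α : F, α ∈ (b : FractionalIdeal (𝓞 F)⁰ F) ↔
    α ∈ (c : FractionalIdeal (𝓞 F)⁰ F)) : b = c :=
  Units.ext (SetLike.ext h)

/-- The multipliers of `x` into the lattice form the inverse of the content ideal, so primitivity is
an equality of ideals. Membership of `x` itself is the multiplier `1`, whence the anti-integrality
of `b`. -/
lemma mem_primVec {a : Fin n → Frac F} {b : Frac F} {x : Fin n → F} :
    x ∈ primVec (sumLattice a) b ↔ x ≠ 0 ∧ (1 : F) ∈ (b : FractionalIdeal (𝓞 F)⁰ F) ∧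
      contentInv a x = ((b⁻¹ : Frac F) : FractionalIdeal (𝓞 F)⁰ F) := by
  constructor
  · rintro ⟨h1, h2, h3⟩
    refine ⟨h2, (h3 1).mp (by rwa [one_smul]), ?_⟩
    set k : Frac F := (Units.mk0 _ (contentInv_ne_zero (a := a) h2))⁻¹ with hk
    have hk' : contentInv a x = ((k⁻¹ : Frac F) : FractionalIdeal (𝓞 F)⁰ F) := by simp [hk]
    have : k = b := frac_ext fun α => by
      rw [← h3 α, smul_mem_sumLattice, hk', mem_frac_iff]
    rw [hk', this]
  · rintro ⟨h1, h2, h3⟩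
    have : ∀ α : F, α • x ∈ sumLattice a ↔ α ∈ (b : FractionalIdeal (𝓞 F)⁰ F) := fun α => by
      rw [smul_mem_sumLattice, h3, mem_frac_iff]
    exact ⟨by simpa using (this 1).mpr h2, h1, this⟩

lemma contentInv_smul (a : Fin n → Frac F) (x : Fin n → F) (α : F) :
    contentInv a (α • x) = FractionalIdeal.spanSingleton (𝓞 F)⁰ α * contentInv a x := by
  simp only [contentInv, Finset.mul_sum, Pi.smul_apply, smul_eq_mul,
    ← FractionalIdeal.spanSingleton_mul_spanSingleton, mul_assoc]

/-! ### Principal ideals, ideal classes and integral ideals. -/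

/-- A non-zero element as a principal fractional ideal. -/
def princ (α : F) (hα : α ≠ 0) : Frac F :=
  Units.mk0 (FractionalIdeal.spanSingleton (𝓞 F)⁰ α)
    (FractionalIdeal.spanSingleton_ne_zero_iff.mpr hα)

@[simp] lemma coe_princ (α : F) (hα : α ≠ 0) : ((princ α hα : Frac F) :
    FractionalIdeal (𝓞 F)⁰ F) = FractionalIdeal.spanSingleton (𝓞 F)⁰ α := rfl

lemma idealClass_mul (b c : Frac F) : idealClass (b * c) = idealClass b * idealClass c :=
  map_mul _ _ _

lemma idealClass_inv (b : Frac F) : idealClass b⁻¹ = (idealClass b)⁻¹ := map_inv _ _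

lemma idealClass_toFrac (m : (Ideal (𝓞 F))⁰) : idealClass (toFrac m : Frac F) = ClassGroup.mk0 m :=
  ClassGroup.mk_mk0 _ _

lemma idealClass_eq_one_iff (b : Frac F) : idealClass b = 1 ↔
    ∃ (α : F) (hα : α ≠ 0), b = princ α hα := by
  rw [idealClass, ClassGroup.mk_eq_one_iff, FractionalIdeal.isPrincipal_iff]
  constructor
  · rintro ⟨x, hx⟩
    have hx0 : x ≠ 0 := by
      rintro rfl
      exact b.ne_zero (by rw [hx, FractionalIdeal.spanSingleton_zero])
    exact ⟨x, hx0, Units.ext hx⟩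
  · rintro ⟨x, hx, rfl⟩
    exact ⟨x, rfl⟩

lemma idealClass_eq_iff (b c : Frac F) : idealClass b = idealClass c ↔
    ∃ (α : F) (hα : α ≠ 0), b = princ α hα * c := by
  rw [← mul_inv_eq_one, ← idealClass_inv, ← idealClass_mul, idealClass_eq_one_iff]
  simp only [mul_inv_eq_iff_eq_mul]

lemma princ_eq_iff {x y : F} (hx : x ≠ 0) (hy : y ≠ 0) :
    princ x hx = princ y hy ↔ ∃ u : (𝓞 F)ˣ, u • x = y := by
  rw [Units.ext_iff]
  exact FractionalIdeal.spanSingleton_eq_spanSingleton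

lemma princ_mul {x y : F} (hx : x ≠ 0) (hy : y ≠ 0) :
    princ (x * y) (mul_ne_zero hx hy) = princ x hx * princ y hy :=
  Units.ext (FractionalIdeal.spanSingleton_mul_spanSingleton x y).symm

lemma one_mem_iff (c : Frac F) : (1 : F) ∈ (c : FractionalIdeal (𝓞 F)⁰ F) ↔
    ((c⁻¹ : Frac F) : FractionalIdeal (𝓞 F)⁰ F) ≤ 1 := by
  rw [mem_frac_iff, FractionalIdeal.spanSingleton_one, one_mul]

lemma exists_toFrac_iff (c : Frac F) : (∃ m : (Ideal (𝓞 F))⁰, c = toFrac m) ↔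
    (c : FractionalIdeal (𝓞 F)⁰ F) ≤ 1 := by
  rw [FractionalIdeal.le_one_iff_exists_coeIdeal]
  constructor
  · rintro ⟨m, rfl⟩
    exact ⟨m, rfl⟩
  · rintro ⟨I, hI⟩
    have : I ≠ 0 := by
      rintro rfl
      exact c.ne_zero (by rw [← hI]; simp)
    exact ⟨⟨I, mem_nonZeroDivisors_iff_ne_zero.mpr this⟩, Units.ext hI.symm⟩

lemma toFrac_le_one (m : (Ideal (𝓞 F))⁰) :
    ((toFrac m : Frac F) : FractionalIdeal (𝓞 F)⁰ F) ≤ 1 := FractionalIdeal.coeIdeal_le_one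

lemma toFrac_injective : Function.Injective (toFrac : (Ideal (𝓞 F))⁰ → Frac F) := by
  intro m m' h
  have := congrArg (fun c : Frac F => (c : FractionalIdeal (𝓞 F)⁰ F)) h
  exact Subtype.ext (FractionalIdeal.coeIdeal_injective this)

lemma le_iff_mul_inv_le_one (b c : Frac F) :
    (b : FractionalIdeal (𝓞 F)⁰ F) ≤ c ↔
      ((b * c⁻¹ : Frac F) : FractionalIdeal (𝓞 F)⁰ F) ≤ 1 := by
  constructor
  · intro h
    calc ((b * c⁻¹ : Frac F) : FractionalIdeal (𝓞 F)⁰ F) ≤ ((c * c⁻¹ : Frac F) :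
        FractionalIdeal (𝓞 F)⁰ F) := by push_cast; gcongr
      _ = 1 := by simp
  · intro h
    calc (b : FractionalIdeal (𝓞 F)⁰ F) =
        ((b * c⁻¹ : Frac F) : FractionalIdeal (𝓞 F)⁰ F) * c := by
          rw [← Units.val_mul, inv_mul_cancel_right]
      _ ≤ 1 * c := by gcongr
      _ = c := one_mul _

/-! ### Norms of ideals -/

/-- The absolute norm of a fractional ideal, as a real number. -/
def fnorm (a : Frac F) : ℝ := ((FractionalIdeal.absNorm (a : FractionalIdeal (𝓞 F)⁰ F) : ℚ) : ℝ)

lemma idealNorm_eq (a : Frac F) : idealNorm a = (fnorm a : ℂ) := by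
  simp [idealNorm, fnorm]

lemma fnorm_pos (a : Frac F) : 0 < fnorm a := by
  rw [fnorm, Rat.cast_pos]
  exact lt_of_le_of_ne (FractionalIdeal.absNorm_nonneg _)
    (Ne.symm (FractionalIdeal.absNorm_eq_zero_iff.not.mpr a.ne_zero))

lemma fnorm_mul (a b : Frac F) : fnorm (a * b) = fnorm a * fnorm b := by
  simp [fnorm]

@[simp] lemma fnorm_one : fnorm (1 : Frac F) = 1 := by
  simp [fnorm]

lemma fnorm_inv (a : Frac F) : fnorm a⁻¹ = (fnorm a)⁻¹ := by
  refine eq_inv_of_mul_eq_one_left ?_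
  rw [← fnorm_mul, inv_mul_cancel, fnorm_one]

lemma fnorm_toFrac (m : (Ideal (𝓞 F))⁰) :
    fnorm (toFrac m : Frac F) = (Ideal.absNorm (m : Ideal (𝓞 F)) : ℝ) := by
  simp [fnorm, FractionalIdeal.coeIdeal_absNorm]

lemma one_le_fnorm_toFrac (m : (Ideal (𝓞 F))⁰) : 1 ≤ fnorm (toFrac m : Frac F) := by
  have h := fnorm_pos (toFrac m : Frac F)
  rw [fnorm_toFrac] at h ⊢
  exact_mod_cast h

lemma fnorm_princ (α : F) (hα : α ≠ 0) :
    fnorm (princ α hα) = ∏ σ : InfinitePlace F, σ α ^ σ.mult := by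
  rw [prod_eq_abs_norm, fnorm, coe_princ, FractionalIdeal.absNorm_span_singleton]

lemma ofReal_cpow_mul {x y : ℝ} (hx : 0 ≤ x) (hy : 0 ≤ y) (s : ℂ) :
    ((x * y : ℝ) : ℂ) ^ s = (x : ℂ) ^ s * (y : ℂ) ^ s := by
  rw [Complex.ofReal_mul, Complex.mul_cpow_ofReal_nonneg hx hy]

lemma ofReal_pow_cpow {x : ℝ} (hx : 0 ≤ x) (k : ℕ) (s : ℂ) :
    ((x ^ k : ℝ) : ℂ) ^ s = (x : ℂ) ^ (k * s) := by
  rw [mul_comm, Complex.cpow_mul_nat, Complex.ofReal_pow]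
  induction k with
  | zero => simp
  | succ k ih =>
    rw [pow_succ, ← Complex.ofReal_pow, Complex.mul_cpow_ofReal_nonneg (by positivity) hx,
      Complex.ofReal_pow, ih, pow_succ]

/-! ### Homogeneity of the Eisenstein series in the ideal -/

lemma rowNorm_smul (σ : InfinitePlace F) (c : mixedSpace F) (v : Fin n → mixedSpace F) :
    rowNorm σ (c • v) = normAtPlace σ c * rowNorm σ v := by
  simp only [rowNorm, Pi.smul_apply, smul_eq_mul, map_mul, mul_pow, ← Finset.mul_sum]
  rw [Real.sqrt_mul (sq_nonneg _), Real.sqrt_sq (normAtPlace_nonneg _ _)]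

lemma rowNorm_nonneg (σ : InfinitePlace F) (v : Fin n → mixedSpace F) : 0 ≤ rowNorm σ v :=
  Real.sqrt_nonneg _

lemma emb_smul (α : F) (x : Fin n → F) : emb (α • x) = mixedEmbedding F α • emb x := by
  funext i
  simp [emb]

/-- Homogeneity via the product formula: the norm at `σ` scales by `|α|_σ`, and the product of
`|α|_σ ^ n_σ` is the norm of the ideal `(α)`. -/
lemma detAux_smul (α : F) (hα : α ≠ 0) (x : Fin n → F) (g : GL (Fin n) (mixedSpace F)) :
    detAux x g = fnorm (princ α hα) ^ n * detAux (α • x) g := by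
  have h (σ : InfinitePlace F) : rowNorm σ (Matrix.vecMul (emb (α • x))
      (g : Matrix (Fin n) (Fin n) (mixedSpace F))) = σ α *
      rowNorm σ (Matrix.vecMul (emb x) (g : Matrix (Fin n) (Fin n) (mixedSpace F))) := by
    rw [emb_smul, Matrix.smul_vecMul, rowNorm_smul, normAtPlace_apply]
  have h2 : fnorm (princ α hα) ^ n = ∏ σ : InfinitePlace F, σ α ^ (n * σ.mult) := by
    rw [fnorm_princ, ← Finset.prod_pow]
    simp_rw [← pow_mul, mul_comm n]
  rw [h2, detAux, detAux, ← Finset.prod_mul_distrib]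
  refine Finset.prod_congr rfl fun σ _ => ?_
  have h3 : σ α ^ (n * σ.mult) ≠ 0 := pow_ne_zero _ ((map_ne_zero σ).mpr hα)
  rw [h, mul_pow, mul_div_assoc', mul_div_mul_left _ _ h3]

lemma detAux_nonneg (x : Fin n → F) (g : GL (Fin n) (mixedSpace F)) : 0 ≤ detAux x g :=
  Finset.prod_nonneg fun _ _ => div_nonneg (pow_nonneg (normAtPlace_nonneg _ _) _)
    (pow_nonneg (rowNorm_nonneg _ _) _)

/-- Vectors modulo units. -/
abbrev Orbits (F : Type*) [Field F] [NumberField F] (n : ℕ) : Type _ :=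
  MulAction.orbitRel.Quotient (𝓞 F)ˣ (Fin n → F)

/-- The class of a vector modulo units. -/
def toOrbit (x : Fin n → F) : Orbits F n := Quotient.mk _ x

lemma toOrbit_eq_iff {x y : Fin n → F} : toOrbit x = toOrbit y ↔ ∃ u : (𝓞 F)ˣ, u • y = x :=
  Quotient.eq.trans Iff.rfl

lemma detFun_mk (x : Fin n → F) (g : GL (Fin n) (mixedSpace F)) :
    detFun (toOrbit x) (QuotientGroup.mk g) = detAux x g := rfl

lemma unit_smul_eq (u : (𝓞 F)ˣ) (x : Fin n → F) : u • x = ((u : 𝓞 F) : F) • x := by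
  funext i
  simp [Units.smul_def, Algebra.smul_def]

lemma spanSingleton_unit (u : (𝓞 F)ˣ) :
    FractionalIdeal.spanSingleton (𝓞 F)⁰ ((u : 𝓞 F) : F) = 1 := by
  rw [← FractionalIdeal.spanSingleton_one, FractionalIdeal.spanSingleton_eq_spanSingleton]
  refine ⟨u⁻¹, ?_⟩
  rw [Units.smul_def, Algebra.smul_def, ← map_mul]
  simp

lemma contentInv_unit_smul (a : Fin n → Frac F) (x : Fin n → F) (u : (𝓞 F)ˣ) :
    contentInv a (u • x) = contentInv a x := by
  rw [unit_smul_eq, contentInv_smul, spanSingleton_unit, one_mul]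

lemma unit_smul_mem_primVec {a : Fin n → Frac F} {b : Frac F} {x : Fin n → F} (u : (𝓞 F)ˣ) :
    u • x ∈ primVec (sumLattice a) b ↔ x ∈ primVec (sumLattice a) b := by
  rw [mem_primVec, mem_primVec, contentInv_unit_smul, ne_eq, smul_eq_zero_iff_eq]

lemma toOrbit_mem_primOrbits {a : Fin n → Frac F} {b : Frac F} {x : Fin n → F} :
    toOrbit x ∈ primOrbits (sumLattice a) b ↔ x ∈ primVec (sumLattice a) b := by
  constructor
  · rintro ⟨y, hy, hxy⟩
    obtain ⟨u, rfl⟩ := toOrbit_eq_iff.mp hxy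
    exact (unit_smul_mem_primVec u).mp hy
  · exact fun h => ⟨x, h, rfl⟩

/-- Multiplication by a non-zero scalar on orbits. -/
def orbitSMul (α : F) : Orbits F n → Orbits F n :=
  Quotient.map (α • ·) fun x y h => by
    obtain ⟨u, rfl⟩ := h
    exact ⟨u, by simp only [unit_smul_eq, smul_smul, mul_comm]⟩

/-- Contents scale by `(α)`. Both ideals must be anti-integral, since otherwise the corresponding
set of primitive vectors is empty. -/
lemma smul_mem_primVec {a : Fin n → Frac F} {b b' : Frac F}
    (hb : (1 : F) ∈ (b : FractionalIdeal (𝓞 F)⁰ F))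
    (hb' : (1 : F) ∈ (b' : FractionalIdeal (𝓞 F)⁰ F)) (α : F) (hα : α ≠ 0)
    (h : b' = princ α hα * b) (x : Fin n → F) :
    α • x ∈ primVec (sumLattice a) b ↔ x ∈ primVec (sumLattice a) b' := by
  rw [mem_primVec, mem_primVec, contentInv_smul, ne_eq, smul_eq_zero_iff_right hα, ← coe_princ α hα,
    ← Units.eq_inv_mul_iff_mul_eq, h, mul_inv, Units.val_mul (princ α hα)⁻¹, ← h]
  simp only [hb, hb', ne_eq]

lemma orbitSMul_inv (α : F) (hα : α ≠ 0) (q : Orbits F n) :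
    orbitSMul α⁻¹ (orbitSMul α q) = q := by
  induction q using Quotient.inductionOn with
  | h x => exact congrArg toOrbit (inv_smul_smul₀ hα x)

lemma orbitSMul_mem {a : Fin n → Frac F} {b b' : Frac F}
    (hb : (1 : F) ∈ (b : FractionalIdeal (𝓞 F)⁰ F))
    (hb' : (1 : F) ∈ (b' : FractionalIdeal (𝓞 F)⁰ F)) (α : F) (hα : α ≠ 0)
    (h : b' = princ α hα * b) (q : Orbits F n) :
    orbitSMul α q ∈ primOrbits (sumLattice a) b ↔ q ∈ primOrbits (sumLattice a) b' := by
  induction q using Quotient.inductionOn with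
  | h x =>
    exact (toOrbit_mem_primOrbits (x := α • x)).trans
      ((smul_mem_primVec hb hb' α hα h x).trans (toOrbit_mem_primOrbits (x := x)).symm)

lemma detFun_smul (α : F) (hα : α ≠ 0) (q : Orbits F n) (z : UpperSpace F n) :
    detFun q z = fnorm (princ α hα) ^ n * detFun (orbitSMul α q) z := by
  induction q using Quotient.inductionOn with
  | h x =>
    induction z using Quotient.inductionOn' with
    | h g => exact detAux_smul α hα x g

lemma detFun_nonneg (q : Orbits F n) (z : UpperSpace F n) : 0 ≤ detFun q z := by
  induction q using Quotient.inductionOn with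
  | h x =>
    induction z using Quotient.inductionOn' with
    | h g => exact detAux_nonneg x g

/-- The map `x ↦ αx` is a bijection between the two orbit sets and rescales every term by the same
factor. -/
lemma eisIdeal_smul {a : Fin n → Frac F} {b b' : Frac F}
    (hb : (1 : F) ∈ (b : FractionalIdeal (𝓞 F)⁰ F))
    (hb' : (1 : F) ∈ (b' : FractionalIdeal (𝓞 F)⁰ F)) (α : F) (hα : α ≠ 0)
    (h : b' = princ α hα * b) (z : UpperSpace F n) (s : ℂ) :
    eisIdeal (sumLattice a) b' z s =
      (fnorm (princ α hα) : ℂ) ^ (n * s) * eisIdeal (sumLattice a) b z s := by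
  rw [eisIdeal, eisIdeal, ← tsum_mul_left]
  let e : primOrbits (sumLattice a) b' ≃ primOrbits (sumLattice a) b :=
    { toFun := fun q => ⟨orbitSMul α q.1, (orbitSMul_mem hb hb' α hα h q.1).mpr q.2⟩
      invFun := fun q => ⟨orbitSMul α⁻¹ q.1, by
        rw [← orbitSMul_mem hb hb' α hα h]
        have := orbitSMul_inv α⁻¹ (inv_ne_zero hα) q.1
        rw [inv_inv] at this
        rw [this]
        exact q.2⟩
      left_inv := fun q => Subtype.ext (orbitSMul_inv α hα q.1)
      right_inv := fun q => Subtype.ext (by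
        have := orbitSMul_inv α⁻¹ (inv_ne_zero hα) q.1
        rwa [inv_inv] at this) }
  rw [← e.tsum_eq]
  refine tsum_congr fun q => ?_
  rw [detFun_smul α hα, ofReal_cpow_mul (pow_nonneg (fnorm_pos _).le _) (detFun_nonneg _ _),
    ofReal_pow_cpow (fnorm_pos _).le]
  rfl

/-- Anti-integral ideals are the inverses of the integral ideals. -/
def antiIntegralEquiv (b : Frac F) :
    {k : (Ideal (𝓞 F))⁰ // ClassGroup.mk0 k = idealClass b⁻¹} ≃ antiIntegral (idealClass b) :=
  Equiv.ofBijective (fun k => ⟨(toFrac k.1)⁻¹, by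
    refine ⟨(one_mem_iff _).mpr (by rw [inv_inv]; exact toFrac_le_one k.1), ?_⟩
    rw [idealClass_inv, idealClass_toFrac, k.2, idealClass_inv, inv_inv]⟩) (by
    constructor
    · intro k k' h
      exact Subtype.ext (toFrac_injective (inv_injective (Subtype.ext_iff.mp h)))
    · rintro ⟨c, hc1, hc2⟩
      obtain ⟨k, hk⟩ := (exists_toFrac_iff c⁻¹).mpr ((one_mem_iff c).mp hc1)
      refine ⟨⟨k, ?_⟩, Subtype.ext ?_⟩
      · rw [← idealClass_toFrac, ← hk, idealClass_inv, idealClass_inv, hc2]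
      · simp only [← hk, inv_inv])

/-- An anti-integral ideal in the class of `b` is `𝔨⁻¹` with `𝔨` integral, and `𝔨⁻¹ = αb` forces
`N(α) = (N𝔨 · Nb)⁻¹`. Homogeneity then leaves the sum of `N𝔨^{-ns}`. Scalars pull out of a `tsum` in
`ℂ` unconditionally, so no convergence enters. -/
theorem eisClass_eq {a : Fin n → Frac F} {b : Frac F}
    (hb : (1 : F) ∈ (b : FractionalIdeal (𝓞 F)⁰ F)) (z : UpperSpace F n) (s : ℂ) :
    eisClass (sumLattice a) (idealClass b) z s = partialZeta (idealClass b⁻¹) (n * s) *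
      (idealNorm b ^ (-(n * s)) * eisIdeal (sumLattice a) b z s) := by
  rw [eisClass, partialZeta, ← tsum_mul_right, ← (antiIntegralEquiv b).tsum_eq]
  refine tsum_congr fun k => ?_
  have h1 := (antiIntegralEquiv b k).2
  obtain ⟨α, hα, h⟩ := (idealClass_eq_iff _ _).mp h1.2
  rw [eisIdeal_smul hb h1.1 α hα h, zetaTerm, ← mul_assoc]
  congr 1
  have h2 : fnorm (princ α hα) = (fnorm (toFrac k.1 : Frac F) * fnorm b)⁻¹ := by
    have h3 : princ α hα = (toFrac k.1 * b)⁻¹ := by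
      rw [eq_mul_inv_of_mul_eq h.symm, mul_inv]
      rfl
    rw [h3, fnorm_inv, fnorm_mul]
  rw [h2, idealNorm_eq, idealNorm_eq, ← ofReal_cpow_mul (fnorm_pos _).le (fnorm_pos _).le,
    Complex.ofReal_inv, Complex.inv_cpow, Complex.cpow_neg]
  rw [Complex.arg_ofReal_of_nonneg (mul_pos (fnorm_pos _) (fnorm_pos _)).le]
  exact Real.pi_pos.ne

/-! ### Reduction modulo units and absolute convergence -/

lemma normAtPlace_le_rowNorm (σ : InfinitePlace F) (v : Fin n → mixedSpace F) (i : Fin n) :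
    normAtPlace σ (v i) ≤ rowNorm σ v := by
  refine Real.le_sqrt_of_sq_le ?_
  exact Finset.single_le_sum (f := fun i => normAtPlace σ (v i) ^ 2)
    (fun i _ => sq_nonneg _) (Finset.mem_univ i)

lemma normAtPlace_sum_le (σ : InfinitePlace F) {ι : Type*} (s : Finset ι) (f : ι → mixedSpace F) :
    normAtPlace σ (∑ i ∈ s, f i) ≤ ∑ i ∈ s, normAtPlace σ (f i) := by
  induction s using Finset.induction_on with
  | empty => simp
  | insert i s hi ih =>
    rw [Finset.sum_insert hi, Finset.sum_insert hi]
    exact (normAtPlace_add_le _ _ _).trans (by gcongr)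

/-- Write `v = (vg)g⁻¹`. The constant is the sum of the sizes of all entries of `g⁻¹`, increased by
`1` to make it positive. -/
lemma exists_normAtPlace_le (g : GL (Fin n) (mixedSpace F)) :
    ∃ C : ℝ, 0 < C ∧ ∀ (v : Fin n → mixedSpace F) (σ : InfinitePlace F) (j : Fin n),
      normAtPlace σ (v j) ≤ C * rowNorm σ (Matrix.vecMul v (g : Matrix (Fin n) (Fin n) _)) := by
  set h : Matrix (Fin n) (Fin n) (mixedSpace F) := ((g⁻¹ : GL (Fin n) (mixedSpace F)) : Matrix (Fin n) (Fin n) (mixedSpace F)) with hh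
  refine ⟨1 + ∑ σ : InfinitePlace F, ∑ i, ∑ j, normAtPlace σ (h i j), ?_, fun v σ j => ?_⟩
  · have : 0 ≤ ∑ σ : InfinitePlace F, ∑ i, ∑ j, normAtPlace σ (h i j) :=
      Finset.sum_nonneg fun _ _ => Finset.sum_nonneg fun _ _ => Finset.sum_nonneg fun _ _ =>
        normAtPlace_nonneg _ _
    linarith
  · set w := Matrix.vecMul v (g : Matrix (Fin n) (Fin n) (mixedSpace F)) with hw
    have hv : v = Matrix.vecMul w h := by
      rw [hw, hh, Matrix.vecMul_vecMul, ← Units.val_mul, mul_inv_cancel, Units.val_one,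
        Matrix.vecMul_one]
    have h1 : ∑ i, normAtPlace σ (h i j) ≤
        ∑ σ : InfinitePlace F, ∑ i, ∑ j, normAtPlace σ (h i j) := by
      refine le_trans (Finset.sum_le_sum fun i _ => Finset.single_le_sum
        (f := fun j => normAtPlace σ (h i j)) (fun _ _ => normAtPlace_nonneg _ _)
        (Finset.mem_univ j)) ?_
      exact Finset.single_le_sum (f := fun σ => ∑ i, ∑ j, normAtPlace σ (h i j))
        (fun _ _ => Finset.sum_nonneg fun _ _ => Finset.sum_nonneg fun _ _ =>
        normAtPlace_nonneg _ _) (Finset.mem_univ σ)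
    calc normAtPlace σ (v j) = normAtPlace σ (∑ i, w i * h i j) := by
          rw [hv]; rfl
      _ ≤ ∑ i, normAtPlace σ (w i * h i j) := normAtPlace_sum_le _ _ _
      _ ≤ ∑ i, rowNorm σ w * normAtPlace σ (h i j) := by
          refine Finset.sum_le_sum fun i _ => ?_
          rw [map_mul]
          exact mul_le_mul_of_nonneg_right (normAtPlace_le_rowNorm _ _ _) (normAtPlace_nonneg _ _)
      _ = (∑ i, normAtPlace σ (h i j)) * rowNorm σ w := by
          rw [← Finset.mul_sum, mul_comm]
      _ ≤ _ := mul_le_mul_of_nonneg_right (by linarith) (rowNorm_nonneg _ _)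

/-- This is the content of Dirichlet's unit theorem needed here: a unit moves any vector into the
fundamental cone, and the part of the cone of norm at most one is bounded. -/
lemma exists_balancing_unit (F : Type*) [Field F] [NumberField F] :
    ∃ C : ℝ, 0 < C ∧ ∀ r : InfinitePlace F → ℝ, (∀ σ, 0 < r σ) → ∃ u : (𝓞 F)ˣ,
      ∀ σ : InfinitePlace F, σ ((u : 𝓞 F) : F) * r σ ≤
        C * (∏ σ, r σ ^ σ.mult) ^ ((Module.finrank ℚ F : ℝ)⁻¹) := by
  obtain ⟨C, hC⟩ := (fundamentalCone.isBounded_normLeOne F).exists_norm_le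
  refine ⟨max C 1, by positivity, fun r hr => ?_⟩
  set w : mixedSpace F := mixedSpaceOfRealSpace r with hw
  have hwn (σ : InfinitePlace F) : normAtPlace σ w = r σ :=
    normAtPlace_mixedSpaceOfRealSpace (hr σ).le
  have hN : mixedEmbedding.norm w = ∏ σ, r σ ^ σ.mult := by
    rw [mixedEmbedding.norm_apply]
    simp_rw [hwn]
  have hP : 0 < ∏ σ, r σ ^ σ.mult := Finset.prod_pos fun σ _ => pow_pos (hr σ) _
  set P := ∏ σ, r σ ^ σ.mult with hPdef
  obtain ⟨u, hu⟩ := fundamentalCone.exists_unit_smul_mem (x := w) (by rw [hN]; exact hP.ne')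
  refine ⟨u, fun σ => ?_⟩
  set d : ℝ := (Module.finrank ℚ F : ℝ) with hd
  have hd0 : Module.finrank ℚ F ≠ 0 := Module.finrank_pos.ne'
  set c : ℝ := P ^ d⁻¹ with hc
  have hc0 : 0 < c := Real.rpow_pos_of_pos hP _
  have hcd : c ^ Module.finrank ℚ F = P := by
    rw [hc, ← Real.rpow_natCast, ← Real.rpow_mul hP.le, inv_mul_cancel₀ (Nat.cast_ne_zero.mpr hd0),
      Real.rpow_one]
  -- Dividing by `c = P^{1/d}` normalises the norm to one, since scaling by a real number changes
  -- the norm by its `d`-th power.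
  have hmem : c⁻¹ • (u • w) ∈ fundamentalCone.normLeOne F := by
    refine fundamentalCone.mem_normLeOne.mpr
      ⟨fundamentalCone.smul_mem_of_mem hu (inv_ne_zero hc0.ne'), ?_⟩
    rw [mixedEmbedding.norm_smul, norm_unit_smul, hN, abs_of_pos (inv_pos.mpr hc0), inv_pow, hcd,
      inv_mul_cancel₀ hP.ne']
  have h1 : normAtPlace σ (c⁻¹ • (u • w)) ≤ max C 1 := by
    refine le_trans ?_ ((hC _ hmem).trans (le_max_left _ _))
    rw [norm_eq_sup'_normAtPlace]
    exact Finset.le_sup' (fun τ => normAtPlace τ (c⁻¹ • (u • w))) (Finset.mem_univ σ)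
  rw [normAtPlace_smul, abs_of_pos (inv_pos.mpr hc0), inv_mul_le_iff₀ hc0, mul_comm] at h1
  rw [show u • w = mixedEmbedding F ((u : 𝓞 F) : F) * w from rfl, map_mul, normAtPlace_apply, hwn]
    at h1
  exact h1

/-! ### Lattices in `F_∞^n` and absolute convergence of the Eisenstein series. -/

/-- A real basis of `F_∞^n` that is a `ℤ`-basis of the image of `⊕ 𝔞_i`. -/
def vecBasis (a : Fin n → Frac F) :
    Module.Basis ((i : Fin n) × Module.Free.ChooseBasisIndex ℤ (a i : FractionalIdeal (𝓞 F)⁰ F)) ℝ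
      (Fin n → mixedSpace F) :=
  Pi.basis fun i => fractionalIdealLatticeBasis F (a i)

/-- The image of `⊕ 𝔞_i` in `F_∞^n`. -/
abbrev vecLattice (a : Fin n → Frac F) : Submodule ℤ (Fin n → mixedSpace F) :=
  Submodule.span ℤ (Set.range (vecBasis a))

lemma mem_span_pi_basis {ι : Type*} [Fintype ι] {η : ι → Type*} [∀ i, Fintype (η i)]
    {V : ι → Type*} [∀ i, AddCommGroup (V i)] [∀ i, Module ℝ (V i)]
    (b : ∀ i, Module.Basis (η i) ℝ (V i)) (x : ∀ i, V i) :
    x ∈ Submodule.span ℤ (Set.range (Pi.basis b)) ↔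
      ∀ i, x i ∈ Submodule.span ℤ (Set.range (b i)) := by
  simp only [Module.Basis.mem_span_iff_repr_mem, Pi.basis_repr, Sigma.forall]

lemma mem_vecLattice {a : Fin n → Frac F} {v : Fin n → mixedSpace F} :
    v ∈ vecLattice a ↔ ∃ x ∈ sumLattice a, emb x = v := by
  rw [vecLattice, vecBasis, mem_span_pi_basis]
  simp_rw [mem_span_fractionalIdealLatticeBasis, mem_sumLattice]
  constructor
  · intro h
    choose x hx hx' using h
    exact ⟨x, hx, funext hx'⟩
  · rintro ⟨x, hx, rfl⟩ i
    exact ⟨x i, hx i, rfl⟩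

lemma finrank_vec : Module.finrank ℝ (Fin n → mixedSpace F) = n * Module.finrank ℚ F := by
  rw [Module.finrank_pi_fintype]
  simp only [mixedEmbedding.finrank, Finset.sum_const, Finset.card_univ, Fintype.card_fin,
    smul_eq_mul]

lemma summable_norm_vecLattice (a : Fin n → Frac F) {r : ℝ}
    (hr : r < -(n * Module.finrank ℚ F : ℕ)) : Summable fun v : vecLattice a => ‖v‖ ^ r := by
  refine ZLattice.summable_norm_rpow _ r ?_
  rwa [ZLattice.rank ℝ, finrank_vec]

lemma norm_le_of_normAtPlace_le {v : Fin n → mixedSpace F} {R : ℝ} (hR : 0 ≤ R)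
    (h : ∀ i σ, normAtPlace σ (v i) ≤ R) : ‖v‖ ≤ R := by
  refine (pi_norm_le_iff_of_nonneg hR).mpr fun i => ?_
  rw [norm_eq_sup'_normAtPlace]
  exact Finset.sup'_le _ _ fun σ _ => h i σ

lemma emb_injective : Function.Injective (emb : (Fin n → F) → Fin n → mixedSpace F) :=
  fun _ _ h => funext fun i => mixedEmbedding_injective F (congrFun h i)

lemma rowNorm_pos (g : GL (Fin n) (mixedSpace F)) {x : Fin n → F} (hx : x ≠ 0)
    (σ : InfinitePlace F) :
    0 < rowNorm σ (Matrix.vecMul (emb x) (g : Matrix (Fin n) (Fin n) (mixedSpace F))) := by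
  obtain ⟨C, hC, h⟩ := exists_normAtPlace_le g
  obtain ⟨i, hi⟩ := Function.ne_iff.mp hx
  have h1 := h (emb x) σ i
  rw [emb, normAtPlace_apply] at h1
  have h2 : 0 < σ (x i) := InfinitePlace.pos_iff.mpr hi
  exact pos_of_mul_pos_right (h2.trans_le h1) hC.le

lemma detAux_eq (x : Fin n → F) (g : GL (Fin n) (mixedSpace F)) :
    detAux x g = (∏ σ : InfinitePlace F,
      normAtPlace σ (g : Matrix (Fin n) (Fin n) (mixedSpace F)).det ^ σ.mult) /
      (∏ σ : InfinitePlace F,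
        rowNorm σ (Matrix.vecMul (emb x) (g : Matrix (Fin n) (Fin n) (mixedSpace F))) ^ σ.mult) ^ n := by
  rw [detAux, Finset.prod_div_distrib, ← Finset.prod_pow]
  simp_rw [← pow_mul, mul_comm n]

/-- After balancing by a unit all coordinates of `x` are at most a constant times `P^{1/d}`, where
`P` is the product of the local norms, so `P^n` is at least a constant times `‖x‖^{nd}`. -/
lemma exists_detAux_le (g : GL (Fin n) (mixedSpace F)) :
    ∃ C : ℝ, 0 < C ∧ ∀ x : Fin n → F, x ≠ 0 → ∃ u : (𝓞 F)ˣ,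
      detAux x g ≤ C * ‖emb (u • x)‖ ^ (-(n * Module.finrank ℚ F : ℕ) : ℝ) := by
  obtain ⟨C₁, hC₁, h₁⟩ := exists_normAtPlace_le g
  obtain ⟨C₂, hC₂, h₂⟩ := exists_balancing_unit F
  set D := ∏ σ : InfinitePlace F,
      normAtPlace σ (g : Matrix (Fin n) (Fin n) (mixedSpace F)).det ^ σ.mult with hD
  have hD0 : 0 ≤ D := Finset.prod_nonneg fun σ _ => pow_nonneg (normAtPlace_nonneg _ _) _
  set d := Module.finrank ℚ F with hd
  have hd0 : d ≠ 0 := Module.finrank_pos.ne'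
  -- `D + 1` replaces `D` only to make the constant visibly positive.
  refine ⟨(D + 1) * (C₁ * C₂) ^ (n * d), by positivity, fun x hx => ?_⟩
  obtain ⟨u, hu⟩ := h₂ _ (rowNorm_pos g hx)
  refine ⟨u, ?_⟩
  rw [detAux_eq, ← hD]
  set P := ∏ σ : InfinitePlace F,
        rowNorm σ (Matrix.vecMul (emb x) (g : Matrix (Fin n) (Fin n) (mixedSpace F))) ^ σ.mult with hP
  have hP0 : 0 < P := Finset.prod_pos fun σ _ => pow_pos (rowNorm_pos g hx σ) _
  set c := P ^ ((d : ℝ)⁻¹) with hc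
  have hc0 : 0 < c := Real.rpow_pos_of_pos hP0 _
  have hcd : c ^ d = P := by
    rw [hc, ← Real.rpow_natCast, ← Real.rpow_mul hP0.le, inv_mul_cancel₀ (by exact_mod_cast hd0),
      Real.rpow_one]
  have hle : ‖emb (u • x)‖ ≤ C₁ * C₂ * c := by
    refine norm_le_of_normAtPlace_le (by positivity) fun i σ => ?_
    refine (h₁ _ σ i).trans ?_
    rw [mul_assoc]
    refine mul_le_mul_of_nonneg_left ?_ hC₁.le
    rw [unit_smul_eq, emb_smul, Matrix.smul_vecMul, rowNorm_smul, normAtPlace_apply]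
    exact hu σ
  have hpos : 0 < ‖emb (u • x)‖ := by
    rw [norm_pos_iff]
    intro h0
    have h1 : u • x = 0 := emb_injective (h0.trans (by funext i; simp [emb]))
    exact hx ((smul_eq_zero_iff_eq u).mp h1)
  rw [Real.rpow_neg hpos.le, Real.rpow_natCast, ← div_eq_mul_inv, ← hcd, ← pow_mul, mul_comm d n,
    div_le_div_iff₀ (by positivity) (by positivity), mul_assoc (D + 1), ← mul_pow]
  exact mul_le_mul (by linarith) (pow_le_pow_left₀ hpos.le hle _) (by positivity) (by positivity)

/-- The orbits of the non-zero vectors of a lattice. -/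
def latticeOrbits (a : Fin n → Frac F) : Set (Orbits F n) :=
  toOrbit '' {x | x ∈ sumLattice a ∧ x ≠ 0}

/-- Balanced representatives embed the orbits into a lattice of rank `nd`, and the terms are bounded
by `‖x‖^{-ndt}` with `t > 1`. All convergence statements for Eisenstein and zeta series reduce to
this one. -/
theorem summable_detFun (hn : n ≠ 0) (a : Fin n → Frac F) (z : UpperSpace F n) {t : ℝ}
    (ht : 1 < t) : Summable fun q : latticeOrbits a => detFun q.1 z ^ t := by
  induction z using Quotient.inductionOn' with
  | h g =>
    obtain ⟨C, hC, h⟩ := exists_detAux_le g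
    have key : ∀ q : latticeOrbits a, ∃ x, toOrbit x = q.1 ∧ x ∈ sumLattice a ∧
        detFun q.1 (Quotient.mk'' g) ≤ C * ‖emb x‖ ^ (-(n * Module.finrank ℚ F : ℕ) : ℝ) := by
      rintro ⟨_, x, ⟨hx, hx0⟩, rfl⟩
      obtain ⟨u, hu⟩ := h x hx0
      refine ⟨u • x, toOrbit_eq_iff.mpr ⟨u, rfl⟩, ?_, hu⟩
      exact Submodule.smul_mem _ (u : 𝓞 F) hx
    choose x hx1 hx2 hx3 using key
    have hinj : Function.Injective (fun q : latticeOrbits a =>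
        (⟨emb (x q), mem_vecLattice.mpr ⟨x q, hx2 q, rfl⟩⟩ : vecLattice a)) := by
      intro q q' hq
      have := emb_injective (Subtype.ext_iff.mp hq)
      exact Subtype.ext (by rw [← hx1 q, ← hx1 q', this])
    have hd : 0 < Module.finrank ℚ F := Module.finrank_pos
    have hs := ((summable_norm_vecLattice a (r := -(n * Module.finrank ℚ F : ℕ) * t) (by
      have : (0 : ℝ) < (n * Module.finrank ℚ F : ℕ) := by
        exact_mod_cast Nat.mul_pos (Nat.pos_of_ne_zero hn) hd
      nlinarith)).comp_injective hinj).mul_left (C ^ t)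
    refine Summable.of_nonneg_of_le (fun q => Real.rpow_nonneg (detFun_nonneg _ _) _)
      (fun q => ?_) hs
    refine (Real.rpow_le_rpow (detFun_nonneg _ _) (hx3 q) (by linarith)).trans ?_
    rw [Real.mul_rpow hC.le (by positivity), ← Real.rpow_mul (norm_nonneg _)]
    rfl

lemma detFun_pos {a : Fin n → Frac F} {q : Orbits F n} (hq : q ∈ latticeOrbits a)
    (z : UpperSpace F n) : 0 < detFun q z := by
  obtain ⟨x, ⟨-, hx⟩, rfl⟩ := hq
  induction z using Quotient.inductionOn' with
  | h g =>
    refine Finset.prod_pos fun σ _ => div_pos (pow_pos ?_ _) (pow_pos (rowNorm_pos g hx σ) _)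
    have : IsUnit (g : Matrix (Fin n) (Fin n) (mixedSpace F)).det :=
      (Matrix.isUnit_iff_isUnit_det _).mp g.isUnit
    exact lt_of_le_of_ne (normAtPlace_nonneg _ _) (this.map (normAtPlace σ)).ne_zero.symm

lemma primOrbits_subset (a : Fin n → Frac F) (b : Frac F) :
    primOrbits (sumLattice a) b ⊆ latticeOrbits a := by
  rintro _ ⟨x, hx, rfl⟩
  exact ⟨x, ⟨hx.1, hx.2.1⟩, rfl⟩

lemma eq_of_mem_primOrbits {a : Fin n → Frac F} {b c : Frac F} {q : Orbits F n}
    (hb : q ∈ primOrbits (sumLattice a) b) (hc : q ∈ primOrbits (sumLattice a) c) : b = c := by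
  obtain ⟨x, hx, rfl⟩ := hb
  have hc' := toOrbit_mem_primOrbits.mp hc
  have h1 := (mem_primVec.mp hx).2.2
  rw [(mem_primVec.mp hc').2.2] at h1
  exact (inv_injective (Units.ext h1)).symm

lemma norm_detFun_cpow {a : Fin n → Frac F} {q : Orbits F n} (hq : q ∈ latticeOrbits a)
    (z : UpperSpace F n) (s : ℂ) : ‖(detFun q z : ℂ) ^ s‖ = detFun q z ^ s.re :=
  Complex.norm_cpow_eq_rpow_re_of_pos (detFun_pos hq z) s

theorem eisConverges (hn : n ≠ 0) (a : Fin n → Frac F) (A : ClassGroup (𝓞 F)) (z : UpperSpace F n)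
    {s : ℂ} (hs : 1 < s.re) : EisConverges (sumLattice a) A z s := by
  rw [EisConverges]
  have hinj : Function.Injective (fun p : (b : antiIntegral A) × primOrbits (sumLattice a) b.1 =>
      (⟨p.2.1, primOrbits_subset _ _ p.2.2⟩ : latticeOrbits a)) := by
    rintro ⟨b, q, hq⟩ ⟨c, q', hq'⟩ h
    obtain rfl : q = q' := Subtype.ext_iff.mp h
    obtain rfl : b = c := Subtype.ext (eq_of_mem_primOrbits hq hq')
    rfl
  refine ((summable_detFun hn a z hs).comp_injective hinj).congr fun p => ?_
  rw [norm_detFun_cpow (primOrbits_subset _ _ p.2.2)]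
  rfl

/-- A fractional ideal in a given ideal class. -/
lemma exists_idealClass_eq (A : ClassGroup (𝓞 F)) : ∃ a : Frac F, idealClass a = A := by
  obtain ⟨I, rfl⟩ := ClassGroup.mk0_surjective A
  exact ⟨toFrac I, idealClass_toFrac I⟩

/-- For a fixed `𝔞` in the inverse class, `𝔟𝔞 = (α)` identifies the ideals `𝔟` with elements `α ∈ 𝔞`
modulo units. The series is thus the rank one case of the lattice sum at `g = 1`. -/
theorem summable_fnorm_class (A : ClassGroup (𝓞 F)) {t : ℝ} (ht : 1 < t) :
    Summable fun b : {b : (Ideal (𝓞 F))⁰ // ClassGroup.mk0 b = A} =>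
      fnorm (toFrac b.1 : Frac F) ^ (-t) := by
  obtain ⟨a, ha⟩ := exists_idealClass_eq A⁻¹
  have key : ∀ b : {b : (Ideal (𝓞 F))⁰ // ClassGroup.mk0 b = A}, ∃ (α : F) (hα : α ≠ 0),
      toFrac b.1 * a = princ α hα := fun b => by
    rw [← idealClass_eq_one_iff, idealClass_mul, idealClass_toFrac, b.2, ha, mul_inv_cancel]
  choose α hα h using key
  have hmem (b) : α b ∈ (a : FractionalIdeal (𝓞 F)⁰ F) := by
    rw [mem_frac_iff, ← coe_princ _ (hα b), ← Units.val_mul, ← h, mul_inv_cancel_right]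
    exact toFrac_le_one _
  set a' : Fin 1 → Frac F := fun _ => a
  set x : {b : (Ideal (𝓞 F))⁰ // ClassGroup.mk0 b = A} → Fin 1 → F := fun b _ => α b with hx
  have hxmem (b) : toOrbit (x b) ∈ latticeOrbits a' :=
    ⟨x b, ⟨mem_sumLattice.mpr fun _ => hmem b, fun h0 => hα b (congrFun h0 0)⟩, rfl⟩
  have hinj : Function.Injective (fun b => (⟨toOrbit (x b), hxmem b⟩ : latticeOrbits a')) := by
    intro b c hbc
    obtain ⟨u, hu⟩ := toOrbit_eq_iff.mp (Subtype.ext_iff.mp hbc)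
    have h1 : princ (α c) (hα c) = princ (α b) (hα b) :=
      (princ_eq_iff _ _).mpr ⟨u, congrFun hu 0⟩
    rw [← h, ← h] at h1
    exact Subtype.ext (toFrac_injective (mul_right_cancel h1)).symm
  have hs := ((summable_detFun one_ne_zero a' (QuotientGroup.mk 1) ht).comp_injective hinj).mul_left
    (fnorm a ^ t)
  refine hs.congr fun b => ?_
  have h1 : detFun (toOrbit (x b)) (QuotientGroup.mk 1) = (fnorm (toFrac b.1 : Frac F) * fnorm a)⁻¹ := by
    rw [detFun_mk, detAux_eq, ← fnorm_mul, h, fnorm_princ]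
    simp only [Units.val_one, Matrix.det_one, map_one, one_pow, Finset.prod_const_one,
      Matrix.vecMul_one, pow_one, one_div]
    congr 1
    refine Finset.prod_congr rfl fun σ _ => ?_
    simp [rowNorm, emb, hx, Real.sqrt_sq (apply_nonneg σ _)]
  simp only [Function.comp_apply, h1]
  rw [Real.inv_rpow (mul_pos (fnorm_pos _) (fnorm_pos _)).le,
    Real.mul_rpow (fnorm_pos _).le (fnorm_pos _).le, Real.rpow_neg (fnorm_pos _).le, mul_inv]
  have := (Real.rpow_pos_of_pos (fnorm_pos a) t).ne'
  field_simp

lemma norm_idealNorm_cpow (a : Frac F) (s : ℂ) : ‖idealNorm a ^ s‖ = fnorm a ^ s.re := by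
  rw [idealNorm_eq, Complex.norm_cpow_eq_rpow_re_of_pos (fnorm_pos a)]

theorem summable_zetaTerm (A : ClassGroup (𝓞 F)) {s : ℂ} (hs : 1 < s.re) :
    Summable (zetaTerm A s) := by
  refine Summable.of_norm ((summable_fnorm_class A hs).congr fun b => ?_)
  rw [zetaTerm, norm_idealNorm_cpow, Complex.neg_re]

theorem summable_fnorm_toFrac (F : Type*) [Field F] [NumberField F] {t : ℝ} (ht : 1 < t) :
    Summable fun b : (Ideal (𝓞 F))⁰ => fnorm (toFrac b : Frac F) ^ (-t) := by
  -- Sorting by class reduces the claim to finitely many convergent series, by finiteness of the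
  -- class group.
  rw [← (Equiv.sigmaFiberEquiv (fun b : (Ideal (𝓞 F))⁰ => ClassGroup.mk0 b)).summable_iff]
  refine (summable_sigma_of_nonneg fun _ => Real.rpow_nonneg (fnorm_pos _).le _).mpr
    ⟨fun A => summable_fnorm_class A ht, Summable.of_finite⟩

/-! ### Unfolding along a linear surjection -/

section Unfolding

open Measure
open scoped Pointwise

variable {V W : Type*} [NormedAddCommGroup V] [NormedSpace ℝ V] [FiniteDimensional ℝ V]
  [MeasurableSpace V] [BorelSpace V] [NormedAddCommGroup W] [NormedSpace ℝ W]
  [FiniteDimensional ℝ W] [MeasurableSpace W] [BorelSpace W]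
  {μ : Measure V} [IsAddHaarMeasure μ] {ρ : Measure W} [IsAddHaarMeasure ρ]
  {N : AddSubgroup V} [Countable N] {Λ : AddSubgroup W} [Countable Λ]
  {D : Set V} {E : Set W}

/-- The sum over a lattice of the push-forwards of a measure along the translates of a linear map. -/
def unfoldMeasure (μ : Measure V) (D : Set V) (Λ : AddSubgroup W) (ℓ : V →ₗ[ℝ] W) : Measure W :=
  Measure.sum fun l : Λ => (μ.restrict D).map fun ξ => ℓ ξ + l

lemma measurable_add_const (ℓ : V →ₗ[ℝ] W) (w : W) : Measurable fun ξ => ℓ ξ + w :=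
  (ℓ.continuous_of_finiteDimensional.add continuous_const).measurable

lemma unfoldMeasure_apply (ℓ : V →ₗ[ℝ] W) {A : Set W} (hA : MeasurableSet A) :
    unfoldMeasure μ D Λ ℓ A = ∫⁻ ξ in D, ∑' l : Λ, A.indicator 1 (ℓ ξ + l) ∂μ := by
  rw [unfoldMeasure, Measure.sum_apply _ hA, lintegral_tsum]
  · refine tsum_congr fun l => ?_
    rw [Measure.map_apply (measurable_add_const _ _) hA, ← lintegral_indicator_one
      (measurable_add_const ℓ l hA)]
    rfl
  · exact fun l => ((measurable_one.indicator hA).comp (measurable_add_const ℓ l)).aemeasurable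

/-- The sum over `Λ` is `N`-periodic in `ξ` because `ℓ` maps `N` into `Λ`. A translation by `ℓ v`
replaces `D` by `v + D`, another fundamental domain of `N`. -/
lemma unfoldMeasure_preimage_add (hD : IsAddFundamentalDomain N D μ) (ℓ : V →ₗ[ℝ] W)
    (hℓ : Function.Surjective ℓ) (hN : ∀ x ∈ N, ℓ x ∈ Λ) {A : Set W} (hA : MeasurableSet A)
    (w : W) : unfoldMeasure μ D Λ ℓ ((w + ·) ⁻¹' A) = unfoldMeasure μ D Λ ℓ A := by
  obtain ⟨v, rfl⟩ := hℓ w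
  rw [unfoldMeasure_apply ℓ (measurable_const_add _ hA), unfoldMeasure_apply ℓ hA]
  set G : V → ENNReal := fun ξ => ∑' l : Λ, A.indicator 1 (ℓ ξ + l) with hG
  have hGinv (x : N) (ξ : V) : G (x +ᵥ ξ) = G ξ := by
    simp only [hG]
    rw [← (Equiv.addLeft (⟨ℓ x, hN x x.2⟩ : Λ)).tsum_eq (fun l : Λ => A.indicator 1 (ℓ ξ + l))]
    refine tsum_congr fun l => ?_
    congr 1
    simp only [AddSubgroup.vadd_def, vadd_eq_add, map_add, Equiv.coe_addLeft, AddSubgroup.coe_add]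
    abel
  have h1 : ∀ ξ, (∑' l : Λ, ((ℓ v + ·) ⁻¹' A).indicator (1 : W → ENNReal) (ℓ ξ + l)) =
      G (v + ξ) := by
    intro ξ
    refine tsum_congr fun l => ?_
    rw [map_add, add_assoc]
    rfl
  simp_rw [h1]
  have h2 : ∫⁻ ξ in D, G (v + ξ) ∂μ = ∫⁻ ξ in v +ᵥ D, G ξ ∂μ := by
    have := (measurePreserving_add_left μ v).setLIntegral_comp_emb
      (MeasurableEquiv.addLeft v).measurableEmbedding G D
    exact this
  rw [h2]
  exact (hD.vadd_of_comm v).setLIntegral_eq hD G hGinv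

/-- Uniqueness of Haar measure. The constant is read off on `E`: every translate class modulo `Λ`
meets `E` once, so `E` has mass `μ D`. Only the inclusion of `ℓ(N)` in `Λ` is needed, not equality.
-/
theorem unfoldMeasure_eq (hD : IsAddFundamentalDomain N D μ) (hD' : μ D ≠ ⊤) (ℓ : V →ₗ[ℝ] W)
    (hℓ : Function.Surjective ℓ) (hN : ∀ x ∈ N, ℓ x ∈ Λ) (hE : MeasurableSet E)
    (hEuniq : ∀ w, ∃! l : Λ, l +ᵥ w ∈ E) (hE0 : ρ E ≠ 0) (hE' : ρ E ≠ ⊤) :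
    unfoldMeasure μ D Λ ℓ = (μ D / ρ E) • ρ := by
  have hκE : unfoldMeasure μ D Λ ℓ E = μ D := by
    rw [unfoldMeasure_apply ℓ hE]
    have : ∀ ξ, ∑' l : Λ, E.indicator (1 : W → ENNReal) (ℓ ξ + l) = 1 := by
      intro ξ
      obtain ⟨l, hl, hl'⟩ := hEuniq (ℓ ξ)
      rw [tsum_eq_single l]
      · rw [Set.indicator_of_mem]
        · rfl
        · rwa [add_comm]
      · intro l' h
        rw [Set.indicator_of_notMem]
        intro h'
        refine h (hl' l' ?_)
        rwa [add_comm] at h'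
    simp_rw [this]
    simp
  have hinv : (unfoldMeasure μ D Λ ℓ).IsAddLeftInvariant := ⟨fun w => by
    ext A hA
    rw [Measure.map_apply (measurable_const_add w) hA]
    exact unfoldMeasure_preimage_add hD ℓ hℓ hN hA w⟩
  -- The countably many `Λ`-translates of `E` cover `W`, and each has the finite mass `μ D`.
  have hsf : SigmaFinite (unfoldMeasure μ D Λ ℓ) := by
    refine sigmaFinite_of_countable
      (S := Set.range fun l : Λ => ((l : W) + ·) ⁻¹' E) (Set.countable_range _) ?_ ?_
    · rintro _ ⟨l, rfl⟩
      rw [unfoldMeasure_preimage_add hD ℓ hℓ hN hE, hκE]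
      exact hD'.lt_top
    · refine Set.eq_univ_of_forall fun w => ?_
      obtain ⟨l, hl, -⟩ := hEuniq w
      exact Set.mem_sUnion.mpr ⟨_, ⟨l, rfl⟩, hl⟩
  rw [← hκE]
  exact measure_eq_sub_vadd _ _ hE0 hE'

theorem unfold_hasSum {B : Type*} [NormedAddCommGroup B] [NormedSpace ℝ B]
    (hD : IsAddFundamentalDomain N D μ) (hD' : μ D ≠ ⊤) (ℓ : V →ₗ[ℝ] W)
    (hℓ : Function.Surjective ℓ) (hN : ∀ x ∈ N, ℓ x ∈ Λ) (hE : MeasurableSet E)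
    (hEuniq : ∀ w, ∃! l : Λ, l +ᵥ w ∈ E) (hE0 : ρ E ≠ 0) (hE' : ρ E ≠ ⊤)
    {f : W → B} (hf : Integrable f ρ) (t : W) :
    (∀ l : Λ, IntegrableOn (fun ξ => f (ℓ ξ + t + l)) D μ) ∧
      HasSum (fun l : Λ => ∫ ξ in D, f (ℓ ξ + t + l) ∂μ) ((μ D / ρ E).toReal • ∫ w, f w ∂ρ) := by
  set g : W → B := fun w => f (w + t) with hg
  have hgi : Integrable g ρ := hf.comp_add_right t
  have hκ := unfoldMeasure_eq hD hD' ℓ hℓ hN hE hEuniq hE0 hE'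
  have hgκ : Integrable g (unfoldMeasure μ D Λ ℓ) := by
    rw [hκ]
    exact hgi.smul_measure (ENNReal.div_ne_top hD' hE0)
  have hgl (l : Λ) : Integrable g ((μ.restrict D).map fun ξ => ℓ ξ + l) :=
    hgκ.mono_measure (Measure.le_sum _ l)
  have hform (l : Λ) (ξ : V) : f (ℓ ξ + t + l) = g (ℓ ξ + l) := by
    simp only [hg]
    congr 1
    abel
  simp_rw [hform]
  refine ⟨fun l => (integrable_map_measure (hgl l).aestronglyMeasurable
    (measurable_add_const ℓ l).aemeasurable).mp (hgl l), ?_⟩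
  have h1 := hasSum_integral_measure hgκ
  have h2 : ∫ w, g w ∂(Measure.sum fun l : Λ => (μ.restrict D).map fun ξ => ℓ ξ + l) =
      (μ D / ρ E).toReal • ∫ w, f w ∂ρ := by
    change ∫ w, g w ∂(unfoldMeasure μ D Λ ℓ) = _
    rw [hκ, integral_smul_measure, hg, integral_add_right_eq_self]
  rw [h2] at h1
  convert h1 using 2 with l
  exact (integral_map (measurable_add_const ℓ l).aemeasurable (hgl l).aestronglyMeasurable).symm

/-- An integral over a fundamental domain is invariant under translation of the integrand. -/
lemma setIntegral_add_eq {B : Type*} [NormedAddCommGroup B] [NormedSpace ℝ B]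
    (hD : IsAddFundamentalDomain N D μ) (G : V → B) (hG : ∀ x ∈ N, ∀ ξ, G (x + ξ) = G ξ) (v : V) :
    ∫ ξ in D, G (v + ξ) ∂μ = ∫ ξ in D, G ξ ∂μ := by
  have h2 : ∫ ξ in D, G (v + ξ) ∂μ = ∫ ξ in v +ᵥ D, G ξ ∂μ := by
    have := (measurePreserving_add_left μ v).setIntegral_image_emb
      (MeasurableEquiv.addLeft v).measurableEmbedding G D
    rw [← this]
    rfl
  rw [h2]
  exact (hD.vadd_of_comm v).setIntegral_eq hD (f := G) fun x ξ => hG x x.2 ξ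

end Unfolding
/-! ### Fourier transforms of powers of `A² + |t|²` -/

section Radial

open Complex Set
open scoped RealInnerProductSpace

variable {V : Type*} [NormedAddCommGroup V] [InnerProductSpace ℝ V] [FiniteDimensional ℝ V]
  [MeasurableSpace V] [BorelSpace V]

lemma rad_pos {A : ℝ} (hA : 0 < A) (t : V) : 0 < A ^ 2 + ‖t‖ ^ 2 := by positivity

lemma sqrt_cpow {x : ℝ} (hx : 0 ≤ x) (c : ℂ) :
    ((Real.sqrt x : ℝ) : ℂ) ^ c = (x : ℂ) ^ (c / 2) := by
  have h := ofReal_pow_cpow (Real.sqrt_nonneg x) 2 (c / 2)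
  rw [Real.sq_sqrt hx] at h
  rw [h]
  congr 1
  push_cast
  ring

lemma integrable_rad_rpow {A : ℝ} (hA : 0 < A) {r : ℝ} (hr : (Module.finrank ℝ V : ℝ) < 2 * r) :
    Integrable (fun t : V => (A ^ 2 + ‖t‖ ^ 2) ^ (-r)) := by
  have h1 : Integrable (fun t : V => ((1 : ℝ) + ‖t‖ ^ 2) ^ (-(2 * r) / 2)) :=
    integrable_rpow_neg_one_add_norm_sq hr
  have h2 := (h1.comp_smul (R := A⁻¹) (inv_ne_zero hA.ne')).const_mul ((A ^ 2) ^ (-r))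
  refine h2.congr (Filter.Eventually.of_forall fun t => ?_)
  beta_reduce
  have h3 : A ^ 2 + ‖t‖ ^ 2 = A ^ 2 * (1 + ‖A⁻¹ • t‖ ^ 2) := by
    rw [_root_.norm_smul, norm_inv, Real.norm_of_nonneg hA.le]
    field_simp
  rw [h3, Real.mul_rpow (by positivity) (by positivity)]
  congr 2
  ring

lemma continuous_rad_cpow {A : ℝ} (hA : 0 < A) (c : ℂ) :
    Continuous (fun t : V => ((A ^ 2 + ‖t‖ ^ 2 : ℝ) : ℂ) ^ c) := by
  refine Continuous.cpow (by fun_prop) continuous_const fun t => ?_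
  exact Or.inl (by rw [ofReal_re]; exact rad_pos hA t)

lemma integrable_rad_cpow {A : ℝ} (hA : 0 < A) {c : ℂ}
    (hc : (Module.finrank ℝ V : ℝ) < 2 * c.re) :
    Integrable (fun t : V => ((A ^ 2 + ‖t‖ ^ 2 : ℝ) : ℂ) ^ (-c)) := by
  refine (integrable_norm_iff (continuous_rad_cpow hA (-c)).aestronglyMeasurable).mp ?_
  refine (integrable_rad_rpow hA hc).congr (Filter.Eventually.of_forall fun t => ?_)
  beta_reduce
  rw [Complex.norm_cpow_eq_rpow_re_of_pos (rad_pos hA t), neg_re]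

/-- The integrand of the Mellin representation of `(A² + |t|²)^{-a} e^{-2πi⟨w,t⟩}`. -/
def mellinKernel (A : ℝ) (a : ℂ) (w : V) (p : V × ℝ) : ℂ :=
  (p.2 : ℂ) ^ (a - 1) * cexp (-(((A ^ 2 + ‖p.1‖ ^ 2 : ℝ) : ℂ) * p.2)) *
    cexp (-(2 * Real.pi * I * (⟪w, p.1⟫ : ℝ)))

lemma norm_char (x : ℝ) : ‖cexp (-(2 * Real.pi * I * (x : ℂ)))‖ = 1 := by
  rw [show -(2 * (Real.pi : ℂ) * I * (x : ℂ)) = ((-(2 * Real.pi * x) : ℝ) : ℂ) * I by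
    push_cast; ring]
  exact norm_exp_ofReal_mul_I _

lemma integral_mellinKernel_snd {A : ℝ} (hA : 0 < A) {a : ℂ} (ha : 0 < a.re) (w t : V) :
    ∫ u in Ioi (0 : ℝ), mellinKernel A a w (t, u) =
      Gamma a * (((A ^ 2 + ‖t‖ ^ 2 : ℝ) : ℂ) ^ (-a) * cexp (-(2 * Real.pi * I * (⟪w, t⟫ : ℝ)))) := by
  simp only [mellinKernel]
  rw [integral_mul_const, integral_cpow_mul_exp_neg_mul_Ioi ha
    (rad_pos hA t), one_div,
    inv_cpow _ _ (by rw [arg_ofReal_of_nonneg (rad_pos hA t).le]; exact Real.pi_pos.ne), ← cpow_neg]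
  ring

/-- This licenses the exchange of the two integrals: in absolute value the `u`-integral is `Γ(Re a)`
times a power of `A² + |t|²`, which is integrable in `t` by the assumption on `Re a`. -/
lemma integrable_mellinKernel {A : ℝ} (hA : 0 < A) {a : ℂ}
    (ha : (Module.finrank ℝ V : ℝ) < 2 * a.re) (w : V) :
    Integrable (mellinKernel A a w) ((volume : Measure V).prod (volume.restrict (Ioi (0 : ℝ)))) := by
  have ha0 : 0 < a.re := by
    have : (0 : ℝ) ≤ (Module.finrank ℝ V : ℝ) := Nat.cast_nonneg _
    linarith
  have hmeas : AEStronglyMeasurable (mellinKernel A a w)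
      ((volume : Measure V).prod (volume.restrict (Ioi (0 : ℝ)))) := by
    refine Measurable.aestronglyMeasurable ?_
    unfold mellinKernel
    refine Measurable.mul (Measurable.mul ?_ ?_) ?_
    · exact Measurable.pow_const (by fun_prop) _
    · fun_prop
    · fun_prop
  have hnorm (t : V) (u : ℝ) (hu : u ∈ Ioi (0 : ℝ)) : ‖mellinKernel A a w (t, u)‖ =
      u ^ (a.re - 1) * Real.exp (-((A ^ 2 + ‖t‖ ^ 2) * u)) := by
    simp only [mellinKernel]
    rw [norm_mul, norm_char, mul_one, norm_mul, Complex.norm_cpow_eq_rpow_re_of_pos hu,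
      Complex.norm_exp, sub_re, one_re, ← ofReal_mul, ← ofReal_neg, ofReal_re]
  rw [integrable_prod_iff hmeas]
  constructor
  · refine Filter.Eventually.of_forall fun t => ?_
    have hm : AEStronglyMeasurable (fun u => mellinKernel A a w (t, u))
        (volume.restrict (Ioi (0 : ℝ))) := by
      refine Measurable.aestronglyMeasurable ?_
      unfold mellinKernel
      refine Measurable.mul (Measurable.mul ?_ ?_) ?_
      · exact Measurable.pow_const (by fun_prop) _
      · fun_prop
      · fun_prop
    rw [← integrable_norm_iff hm]
    refine IntegrableOn.congr_fun (f := fun u : ℝ => u ^ (a.re - 1) *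
      Real.exp (-((A ^ 2 + ‖t‖ ^ 2) * u))) ?_ (fun u hu => (hnorm t u hu).symm) measurableSet_Ioi
    have := integrableOn_rpow_mul_exp_neg_mul_rpow (s := a.re - 1) (p := 1) (by linarith)
      (by norm_num) (rad_pos hA t)
    simpa only [neg_mul, Real.rpow_one] using this
  · have h1 : ∀ t : V, ∫ u in Ioi (0 : ℝ), ‖mellinKernel A a w (t, u)‖ =
        Real.Gamma a.re * (A ^ 2 + ‖t‖ ^ 2) ^ (-a.re) := by
      intro t
      rw [setIntegral_congr_fun measurableSet_Ioi (fun u hu => hnorm t u hu),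
        Real.integral_rpow_mul_exp_neg_mul_Ioi ha0 (rad_pos hA t), one_div,
        Real.inv_rpow (rad_pos hA t).le, Real.rpow_neg (rad_pos hA t).le, mul_comm]
    simp_rw [h1]
    exact (integrable_rad_rpow hA ha).const_mul _

/-- For fixed `u` this is the Fourier transform of a Gaussian, `(π/u)^{p/2} e^{-π²‖w‖²/u}` with `p`
the dimension. -/
lemma integral_mellinKernel_fst (A : ℝ) (a : ℂ) (w : V) {u : ℝ} (hu : 0 < u) :
    ∫ t : V, mellinKernel A a w (t, u) = (Real.pi : ℂ) ^ (Module.finrank ℝ V / 2 : ℂ) *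
      ((u : ℂ) ^ (a - Module.finrank ℝ V / 2 - 1) *
        (Real.exp (-(u * A ^ 2) - (Real.pi * ‖w‖) ^ 2 / u) : ℂ)) := by
  have h1 (t : V) : mellinKernel A a w (t, u) = ((u : ℂ) ^ (a - 1) * cexp (-(u * A ^ 2))) *
      cexp (-(u : ℂ) * ‖t‖ ^ 2 + (-(2 * Real.pi * I)) * (⟪w, t⟫ : ℝ)) := by
    simp only [mellinKernel]
    rw [mul_assoc, mul_assoc ((u : ℂ) ^ (a - 1)), ← exp_add, ← exp_add]
    congr 2
    push_cast
    ring
  simp_rw [h1]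
  rw [integral_const_mul, GaussianFourier.integral_cexp_neg_mul_sq_norm_add (by simpa using hu)]
  have hu' : (u : ℂ) ≠ 0 := ofReal_ne_zero.mpr hu.ne'
  have h2 : ((Real.pi : ℂ) / u) ^ (Module.finrank ℝ V / 2 : ℂ) =
      (Real.pi : ℂ) ^ (Module.finrank ℝ V / 2 : ℂ) * (u : ℂ) ^ (-(Module.finrank ℝ V / 2 : ℂ)) := by
    rw [div_eq_mul_inv, ← ofReal_inv, mul_cpow_ofReal_nonneg Real.pi_pos.le (by positivity),
      ofReal_inv, inv_cpow _ _ (by rw [arg_ofReal_of_nonneg hu.le]; exact Real.pi_pos.ne),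
      cpow_neg]
  have h3 : (u : ℂ) ^ (a - Module.finrank ℝ V / 2 - 1) =
      (u : ℂ) ^ (a - 1) * (u : ℂ) ^ (-(Module.finrank ℝ V / 2 : ℂ)) := by
    rw [← cpow_add _ _ hu']
    congr 1
    ring
  have h4 : (Real.exp (-(u * A ^ 2) - (Real.pi * ‖w‖) ^ 2 / u) : ℂ) =
      cexp (-(u * A ^ 2)) * cexp ((-(2 * Real.pi * I)) ^ 2 * ‖w‖ ^ 2 / (4 * u)) := by
    rw [← exp_add]
    push_cast
    congr 1
    field_simp
    ring_nf
    rw [I_sq]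
    ring
  rw [h2, h3, h4]
  ring

theorem integral_rad_cpow_mul_char {A : ℝ} (hA : 0 < A) {a : ℂ}
    (ha : (Module.finrank ℝ V : ℝ) < 2 * a.re) (w : V) :
    ∫ t : V, ((A ^ 2 + ‖t‖ ^ 2 : ℝ) : ℂ) ^ (-a) * cexp (-(2 * Real.pi * I * (⟪w, t⟫ : ℝ))) =
      (Real.pi : ℂ) ^ (Module.finrank ℝ V / 2 : ℂ) / Gamma a *
      ∫ u in Ioi (0 : ℝ), (u : ℂ) ^ (a - Module.finrank ℝ V / 2 - 1) *
        (Real.exp (-(u * A ^ 2) - (Real.pi * ‖w‖) ^ 2 / u) : ℂ) := by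
  have ha0 : 0 < a.re := by
    have : (0 : ℝ) ≤ (Module.finrank ℝ V : ℝ) := Nat.cast_nonneg _
    linarith
  have hG : Gamma a ≠ 0 := Gamma_ne_zero_of_re_pos ha0
  have h1 := integral_integral_swap (f := fun t u => mellinKernel A a w (t, u))
    (integrable_mellinKernel hA ha w)
  simp_rw [integral_mellinKernel_snd hA ha0] at h1
  rw [integral_const_mul, setIntegral_congr_fun measurableSet_Ioi
    (fun u hu => integral_mellinKernel_fst A a w hu), integral_const_mul] at h1
  rw [div_mul_eq_mul_div, eq_div_iff hG, mul_comm, h1]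

/-- The integral of `(A² + |t|²)^{-pκ/2}`, with `p` the dimension. -/
theorem integral_rad {A : ℝ} (hA : 0 < A) {κ : ℂ} (hκ : 1 < κ.re) [Nontrivial V] :
    ∫ t : V, ((Real.sqrt (A ^ 2 + ‖t‖ ^ 2) : ℝ) : ℂ) ^ (-(Module.finrank ℝ V * κ)) =
      (Real.pi : ℂ) ^ (Module.finrank ℝ V / 2 : ℂ) *
      (Gamma (Module.finrank ℝ V * (κ - 1) / 2) / Gamma (Module.finrank ℝ V * κ / 2)) *
      (A : ℂ) ^ (-(Module.finrank ℝ V * (κ - 1))) := by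
  set p : ℝ := (Module.finrank ℝ V : ℝ) with hp
  have hp0 : 0 < p := by rw [hp]; exact_mod_cast Module.finrank_pos
  have hpc : (Module.finrank ℝ V : ℂ) = (p : ℂ) := by simp [hp]
  simp_rw [hpc]
  have ha : (Module.finrank ℝ V : ℝ) < 2 * ((p : ℂ) * κ / 2).re := by
    rw [← hp, mul_div_assoc, re_ofReal_mul]
    have : (κ / 2).re = κ.re / 2 := by simp
    rw [this]
    nlinarith
  -- At frequency zero the remaining `u`-integral has no `1/u` in the exponent and is a Gamma
  -- integral.
  have h := integral_rad_cpow_mul_char hA ha (0 : V)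
  simp only [inner_zero_left, ofReal_zero, mul_zero, neg_zero, Complex.exp_zero, mul_one, norm_zero,
    hpc] at h
  simp_rw [sqrt_cpow (rad_pos hA _).le, neg_div]
  rw [h]
  have hb : 0 < ((p : ℂ) * (κ - 1) / 2).re := by
    rw [mul_div_assoc, re_ofReal_mul]
    have : ((κ - 1) / 2).re = (κ.re - 1) / 2 := by simp
    rw [this]
    nlinarith
  have h2 : ∫ u in Ioi (0 : ℝ), (u : ℂ) ^ ((p : ℂ) * κ / 2 - p / 2 - 1) *
        (Real.exp (-(u * A ^ 2) - 0 ^ 2 / u) : ℂ) =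
      (A : ℂ) ^ (-(p * (κ - 1))) * Gamma (p * (κ - 1) / 2) := by
    have h3 := integral_cpow_mul_exp_neg_mul_Ioi hb (r := A ^ 2) (by positivity)
    have h4 : (1 / ((A ^ 2 : ℝ) : ℂ)) ^ ((p : ℂ) * (κ - 1) / 2) = (A : ℂ) ^ (-(p * (κ - 1))) := by
      rw [one_div, ← ofReal_inv, ← inv_pow, ofReal_pow_cpow (by positivity), ofReal_inv,
        inv_cpow _ _ (by rw [arg_ofReal_of_nonneg hA.le]; exact Real.pi_pos.ne), ← cpow_neg]
      congr 1
      push_cast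
      ring
    rw [h4] at h3
    rw [← h3]
    refine setIntegral_congr_fun measurableSet_Ioi fun u _ => ?_
    congr 2
    · ring
    · push_cast
      congr 1
      simp
      ring
  rw [h2]
  ring

/-- The substitution `u ↦ (c/A)u` equalises the coefficients of `u` and `1/u` in the exponent; both
become `Ac`. -/
lemma besselK_integral {A c : ℝ} (hA : 0 < A) (hc : 0 < c) (b : ℂ) :
    ∫ u in Ioi (0 : ℝ), (u : ℂ) ^ (b - 1) * (Real.exp (-(u * A ^ 2) - c ^ 2 / u) : ℂ) =
      2 * ((c / A : ℝ) : ℂ) ^ b * besselK b (2 * A * c) := by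
  have hk : 0 < c / A := div_pos hc hA
  have h := integral_comp_mul_left_Ioi
    (fun u : ℝ => (u : ℂ) ^ (b - 1) * (Real.exp (-(u * A ^ 2) - c ^ 2 / u) : ℂ)) 0 hk
  rw [mul_zero, eq_comm, inv_smul_eq_iff₀ hk.ne'] at h
  rw [h, besselK, real_smul, ← integral_const_mul, ← integral_const_mul, ← integral_const_mul]
  refine setIntegral_congr_fun measurableSet_Ioi fun u hu => ?_
  have hu' : (0 : ℝ) < u := hu
  have hk' : ((c / A : ℝ) : ℂ) ≠ 0 := ofReal_ne_zero.mpr hk.ne'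
  have huc : (u : ℂ) ≠ 0 := ofReal_ne_zero.mpr hu'.ne'
  have h1 : -(c / A * u * A ^ 2) - c ^ 2 / (c / A * u) = -(1 / 2) * (2 * A * c) * (u + 1 / u) := by
    field_simp
    ring
  rw [h1, ofReal_cpow_mul hk.le hu'.le, cpow_sub _ _ hk', cpow_sub _ _ huc, cpow_one, cpow_one]
  field_simp

/-- The Fourier transform of `(A² + |t|²)^{-pκ/2}`, with `p` the dimension. -/
theorem integral_rad_char {A : ℝ} (hA : 0 < A) {κ : ℂ} (hκ : 1 < κ.re) [Nontrivial V] {w : V}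
    (hw : w ≠ 0) :
    ∫ t : V, ((Real.sqrt (A ^ 2 + ‖t‖ ^ 2) : ℝ) : ℂ) ^ (-(Module.finrank ℝ V * κ)) *
        cexp (-(2 * Real.pi * I * (⟪w, t⟫ : ℝ))) =
      2 * (Real.pi : ℂ) ^ (Module.finrank ℝ V / 2 : ℂ) / Gamma (Module.finrank ℝ V * κ / 2) *
      ((Real.pi * ‖w‖ / A : ℝ) : ℂ) ^ (Module.finrank ℝ V * (κ - 1) / 2) *
      besselK (Module.finrank ℝ V * (κ - 1) / 2) (2 * A * (Real.pi * ‖w‖)) := by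
  set p : ℝ := (Module.finrank ℝ V : ℝ) with hp
  have hp0 : 0 < p := by rw [hp]; exact_mod_cast Module.finrank_pos
  have hpc : (Module.finrank ℝ V : ℂ) = (p : ℂ) := by simp [hp]
  simp_rw [hpc]
  have ha : (Module.finrank ℝ V : ℝ) < 2 * ((p : ℂ) * κ / 2).re := by
    rw [← hp, mul_div_assoc, re_ofReal_mul]
    have : (κ / 2).re = κ.re / 2 := by simp
    rw [this]
    nlinarith
  have h := integral_rad_cpow_mul_char hA ha w
  simp_rw [sqrt_cpow (rad_pos hA _).le, neg_div]
  rw [h, hpc, show (p : ℂ) * κ / 2 - p / 2 - 1 = p * (κ - 1) / 2 - 1 by ring,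
    besselK_integral hA (mul_pos Real.pi_pos (norm_pos_iff.mpr hw))]
  ring

/-- Half of `u + 1/u` is bounded below by `2/2` and the other half by `u/2`: this splits off
`e^{-x/2}` and leaves a Gamma integral. The bound is crude for large `x` but still exponential. -/
lemma norm_besselK_le {s : ℂ} (hs : 0 < s.re) {x : ℝ} (hx : 0 < x) :
    ‖besselK s x‖ ≤ (1 / 2 * 4 ^ s.re * Real.Gamma s.re) * x ^ (-s.re) * Real.exp (-x / 2) := by
  rw [besselK, norm_mul]
  have h0 : ‖(1 / 2 : ℂ)‖ = 1 / 2 := by simp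
  rw [h0]
  have h1 := Real.integral_rpow_mul_exp_neg_mul_Ioi hs (r := x / 4) (by positivity)
  have hint : IntegrableOn (fun u : ℝ => Real.exp (-x / 2) *
      (u ^ (s.re - 1) * Real.exp (-(x / 4 * u)))) (Ioi 0) := by
    refine Integrable.const_mul ?_ _
    have := integrableOn_rpow_mul_exp_neg_mul_rpow (s := s.re - 1) (p := 1) (b := x / 4)
      (by linarith) (by norm_num) (by positivity)
    simp only [neg_mul, Real.rpow_one] at this
    exact this
  have h2 : ‖∫ u in Ioi (0 : ℝ), (Real.exp (-(1 / 2) * x * (u + 1 / u)) : ℂ) * (u : ℂ) ^ s / u‖ ≤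
      ∫ u in Ioi (0 : ℝ), Real.exp (-x / 2) * (u ^ (s.re - 1) * Real.exp (-(x / 4 * u))) := by
    refine norm_integral_le_of_norm_le hint ?_
    refine (ae_restrict_iff' measurableSet_Ioi).mpr (Filter.Eventually.of_forall fun u hu => ?_)
    have hu' : (0 : ℝ) < u := hu
    rw [norm_div, norm_mul, Complex.norm_cpow_eq_rpow_re_of_pos hu', Complex.norm_real, Complex.norm_real,
      Real.norm_of_nonneg (Real.exp_pos _).le, Real.norm_of_nonneg hu'.le, mul_div_assoc,
      Real.rpow_sub_one hu'.ne', mul_left_comm, ← Real.exp_add, mul_comm]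
    refine mul_le_mul_of_nonneg_left (Real.exp_le_exp.mpr ?_) (by positivity)
    have h3 : 2 ≤ u + 1 / u := by
      rw [← sub_nonneg]
      have : u + 1 / u - 2 = (u - 1) ^ 2 / u := by field_simp; ring
      rw [this]
      positivity
    have h4 : 0 < 1 / u := by positivity
    nlinarith
  rw [integral_const_mul, h1] at h2
  calc _ ≤ 1 / 2 * (Real.exp (-x / 2) * ((1 / (x / 4)) ^ s.re * Real.Gamma s.re)) := by gcongr
    _ = _ := by
      rw [one_div_div, Real.div_rpow (by norm_num) hx.le, Real.rpow_neg hx.le]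
      ring

end Radial
/-! ### Integrals over `F_∞` -/

section Places

open scoped RealInnerProductSpace

/-- `∏_σ (A_σ² + |t_σ|²)^{-n_σ κ / 2}`. -/
def radProd (A : InfinitePlace F → ℝ) (κ : ℂ) (t : mixedSpace F) : ℂ :=
  ∏ σ : InfinitePlace F, ((Real.sqrt (A σ ^ 2 + normAtPlace σ t ^ 2) : ℝ) : ℂ) ^ (-(σ.mult * κ))

/-- The additive character `e^{-2πi Tr(x)}` of `F_∞`. -/
def charInf (x : mixedSpace F) : ℂ := Complex.exp (-(2 * Real.pi * Complex.I * (traceInf x : ℂ)))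

/-- The vector of `F_σ` that represents `t ↦ Tr(μ t)`, at a real place. -/
lemma radProd_mul_charInf (A : InfinitePlace F → ℝ) (κ : ℂ) (μ t : mixedSpace F) :
    radProd A κ t * charInf (μ * t) =
      (∏ σ : {w : InfinitePlace F // IsReal w},
        (((Real.sqrt (A σ ^ 2 + ‖t.1 σ‖ ^ 2) : ℝ) : ℂ) ^ (-(Module.finrank ℝ ℝ * κ)) *
          Complex.exp (-(2 * Real.pi * Complex.I * (⟪μ.1 σ, t.1 σ⟫ : ℝ))))) *
      ∏ σ : {w : InfinitePlace F // IsComplex w},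
        (((Real.sqrt (A σ ^ 2 + ‖t.2 σ‖ ^ 2) : ℝ) : ℂ) ^ (-(Module.finrank ℝ ℂ * κ)) *
          Complex.exp (-(2 * Real.pi * Complex.I *
            (⟪2 * (starRingEnd ℂ) (μ.2 σ), t.2 σ⟫ : ℝ)))) := by
  rw [radProd, prod_eq_prod_mul_prod, Finset.prod_mul_distrib, Finset.prod_mul_distrib,
    ← Complex.exp_sum, ← Complex.exp_sum, mul_mul_mul_comm, ← Complex.exp_add]
  congr 1
  · congr 1
    · refine Finset.prod_congr rfl fun σ _ => ?_
      rw [normAtPlace_apply_of_isReal σ.2, mult_isReal, Module.finrank_self]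
    · refine Finset.prod_congr rfl fun σ _ => ?_
      rw [normAtPlace_apply_of_isComplex σ.2, mult_isComplex, Complex.finrank_real_complex]
  · rw [charInf, Finset.sum_neg_distrib, Finset.sum_neg_distrib, ← Finset.mul_sum,
      ← Finset.mul_sum, ← neg_add, ← mul_add, ← Complex.ofReal_sum, ← Complex.ofReal_sum,
      ← Complex.ofReal_add]
    congr 5
    rw [traceInf]
    congr 1
    · refine Finset.sum_congr rfl fun σ _ => ?_
      simp [mul_comm]
    -- At a complex place `2 Re(μt)` is the real inner product of `2μ̄` with `t`.
    · refine Finset.sum_congr rfl fun σ _ => ?_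
      simp [Complex.inner, Complex.mul_re]
      ring

lemma integral_prod_places (f : {w : InfinitePlace F // IsReal w} → ℝ → ℂ)
    (g : {w : InfinitePlace F // IsComplex w} → ℂ → ℂ) :
    ∫ t : mixedSpace F, (∏ σ, f σ (t.1 σ)) * ∏ σ, g σ (t.2 σ) =
      (∏ σ, ∫ x, f σ x) * ∏ σ, ∫ x, g σ x := by
  rw [Measure.volume_eq_prod, integral_prod_mul (μ := volume) (ν := volume)
    (fun t : {w : InfinitePlace F // IsReal w} → ℝ => ∏ σ, f σ (t σ))
    (fun t : {w : InfinitePlace F // IsComplex w} → ℂ => ∏ σ, g σ (t σ)),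
    integral_fintype_prod_volume_eq_prod, integral_fintype_prod_volume_eq_prod]

lemma integrable_prod_places (f : {w : InfinitePlace F // IsReal w} → ℝ → ℂ)
    (g : {w : InfinitePlace F // IsComplex w} → ℂ → ℂ) (hf : ∀ σ, Integrable (f σ))
    (hg : ∀ σ, Integrable (g σ)) :
    Integrable fun t : mixedSpace F => (∏ σ, f σ (t.1 σ)) * ∏ σ, g σ (t.2 σ) := by
  rw [Measure.volume_eq_prod]
  exact Integrable.mul_prod (μ := volume) (ν := volume)
    (f := fun t : {w : InfinitePlace F // IsReal w} → ℝ => ∏ σ, f σ (t σ))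
    (g := fun t : {w : InfinitePlace F // IsComplex w} → ℂ => ∏ σ, g σ (t σ))
    (Integrable.fintype_prod hf) (Integrable.fintype_prod hg)

lemma charInf_zero : charInf (0 : mixedSpace F) = 1 := by
  simp [charInf, traceInf]

lemma norm_charInf (x : mixedSpace F) : ‖charInf x‖ = 1 := norm_char _

lemma continuous_traceInf : Continuous (traceInf : mixedSpace F → ℝ) := by
  unfold traceInf
  fun_prop

lemma continuous_charInf : Continuous (charInf : mixedSpace F → ℂ) := by
  unfold charInf
  have := continuous_traceInf (F := F)
  fun_prop

lemma integrable_local {V : Type*} [NormedAddCommGroup V] [InnerProductSpace ℝ V]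
    [FiniteDimensional ℝ V] [Nontrivial V] [MeasurableSpace V] [BorelSpace V] {A : ℝ} (hA : 0 < A)
    {κ : ℂ} (hκ : 1 < κ.re) : Integrable fun t : V =>
      ((Real.sqrt (A ^ 2 + ‖t‖ ^ 2) : ℝ) : ℂ) ^ (-(Module.finrank ℝ V * κ)) := by
  simp_rw [sqrt_cpow (rad_pos hA _).le, neg_div]
  refine integrable_rad_cpow hA ?_
  have h : (0 : ℝ) < Module.finrank ℝ V := by exact_mod_cast Module.finrank_pos
  have h1 : ((Module.finrank ℝ V : ℂ) * κ / 2).re = Module.finrank ℝ V * κ.re / 2 := by simp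
  rw [h1]
  nlinarith

theorem integrable_radProd {A : InfinitePlace F → ℝ} (hA : ∀ σ, 0 < A σ) {κ : ℂ}
    (hκ : 1 < κ.re) : Integrable (radProd A κ) := by
  have h : radProd A κ = fun t : mixedSpace F =>
      (∏ σ : {w : InfinitePlace F // IsReal w},
        ((Real.sqrt (A σ ^ 2 + ‖t.1 σ‖ ^ 2) : ℝ) : ℂ) ^ (-(Module.finrank ℝ ℝ * κ))) *
      ∏ σ : {w : InfinitePlace F // IsComplex w},
        ((Real.sqrt (A σ ^ 2 + ‖t.2 σ‖ ^ 2) : ℝ) : ℂ) ^ (-(Module.finrank ℝ ℂ * κ)) := by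
    funext t
    have := radProd_mul_charInf A κ 0 t
    simpa [charInf_zero] using this
  have hr (σ : {w : InfinitePlace F // IsReal w}) := integrable_local (V := ℝ) (hA σ.1) hκ
  have hc (σ : {w : InfinitePlace F // IsComplex w}) := integrable_local (V := ℂ) (hA σ.1) hκ
  have := integrable_prod_places _ _ hr hc
  rwa [← h] at this

lemma integrable_radProd_mul_charInf {A : InfinitePlace F → ℝ} (hA : ∀ σ, 0 < A σ) {κ : ℂ}
    (hκ : 1 < κ.re) (μ : mixedSpace F) :
    Integrable fun t => radProd A κ t * charInf (μ * t) := by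
  refine (integrable_radProd hA hκ).mul_bdd (c := 1) ?_ ?_
  · exact (continuous_charInf.comp (continuous_const.mul continuous_id)).aestronglyMeasurable
  · exact Filter.Eventually.of_forall fun t => (norm_charInf _).le

lemma integral_radProd_mul_charInf (A : InfinitePlace F → ℝ) (κ : ℂ) (μ : mixedSpace F) :
    ∫ t, radProd A κ t * charInf (μ * t) =
      (∏ σ : {w : InfinitePlace F // IsReal w}, ∫ t : ℝ,
        ((Real.sqrt (A σ ^ 2 + ‖t‖ ^ 2) : ℝ) : ℂ) ^ (-(Module.finrank ℝ ℝ * κ)) *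
          Complex.exp (-(2 * Real.pi * Complex.I * (⟪μ.1 σ, t⟫ : ℝ)))) *
      ∏ σ : {w : InfinitePlace F // IsComplex w}, ∫ t : ℂ,
        ((Real.sqrt (A σ ^ 2 + ‖t‖ ^ 2) : ℝ) : ℂ) ^ (-(Module.finrank ℝ ℂ * κ)) *
          Complex.exp (-(2 * Real.pi * Complex.I *
            (⟪2 * (starRingEnd ℂ) (μ.2 σ), t⟫ : ℝ))) := by
  simp_rw [radProd_mul_charInf]
  exact integral_prod_places (fun σ t =>
    ((Real.sqrt (A σ ^ 2 + ‖t‖ ^ 2) : ℝ) : ℂ) ^ (-(Module.finrank ℝ ℝ * κ)) *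
      Complex.exp (-(2 * Real.pi * Complex.I * (⟪μ.1 σ, t⟫ : ℝ)))) (fun σ t =>
    ((Real.sqrt (A σ ^ 2 + ‖t‖ ^ 2) : ℝ) : ℂ) ^ (-(Module.finrank ℝ ℂ * κ)) *
      Complex.exp (-(2 * Real.pi * Complex.I * (⟪2 * (starRingEnd ℂ) (μ.2 σ), t⟫ : ℝ))))

lemma prod_cpow_mult (x : ℂ) (hx : x ≠ 0) (c : ℂ) :
    ∏ σ : InfinitePlace F, x ^ (σ.mult * c) = x ^ (Module.finrank ℚ F * c) := by
  rw [← sum_mult_eq, Nat.cast_sum, Finset.sum_mul]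
  induction (Finset.univ : Finset (InfinitePlace F)) using Finset.induction_on with
  | empty => simp
  | insert i t hi ih => rw [Finset.prod_insert hi, Finset.sum_insert hi, ih, Complex.cpow_add _ _ hx]

theorem integral_radProd {A : InfinitePlace F → ℝ} (hA : ∀ σ, 0 < A σ) {κ : ℂ}
    (hκ : 1 < κ.re) : ∫ t, radProd A κ t =
      (Real.pi : ℂ) ^ (Module.finrank ℚ F / 2 : ℂ) * (gammaF F (κ - 1) / gammaF F κ) *
      ∏ σ : InfinitePlace F, (A σ : ℂ) ^ (-(σ.mult * (κ - 1))) := by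
  have h := integral_radProd_mul_charInf A κ (0 : mixedSpace F)
  simp only [zero_mul, charInf_zero, mul_one, Prod.fst_zero, Prod.snd_zero, Pi.zero_apply, map_zero,
    mul_zero, inner_zero_left, Complex.ofReal_zero, neg_zero, Complex.exp_zero] at h
  rw [h]
  have h1 : (Real.pi : ℂ) ^ (Module.finrank ℚ F / 2 : ℂ) * (gammaF F (κ - 1) / gammaF F κ) *
      ∏ σ : InfinitePlace F, (A σ : ℂ) ^ (-(σ.mult * (κ - 1))) =
      ∏ σ : InfinitePlace F, (Real.pi : ℂ) ^ (σ.mult / 2 : ℂ) *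
        (Complex.Gamma (σ.mult * (κ - 1) / 2) / Complex.Gamma (σ.mult * κ / 2)) *
        (A σ : ℂ) ^ (-(σ.mult * (κ - 1))) := by
    rw [Finset.prod_mul_distrib, Finset.prod_mul_distrib, Finset.prod_div_distrib]
    congr 2
    have := prod_cpow_mult (F := F) (Real.pi : ℂ) (by exact_mod_cast Real.pi_ne_zero) (1 / 2)
    simpa only [mul_one_div] using this.symm
  rw [h1, prod_eq_prod_mul_prod]
  congr 1
  · refine Finset.prod_congr rfl fun σ _ => ?_
    rw [integral_rad (hA σ) hκ, mult_isReal, Module.finrank_self]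
  · refine Finset.prod_congr rfl fun σ _ => ?_
    rw [integral_rad (hA σ) hκ, mult_isComplex, Complex.finrank_real_complex]

/-- The integral is a product of local ones. The frequency at `σ` has length `n_σ|μ_σ|`, since the
trace pairing doubles at complex places; it must be non-zero everywhere for the Bessel formula to
apply. -/
theorem integral_radProd_char {A : InfinitePlace F → ℝ} (hA : ∀ σ, 0 < A σ) {κ : ℂ}
    (hκ : 1 < κ.re) {μ : mixedSpace F} (hμ : ∀ σ, normAtPlace σ μ ≠ 0) :
    ∫ t, radProd A κ t * charInf (μ * t) =
      ∏ σ : InfinitePlace F, 2 * (Real.pi : ℂ) ^ (σ.mult / 2 : ℂ) /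
        Complex.Gamma (σ.mult * κ / 2) *
        ((Real.pi * (σ.mult * normAtPlace σ μ) / A σ : ℝ) : ℂ) ^ (σ.mult * (κ - 1) / 2 : ℂ) *
        besselK (σ.mult * (κ - 1) / 2) (2 * A σ * (Real.pi * (σ.mult * normAtPlace σ μ))) := by
  rw [integral_radProd_mul_charInf, prod_eq_prod_mul_prod]
  congr 1
  · refine Finset.prod_congr rfl fun σ _ => ?_
    have h1 : normAtPlace σ.1 μ = ‖μ.1 σ‖ := normAtPlace_apply_of_isReal σ.2 μ
    have h0 : μ.1 σ ≠ 0 := by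
      rw [← norm_ne_zero_iff, ← h1]
      exact hμ _
    rw [integral_rad_char (hA σ) hκ h0, mult_isReal, Module.finrank_self, h1, Nat.cast_one,
      Nat.cast_one, one_mul ‖μ.1 σ‖]
  · refine Finset.prod_congr rfl fun σ _ => ?_
    have h1 : normAtPlace σ.1 μ = ‖μ.2 σ‖ := normAtPlace_apply_of_isComplex σ.2 μ
    have h2 : ‖2 * (starRingEnd ℂ) (μ.2 σ)‖ = 2 * normAtPlace σ.1 μ := by
      rw [norm_mul, Complex.norm_conj, h1, Complex.norm_ofNat]
    have h0 : 2 * (starRingEnd ℂ) (μ.2 σ) ≠ 0 := by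
      rw [← norm_ne_zero_iff, h2]
      exact mul_ne_zero two_ne_zero (hμ _)
    rw [integral_rad_char (hA σ) hκ h0, mult_isComplex, Complex.finrank_real_complex, h2]
    norm_num

end Places
/-! ### The trace form and dual lattices -/

lemma traceInf_add (x y : mixedSpace F) : traceInf (x + y) = traceInf x + traceInf y := by
  simp only [traceInf, Prod.fst_add, Prod.snd_add, Pi.add_apply, Complex.add_re, mul_add,
    Finset.sum_add_distrib]
  ring

lemma traceInf_smul (r : ℝ) (x : mixedSpace F) : traceInf (r • x) = r * traceInf x := by
  simp only [traceInf, Prod.smul_fst, Prod.smul_snd, Pi.smul_apply, Complex.real_smul,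
    Complex.re_ofReal_mul, smul_eq_mul, mul_add, Finset.mul_sum]
  congr 1
  exact Finset.sum_congr rfl fun _ _ => by ring

variable (F) in
/-- The trace as an `ℝ`-linear functional. -/
def traceInfLin : mixedSpace F →ₗ[ℝ] ℝ where
  toFun := traceInf
  map_add' := traceInf_add
  map_smul' := traceInf_smul

lemma traceInfLin_apply (x : mixedSpace F) : traceInfLin F x = traceInf x := rfl

lemma traceInf_zero : traceInf (0 : mixedSpace F) = 0 := map_zero (traceInfLin F)

lemma traceInf_neg (x : mixedSpace F) : traceInf (-x) = -traceInf x := map_neg (traceInfLin F) x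

lemma traceInf_sub (x y : mixedSpace F) : traceInf (x - y) = traceInf x - traceInf y :=
  map_sub (traceInfLin F) x y

lemma traceInf_sum {ι : Type*} (s : Finset ι) (f : ι → mixedSpace F) :
    traceInf (∑ i ∈ s, f i) = ∑ i ∈ s, traceInf (f i) := map_sum (traceInfLin F) f s

/-- The trace is the sum over all complex embeddings, and a conjugate pair contributes twice a real
part. -/
lemma traceInf_mixedEmbedding (x : F) :
    traceInf (mixedEmbedding F x) = ((Algebra.trace ℚ F x : ℚ) : ℝ) := by
  have h1 : ((Algebra.trace ℚ F x : ℚ) : ℂ) = ∑ φ : F →+* ℂ, φ x := by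
    have := trace_eq_sum_embeddings (K := ℚ) (L := F) ℂ (x := x)
    rw [eq_ratCast] at this
    rw [this]
    exact Fintype.sum_equiv (RingHom.equivRatAlgHom F ℂ).symm _ _ fun φ => rfl
  have h2 : ∑ φ : F →+* ℂ, φ x = ((traceInf (mixedEmbedding F x) : ℝ) : ℂ) := by
    rw [← (indexEquiv F).sum_comp, Fintype.sum_sum_type, Fintype.sum_prod_type, traceInf]
    push_cast
    congr 1
    · refine Finset.sum_congr rfl fun w _ => ?_
      rw [indexEquiv_apply_isReal, mixedEmbedding_apply_isReal]
      exact (embedding_of_isReal_apply w.2 x).symm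
    · refine Finset.sum_congr rfl fun w _ => ?_
      rw [Fin.sum_univ_two, indexEquiv_apply_isComplex_fst, indexEquiv_apply_isComplex_snd,
        mixedEmbedding_apply_isComplex, ComplexEmbedding.conjugate_coe_eq, Complex.add_conj]
      push_cast
      rfl
  have h3 := h1.trans h2
  exact_mod_cast h3.symm

lemma eq_zero_of_traceInf_mul (y : mixedSpace F) (h : ∀ w, traceInf (w * y) = 0) : y = 0 := by
  -- Against `star y` the trace is a positive combination of the squares of the local absolute
  -- values.
  have h1 := h (star y)
  have e1 (i) : (star y * y).1 i = y.1 i ^ 2 := by simp [sq]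
  have e2 (i) : ((star y * y).2 i).re = Complex.normSq (y.2 i) := by
    simp [Complex.normSq_apply]
  rw [traceInf] at h1
  simp only [e1, e2] at h1
  have p1 : 0 ≤ ∑ i, y.1 i ^ 2 := Finset.sum_nonneg fun i _ => sq_nonneg _
  have p2 : 0 ≤ ∑ i, 2 * Complex.normSq (y.2 i) :=
    Finset.sum_nonneg fun i _ => mul_nonneg two_pos.le (Complex.normSq_nonneg _)
  have q1 : ∑ i, y.1 i ^ 2 = 0 := by linarith
  have q2 : ∑ i, 2 * Complex.normSq (y.2 i) = 0 := by linarith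
  rw [Finset.sum_eq_zero_iff_of_nonneg fun i _ => sq_nonneg _] at q1
  rw [Finset.sum_eq_zero_iff_of_nonneg
    fun i _ => mul_nonneg two_pos.le (Complex.normSq_nonneg _)] at q2
  refine Prod.ext (funext fun i => ?_) (funext fun i => ?_)
  · simpa using q1 i (Finset.mem_univ _)
  · simpa using q2 i (Finset.mem_univ _)

lemma mem_inv_mul_different_inv {c : Frac F} {y : F} :
    y ∈ ((c⁻¹ * (different F)⁻¹ : Frac F) : FractionalIdeal (𝓞 F)⁰ F) ↔
      ∀ x ∈ (c : FractionalIdeal (𝓞 F)⁰ F), ∃ k : ℤ, Algebra.trace ℚ F (x * y) = k := by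
  have h : ((c⁻¹ * (different F)⁻¹ : Frac F) : FractionalIdeal (𝓞 F)⁰ F) =
      FractionalIdeal.dual ℤ ℚ (c : FractionalIdeal (𝓞 F)⁰ F) := by
    rw [FractionalIdeal.dual_eq_mul_inv, Units.val_mul, mul_comm]
    congr 1
    · rw [Units.val_inv_eq_inv_val, different, FractionalIdeal.coe_mk0,
        coeIdeal_differentIdeal ℤ ℚ, inv_inv]
    · rw [Units.val_inv_eq_inv_val]
  rw [h, FractionalIdeal.mem_dual c.ne_zero]
  refine forall₂_congr fun x _ => ?_
  rw [RingHom.mem_range, Algebra.traceForm_apply, mul_comm]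
  exact exists_congr fun k => by rw [eq_comm]; simp

/-- The real dual of a fractional ideal is no larger than the one inside `F`: a functional that is
integral on a `ℤ`-basis is realised by an integral combination of the trace-dual basis, and the
trace form is non-degenerate. -/
lemma mem_dual_ideal_iff (c : Frac F) (y : mixedSpace F) :
    (∀ x ∈ (c : FractionalIdeal (𝓞 F)⁰ F), ∃ k : ℤ, traceInf (mixedEmbedding F x * y) = k) ↔
      ∃ u ∈ ((c⁻¹ * (different F)⁻¹ : Frac F) : FractionalIdeal (𝓞 F)⁰ F),
        mixedEmbedding F u = y := by
  constructor
  · intro h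
    let β := basisOfFractionalIdeal F c
    have hβ (i) : β i ∈ (c : FractionalIdeal (𝓞 F)⁰ F) :=
      (mem_span_basisOfFractionalIdeal (I := c)).mp (Submodule.subset_span ⟨i, rfl⟩)
    choose k hk using fun i => h (β i) (hβ i)
    let u : F := ∑ i, (k i : ℚ) • β.traceDual i
    have hu (i) : traceInf (mixedEmbedding F (β i) * mixedEmbedding F u) = k i := by
      rw [← map_mul, traceInf_mixedEmbedding, Finset.mul_sum]
      simp only [map_sum, mul_smul_comm, map_smul, Module.Basis.trace_mul_traceDual]
      simp
    have hy : mixedEmbedding F u = y := by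
      rw [← sub_eq_zero]
      refine eq_zero_of_traceInf_mul _ fun w => ?_
      have : (traceInfLin F).comp (LinearMap.mulRight ℝ (mixedEmbedding F u - y)) = 0 := by
        refine (fractionalIdealLatticeBasis F c).ext fun i => ?_
        rw [fractionalIdealLatticeBasis_apply]
        simp only [LinearMap.comp_apply, LinearMap.mulRight_apply, traceInfLin_apply, mul_sub,
          traceInf_sub, LinearMap.zero_apply]
        rw [hu, hk, sub_self]
      exact LinearMap.congr_fun this w
    refine ⟨u, mem_inv_mul_different_inv.mpr fun x hx => ?_, hy⟩
    obtain ⟨l, hl⟩ := h x hx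
    refine ⟨l, ?_⟩
    rw [← hy, ← map_mul, traceInf_mixedEmbedding] at hl
    exact_mod_cast hl
  · rintro ⟨u, hu, rfl⟩ x hx
    obtain ⟨l, hl⟩ := mem_inv_mul_different_inv.mp hu x hx
    exact ⟨l, by rw [← map_mul, traceInf_mixedEmbedding, hl]; simp⟩

/-- The ideals `𝔞_i 𝔞_{n+1}⁻¹ 𝔡⁻¹` whose sum is `N^∨`. -/
def dualIdeals (a : Fin (n + 1) → Frac F) (i : Fin n) : Frac F :=
  a i.castSucc * (a (Fin.last n))⁻¹ * (different F)⁻¹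

lemma mem_unipLattice {a : Fin (n + 1) → Frac F} {ξ : Fin n → mixedSpace F} :
    ξ ∈ unipLattice a ↔ ∃ x ∈ sumLattice (fun i : Fin n => (a i.castSucc)⁻¹ * a (Fin.last n)),
      emb x = ξ := by
  rw [unipLattice, AddSubgroup.mem_pi]
  constructor
  · intro h
    choose x hx hx' using fun i => AddSubgroup.mem_map.mp (h i (Set.mem_univ i))
    exact ⟨x, mem_sumLattice.mpr hx, funext hx'⟩
  · rintro ⟨x, hx, rfl⟩ i _
    exact AddSubgroup.mem_map.mpr ⟨x i, mem_sumLattice.mp hx i, rfl⟩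

/-- Testing against vectors of `N` supported in one coordinate reduces the dual of the sum to the
duals of the summands. -/
lemma mem_dualLattice {a : Fin (n + 1) → Frac F} {ν : Fin n → mixedSpace F} :
    ν ∈ dualLattice a ↔ ∃ x ∈ sumLattice (dualIdeals a), emb x = ν := by
  have key (i : Fin n) : (((a i.castSucc)⁻¹ * a (Fin.last n))⁻¹ * (different F)⁻¹ : Frac F) =
      dualIdeals a i := by
    rw [dualIdeals, mul_inv, inv_inv]
  constructor
  · intro h
    have h1 (i : Fin n) : ∃ u ∈ ((dualIdeals a i : Frac F) : FractionalIdeal (𝓞 F)⁰ F),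
        mixedEmbedding F u = ν i := by
      rw [← key, ← mem_dual_ideal_iff]
      intro x hx
      have hm : (Pi.single i (mixedEmbedding F x) : Fin n → mixedSpace F) ∈ unipLattice a := by
        rw [mem_unipLattice]
        refine ⟨Pi.single i x, mem_sumLattice.mpr fun j => ?_, funext fun j => ?_⟩
        · rcases eq_or_ne j i with rfl | hj
          · simpa using hx
          · rw [Pi.single_eq_of_ne hj]
            exact FractionalIdeal.zero_mem _
        · rcases eq_or_ne j i with rfl | hj
          · simp [emb]
          · simp [emb, Pi.single_eq_of_ne hj]
      obtain ⟨k, hk⟩ := h _ hm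
      refine ⟨k, ?_⟩
      rw [← hk, pairing, Finset.sum_eq_single i]
      · simp
      · intro j _ hj
        rw [Pi.single_eq_of_ne hj, zero_mul, traceInf_zero]
      · simp
    choose x hx hx' using h1
    exact ⟨x, mem_sumLattice.mpr hx, funext hx'⟩
  · rintro ⟨x, hx, rfl⟩ ξ hξ
    obtain ⟨w, hw, rfl⟩ := mem_unipLattice.mp hξ
    have h1 (i : Fin n) : ∃ k : ℤ, traceInf (emb w i * emb x i) = k := by
      refine (mem_dual_ideal_iff _ (emb x i)).mpr ⟨x i, ?_, rfl⟩ (w i) (mem_sumLattice.mp hw i)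
      rw [key]
      exact mem_sumLattice.mp hx i
    choose k hk using h1
    exact ⟨∑ i, k i, by simp [pairing, hk]⟩

lemma emb_eq_zero_iff {x : Fin n → F} : emb x = 0 ↔ x = 0 := by
  constructor
  · intro h
    exact emb_injective (h.trans (funext fun i => (map_zero _).symm))
  · rintro rfl
    exact funext fun i => map_zero _

lemma mem_dualPrimVec {a : Fin (n + 1) → Frac F} {b : Frac F} {ν : Fin n → mixedSpace F} :
    ν ∈ dualPrimVec a b ↔ ∃ x ∈ primVec (sumLattice (dualIdeals a)) b, emb x = ν := by
  have hs (α : F) (x : Fin n → F) : mixedEmbedding F α • emb x ∈ dualLattice a ↔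
      α • x ∈ sumLattice (dualIdeals a) := by
    rw [← emb_smul, mem_dualLattice]
    exact ⟨fun ⟨y, hy, e⟩ => emb_injective e ▸ hy, fun h => ⟨_, h, rfl⟩⟩
  constructor
  · rintro ⟨h1, h2, h3⟩
    obtain ⟨x, hx, rfl⟩ := mem_dualLattice.mp h1
    exact ⟨x, ⟨hx, fun h => h2 (emb_eq_zero_iff.mpr h), fun α => (hs α x).symm.trans (h3 α)⟩, rfl⟩
  · rintro ⟨x, ⟨h1, h2, h3⟩, rfl⟩
    exact ⟨mem_dualLattice.mpr ⟨x, h1, rfl⟩, fun h => h2 (emb_eq_zero_iff.mp h),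
      fun α => (hs α x).trans (h3 α)⟩

/-- The summands of `N^∨` and of `L^{(1)}` differ by one and the same ideal, so contents in the two
lattices can be compared. This is where the different and `𝔞_n` enter the Ramanujan sums. -/
lemma contentInv_dualIdeals (a : Fin (n + 1) → Frac F) (x : Fin n → F) :
    contentInv (dualIdeals a) x = contentInv (fun i : Fin n => a i.castSucc) x *
      ((a (Fin.last n) * different F : Frac F) : FractionalIdeal (𝓞 F)⁰ F) := by
  rw [contentInv, contentInv, Finset.sum_mul]
  refine Finset.sum_congr rfl fun i _ => ?_
  rw [mul_assoc, ← Units.val_mul, dualIdeals]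
  congr 2
  simp only [mul_inv, inv_inv, mul_assoc]

lemma mem_primVec_toFrac_inv {a : Fin n → Frac F} {k : (Ideal (𝓞 F))⁰} {x : Fin n → F} :
    x ∈ primVec (sumLattice a) (toFrac k)⁻¹ ↔ x ≠ 0 ∧
      contentInv a x = ((toFrac k : Frac F) : FractionalIdeal (𝓞 F)⁰ F) := by
  rw [mem_primVec, one_mem_iff, inv_inv]
  exact ⟨fun h => ⟨h.1, h.2.2⟩, fun h => ⟨h.1, toFrac_le_one _, h.2⟩⟩

lemma exists_mem_primVec {a : Fin n → Frac F} {x : Fin n → F} (hx : x ∈ sumLattice a)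
    (hx0 : x ≠ 0) : ∃! k : (Ideal (𝓞 F))⁰, x ∈ primVec (sumLattice a) (toFrac k)⁻¹ := by
  have h1 : contentInv a x ≤ 1 := by
    have := (smul_mem_sumLattice (a := a) (x := x) (α := 1)).mp (by rwa [one_smul])
    rwa [FractionalIdeal.spanSingleton_one, one_mul] at this
  obtain ⟨k, hk⟩ := (exists_toFrac_iff (Units.mk0 _ (contentInv_ne_zero (a := a) hx0))).mpr h1
  refine ⟨k, mem_primVec_toFrac_inv.mpr ⟨hx0, by rw [← hk]; rfl⟩, fun k' hk' => ?_⟩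
  refine toFrac_injective (Units.ext ?_)
  rw [← (mem_primVec_toFrac_inv.mp hk').2, ← hk]
  rfl

/-- The non-zero vectors of `N^∨`, sorted by their content. -/
def dualEquiv (a : Fin (n + 1) → Frac F) :
    (Σ k : (Ideal (𝓞 F))⁰, dualPrimVec a (toFrac k)⁻¹) ≃ {ν // ν ∈ dualLattice a ∧ ν ≠ 0} :=
  Equiv.ofBijective (fun p => ⟨p.2.1, p.2.2.1, p.2.2.2.1⟩) <| by
    constructor
    · rintro ⟨k, ν, hν⟩ ⟨k', ν', hν'⟩ h
      obtain rfl : ν = ν' := congrArg Subtype.val h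
      obtain ⟨x, hx, rfl⟩ := mem_dualPrimVec.mp hν
      obtain ⟨x', hx', e⟩ := mem_dualPrimVec.mp hν'
      obtain rfl := emb_injective e
      obtain rfl : k = k' := (exists_mem_primVec hx.1 hx.2.1).unique hx hx'
      rfl
    · rintro ⟨ν, h1, h2⟩
      obtain ⟨x, hx, rfl⟩ := mem_dualLattice.mp h1
      obtain ⟨k, hk, _⟩ := exists_mem_primVec hx fun h => h2 (emb_eq_zero_iff.mpr h)
      exact ⟨⟨k, emb x, mem_dualPrimVec.mpr ⟨x, hk, rfl⟩⟩, rfl⟩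

/-! ### Ramanujan sums -/

/-- The elements of `𝔠𝔪⁻¹` that generate the module `𝔠𝔪⁻¹ / 𝔠`. -/
def unitVecs (m : (Ideal (𝓞 F))⁰) (c : Frac F) : Set F :=
  {x | FractionalIdeal.spanSingleton (𝓞 F)⁰ x + (c : FractionalIdeal (𝓞 F)⁰ F) =
    ((c * (toFrac m)⁻¹ : Frac F) : FractionalIdeal (𝓞 F)⁰ F)}

lemma le_mul_toFrac_inv (m : (Ideal (𝓞 F))⁰) (c : Frac F) : (c : FractionalIdeal (𝓞 F)⁰ F) ≤
    ((c * (toFrac m)⁻¹ : Frac F) : FractionalIdeal (𝓞 F)⁰ F) := by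
  calc (c : FractionalIdeal (𝓞 F)⁰ F) = ((c * (toFrac m)⁻¹ : Frac F) : FractionalIdeal (𝓞 F)⁰ F) *
        ((toFrac m : Frac F) : FractionalIdeal (𝓞 F)⁰ F) := by
        rw [← Units.val_mul, inv_mul_cancel_right]
    _ ≤ ((c * (toFrac m)⁻¹ : Frac F) : FractionalIdeal (𝓞 F)⁰ F) * 1 := by
        gcongr
        exact toFrac_le_one m
    _ = _ := mul_one _

lemma mem_of_mem_unitVecs {m : (Ideal (𝓞 F))⁰} {c : Frac F} {x : F} (hx : x ∈ unitVecs m c) :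
    x ∈ ramModule m c := by
  change x ∈ ((c * (toFrac m)⁻¹ : Frac F) : FractionalIdeal (𝓞 F)⁰ F)
  rw [← FractionalIdeal.spanSingleton_le_iff_mem, ← hx]
  exact le_self_add

/-- The generators of `𝔠𝔪⁻¹ / 𝔠`. -/
abbrev RamGen (m : (Ideal (𝓞 F))⁰) (c : Frac F) : Type _ :=
  {q : RamQuot m c // Submodule.span (𝓞 F) {q} = ⊤}

/-- The representatives in the definition of the Ramanujan sum. -/
def ramRep (m : (Ideal (𝓞 F))⁰) (c : Frac F) (q : RamQuot m c) : F :=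
  (Function.surjInv (Submodule.mkQ_surjective _) q : ramModule m c)

lemma span_mkQ_eq_top_iff {m : (Ideal (𝓞 F))⁰} {c : Frac F} (r : ramModule m c) :
    Submodule.span (𝓞 F) {(Submodule.mkQ _ r : RamQuot m c)} = ⊤ ↔ (r : F) ∈ unitVecs m c := by
  rw [← Set.image_singleton, ← Submodule.map_span, Submodule.map_mkQ_eq_top]
  have hinj := Submodule.map_injective_of_injective (ramModule m c).injective_subtype
  rw [← hinj.eq_iff, Submodule.map_sup, Submodule.map_span, Set.image_singleton,
    Submodule.submoduleOf, Submodule.map_comap_subtype, Submodule.map_top,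
    Submodule.range_subtype, unitVecs, Set.mem_ofPred_eq,
    ← FractionalIdeal.coeToSubmodule_injective.eq_iff, FractionalIdeal.coe_add,
    FractionalIdeal.coe_spanSingleton, Submodule.add_eq_sup, sup_comm,
    inf_eq_right.mpr (show ((c : FractionalIdeal (𝓞 F)⁰ F) : Submodule (𝓞 F) F) ≤ ramModule m c
      from le_mul_toFrac_inv m c)]
  rfl

lemma exists_eq_ramRep {m : (Ideal (𝓞 F))⁰} {c : Frac F} (q : RamQuot m c) :
    ∃ r : ramModule m c, (r : F) = ramRep m c q ∧ Submodule.mkQ _ r = q :=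
  ⟨_, rfl, Function.surjInv_eq (Submodule.mkQ_surjective _) q⟩

lemma ramRep_mem {m : (Ideal (𝓞 F))⁰} {c : Frac F} (q : RamGen m c) :
    ramRep m c q.1 ∈ unitVecs m c := by
  obtain ⟨r, hr, hr'⟩ := exists_eq_ramRep q.1
  rw [← hr, ← span_mkQ_eq_top_iff, hr']
  exact q.2

lemma mkQ_eq_iff {m : (Ideal (𝓞 F))⁰} {c : Frac F} (r r' : ramModule m c) :
    (Submodule.mkQ _ r : RamQuot m c) = Submodule.mkQ _ r' ↔
      (r : F) - r' ∈ (c : FractionalIdeal (𝓞 F)⁰ F) := by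
  rw [Submodule.mkQ_apply, Submodule.mkQ_apply, Submodule.Quotient.eq]
  rfl

lemma existsUnique_ramRep {m : (Ideal (𝓞 F))⁰} {c : Frac F} {x : F} (hx : x ∈ unitVecs m c) :
    ∃! q : RamGen m c, x - ramRep m c q.1 ∈ (c : FractionalIdeal (𝓞 F)⁰ F) := by
  let r : ramModule m c := ⟨x, mem_of_mem_unitVecs hx⟩
  have key (q : RamQuot m c) : x - ramRep m c q ∈ (c : FractionalIdeal (𝓞 F)⁰ F) ↔
      (Submodule.mkQ _ r : RamQuot m c) = q := by
    obtain ⟨r', hr, hr'⟩ := exists_eq_ramRep q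
    rw [← hr, ← hr']
    exact (mkQ_eq_iff r r').symm
  refine ⟨⟨Submodule.mkQ _ r, (span_mkQ_eq_top_iff r).mpr hx⟩, (key _).mpr rfl, fun q hq => ?_⟩
  exact Subtype.ext ((key _).mp hq).symm

lemma add_mem_unitVecs {m : (Ideal (𝓞 F))⁰} {c : Frac F} {x l : F} (hx : x ∈ unitVecs m c)
    (hl : l ∈ (c : FractionalIdeal (𝓞 F)⁰ F)) : x + l ∈ unitVecs m c := by
  have key (y l : F) (hl : l ∈ (c : FractionalIdeal (𝓞 F)⁰ F)) :
      FractionalIdeal.spanSingleton (𝓞 F)⁰ (y + l) + (c : FractionalIdeal (𝓞 F)⁰ F) ≤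
        FractionalIdeal.spanSingleton (𝓞 F)⁰ y + (c : FractionalIdeal (𝓞 F)⁰ F) := by
    rw [← FractionalIdeal.sup_eq_add, ← FractionalIdeal.sup_eq_add]
    refine sup_le ?_ le_sup_right
    rw [FractionalIdeal.spanSingleton_le_iff_mem, FractionalIdeal.sup_eq_add,
      FractionalIdeal.mem_add]
    exact ⟨y, FractionalIdeal.mem_spanSingleton_self _ _, l, hl, rfl⟩
  refine Eq.trans (le_antisymm (key x l hl) ?_) hx
  have := key (x + l) (-l) (Submodule.neg_mem _ hl)
  rwa [add_neg_cancel_right] at this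

/-- `𝔠𝔪⁻¹ ∋ x` generating `𝔠𝔪⁻¹/𝔠` is a representative of a generator plus an element of `𝔠`. -/
def unitVecsEquiv (m : (Ideal (𝓞 F))⁰) (c : Frac F) :
    (RamGen m c × (c : FractionalIdeal (𝓞 F)⁰ F)) ≃ unitVecs m c :=
  Equiv.ofBijective (fun p => ⟨ramRep m c p.1.1 + p.2.1, add_mem_unitVecs (ramRep_mem _) p.2.2⟩) <| by
    constructor
    · rintro ⟨q, l⟩ ⟨q', l'⟩ h
      have h' : ramRep m c q.1 + l.1 = ramRep m c q'.1 + l'.1 := congrArg Subtype.val h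
      have h1 : q = q' := by
        refine (existsUnique_ramRep (add_mem_unitVecs (ramRep_mem q) l.2)).unique ?_ ?_
        · rw [add_sub_cancel_left]
          exact l.2
        · rw [h', add_sub_cancel_left]
          exact l'.2
      subst h1
      rw [Subtype.ext (add_left_cancel h')]
    · rintro ⟨x, hx⟩
      obtain ⟨q, hq, _⟩ := existsUnique_ramRep hx
      exact ⟨⟨q, ⟨_, hq⟩⟩, Subtype.ext (add_sub_cancel _ _)⟩

/-- In a Dedekind domain `𝔠𝔪⁻¹` is generated by `𝔠` and one more element `x`, so the quotient is
cyclic; its annihilator is `𝔪`. -/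
lemma exists_linearEquiv_ramQuot (m : (Ideal (𝓞 F))⁰) (c : Frac F) :
    Nonempty ((𝓞 F ⧸ (m : Ideal (𝓞 F))) ≃ₗ[𝓞 F] RamQuot m c) := by
  obtain ⟨x, hx⟩ := IsDedekindDomain.exists_add_spanSingleton_mul_eq (le_mul_toFrac_inv m c)
    c.ne_zero (one_ne_zero (α := FractionalIdeal (𝓞 F)⁰ F))
  rw [mul_one, add_comm] at hx
  have hx' : x ∈ unitVecs m c := hx
  let r : ramModule m c := ⟨x, mem_of_mem_unitVecs hx'⟩
  let f : 𝓞 F →ₗ[𝓞 F] RamQuot m c := LinearMap.toSpanSingleton _ _ (Submodule.mkQ _ r)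
  have hf : Function.Surjective f := by
    rw [← LinearMap.range_eq_top, LinearMap.range_toSpanSingleton]
    exact (span_mkQ_eq_top_iff r).mpr hx'
  have hker : LinearMap.ker f = (m : Ideal (𝓞 F)) := by
    ext t
    have h1 : t ∈ LinearMap.ker f ↔ t • x ∈ (c : FractionalIdeal (𝓞 F)⁰ F) := by
      rw [LinearMap.mem_ker, LinearMap.toSpanSingleton_apply, ← map_smul, Submodule.mkQ_apply,
        Submodule.Quotient.mk_eq_zero]
      rfl
    have hc : ∀ c' : Frac F, FractionalIdeal.spanSingleton (𝓞 F)⁰ (t : F) * (c' : FractionalIdeal (𝓞 F)⁰ F) ≤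
        (c : FractionalIdeal (𝓞 F)⁰ F) ↔ (t : F) ∈ ((c * c'⁻¹ : Frac F) : FractionalIdeal (𝓞 F)⁰ F) := by
      intro c'
      rw [mem_frac_iff, mul_inv_rev, inv_inv, Units.val_mul, ← mul_assoc]
      constructor
      · intro h
        calc _ ≤ (c : FractionalIdeal (𝓞 F)⁰ F) * ((c⁻¹ : Frac F) : FractionalIdeal (𝓞 F)⁰ F) := by
              gcongr
          _ = 1 := Units.mul_inv c
      · intro h
        calc _ = FractionalIdeal.spanSingleton (𝓞 F)⁰ (t : F) * (c' : FractionalIdeal (𝓞 F)⁰ F) *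
              ((c⁻¹ : Frac F) : FractionalIdeal (𝓞 F)⁰ F) * (c : FractionalIdeal (𝓞 F)⁰ F) := by
              rw [mul_assoc _ _ (c : FractionalIdeal (𝓞 F)⁰ F), Units.inv_mul, mul_one]
          _ ≤ 1 * (c : FractionalIdeal (𝓞 F)⁰ F) := by gcongr
          _ = _ := one_mul _
    -- As `t𝔠 ⊂ 𝔠` always holds, `tx ∈ 𝔠` is equivalent to `t𝔠𝔪⁻¹ ⊂ 𝔠`, that is, to `t ∈ 𝔪`.
    have h2 := hc (c * (toFrac m)⁻¹)
    rw [← hx, mul_add, FractionalIdeal.spanSingleton_mul_spanSingleton,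
      ← FractionalIdeal.sup_eq_add, sup_le_iff, FractionalIdeal.spanSingleton_le_iff_mem,
      mul_inv_rev, inv_inv, mul_comm (toFrac m), mul_inv_cancel_left] at h2
    have h3 : FractionalIdeal.spanSingleton (𝓞 F)⁰ (t : F) * (c : FractionalIdeal (𝓞 F)⁰ F) ≤
        (c : FractionalIdeal (𝓞 F)⁰ F) := by
      rw [hc, mul_inv_cancel]
      exact FractionalIdeal.coe_mem_one _ t
    rw [h1, Algebra.smul_def, show algebraMap (𝓞 F) F t * x = (t : F) * x from rfl]
    have h4 : (t : F) ∈ ((toFrac m : Frac F) : FractionalIdeal (𝓞 F)⁰ F) ↔ t ∈ (m : Ideal (𝓞 F)) := by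
      rw [FractionalIdeal.coe_mk0, FractionalIdeal.mem_coeIdeal]
      exact ⟨fun ⟨t', ht', e⟩ => (RingOfIntegers.coe_injective e) ▸ ht', fun h => ⟨t, h, rfl⟩⟩
    rw [← h4, ← h2]
    exact ⟨fun h => ⟨h, h3⟩, fun h => h.1⟩
  exact ⟨(Submodule.quotEquivOfEq _ _ hker.symm).trans (f.quotKerEquivOfSurjective hf)⟩

lemma finite_quotient (m : (Ideal (𝓞 F))⁰) : Finite (𝓞 F ⧸ (m : Ideal (𝓞 F))) :=
  Ideal.finiteQuotientOfFreeOfNeBot _ (nonZeroDivisors.coe_ne_zero m)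

instance finite_ramQuot (m : (Ideal (𝓞 F))⁰) (c : Frac F) : Finite (RamQuot m c) := by
  obtain ⟨e⟩ := exists_linearEquiv_ramQuot m c
  have := finite_quotient m
  exact Finite.of_equiv _ e.toEquiv

/-- Under the isomorphism with `𝓞_F/𝔪`, module generators are the units of the quotient ring. -/
lemma card_ramGen (m : (Ideal (𝓞 F))⁰) (c : Frac F) : Nat.card (RamGen m c) = totient m := by
  obtain ⟨e⟩ := exists_linearEquiv_ramQuot m c
  rw [totient]
  refine Nat.card_congr (((Equiv.ofBijective (fun u : (𝓞 F ⧸ (m : Ideal (𝓞 F)))ˣ =>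
    (⟨u, u.isUnit⟩ : {x : 𝓞 F ⧸ (m : Ideal (𝓞 F)) // IsUnit x})) ⟨fun u v h =>
      Units.ext (congrArg Subtype.val h), fun ⟨x, hx⟩ => ⟨hx.unit, rfl⟩⟩).trans
    (e.toEquiv.subtypeEquiv fun u => ?_)).symm)
  have h1 : Submodule.span (𝓞 F) {e u} = (Submodule.span (𝓞 F) {u}).map e.toLinearMap := by
    rw [Submodule.map_span, Set.image_singleton]
    rfl
  change IsUnit u ↔ Submodule.span (𝓞 F) {e u} = ⊤
  have h2 : ∀ S : Submodule (𝓞 F) (𝓞 F ⧸ (m : Ideal (𝓞 F))), S.map e.toLinearMap = ⊤ ↔ S = ⊤ := by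
    intro S
    refine (Submodule.map_injective_of_injective (f := e.toLinearMap) e.injective).eq_iff' ?_
    rw [Submodule.map_top]
    exact LinearEquiv.range e
  rw [h1, h2, Submodule.eq_top_iff']
  simp only [Submodule.mem_span_singleton]
  constructor
  · intro hu x
    obtain ⟨t, ht⟩ := Ideal.Quotient.mk_surjective (x * ((hu.unit⁻¹ : (𝓞 F ⧸ (m : Ideal (𝓞 F)))ˣ) :
      𝓞 F ⧸ (m : Ideal (𝓞 F))))
    refine ⟨t, ?_⟩
    rw [Algebra.smul_def, Ideal.Quotient.algebraMap_eq, ht, mul_assoc, hu.val_inv_mul, mul_one]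
  · intro h
    obtain ⟨t, ht⟩ := h 1
    rw [Algebra.smul_def] at ht
    exact IsUnit.of_mul_eq_one_right _ ht

lemma totient_le (m : (Ideal (𝓞 F))⁰) : (totient m : ℝ) ≤ fnorm (toFrac m) := by
  have := finite_quotient m
  rw [fnorm_toFrac]
  have : totient m ≤ Nat.card (𝓞 F ⧸ (m : Ideal (𝓞 F))) :=
    Nat.card_le_card_of_injective _ Units.val_injective
  rw [Ideal.absNorm_apply, Submodule.cardQuot_apply]
  exact_mod_cast this

/-! ### The additive character of `F` and evaluation of Ramanujan sums. -/

variable (F) in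
/-- The additive character `e^{2πi Tr(x)}`. -/
def charTr (x : F) : ℂ := Complex.exp (2 * Real.pi * Complex.I * ((Algebra.trace ℚ F x : ℚ) : ℂ))

lemma charTr_add (x y : F) : charTr F (x + y) = charTr F x * charTr F y := by
  rw [charTr, charTr, charTr, ← Complex.exp_add, map_add]
  push_cast
  ring_nf

lemma norm_charTr (x : F) : ‖charTr F x‖ = 1 := by
  rw [charTr, show (2 * Real.pi * Complex.I * ((Algebra.trace ℚ F x : ℚ) : ℂ)) =
    ((2 * Real.pi * ((Algebra.trace ℚ F x : ℚ) : ℝ) : ℝ) : ℂ) * Complex.I by push_cast; ring]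
  exact Complex.norm_exp_ofReal_mul_I _

lemma charTr_eq_one {x : F} (hx : x ∈ (((different F)⁻¹ : Frac F) : FractionalIdeal (𝓞 F)⁰ F)) :
    charTr F x = 1 := by
  have := (mem_inv_mul_different_inv (c := 1) (y := x)).mp (by simpa using hx) 1
    (FractionalIdeal.one_mem_one _)
  obtain ⟨k, hk⟩ := this
  rw [one_mul] at hk
  rw [charTr, hk, Complex.exp_eq_one_iff]
  exact ⟨k, by push_cast; ring⟩

lemma ramanujanSum_eq (m : (Ideal (𝓞 F))⁰) (c : Frac F) :
    ramanujanSum m c = ∑ᶠ q : RamGen m c, charTr F (ramRep m c q.1) := rfl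

lemma norm_ramanujanSum_le (m : (Ideal (𝓞 F))⁰) (c : Frac F) :
    ‖ramanujanSum m c‖ ≤ totient m := by
  have := Fintype.ofFinite (RamGen m c)
  rw [ramanujanSum_eq, finsum_eq_sum_of_fintype, ← card_ramGen m c, Nat.card_eq_fintype_card]
  refine (norm_sum_le _ _).trans ?_
  simp [norm_charTr]

/-- For `𝔠 ⊂ 𝔡⁻¹` the Ramanujan sum may be computed with any representatives. -/
lemma ramanujanSum_eq_of_reps {m : (Ideal (𝓞 F))⁰} {c : Frac F}
    (hc : (c : FractionalIdeal (𝓞 F)⁰ F) ≤ (((different F)⁻¹ : Frac F) : FractionalIdeal (𝓞 F)⁰ F))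
    {ι : Type*} (r : ι → F) (hr : ∀ i, r i ∈ unitVecs m c)
    (hr' : ∀ x ∈ unitVecs m c, ∃! i, x - r i ∈ (c : FractionalIdeal (𝓞 F)⁰ F)) :
    ramanujanSum m c = ∑ᶠ i, charTr F (r i) := by
  choose f hf hf' using hr'
  have hneg {x y : F} (h : x - y ∈ (c : FractionalIdeal (𝓞 F)⁰ F)) :
      y - x ∈ (c : FractionalIdeal (𝓞 F)⁰ F) := by
    rw [← neg_sub]
    exact Submodule.neg_mem _ h
  rw [ramanujanSum_eq]
  refine finsum_eq_of_bijective (fun q : RamGen m c => f _ (ramRep_mem q)) ⟨?_, ?_⟩ fun q => ?_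
  · intro q q' h
    have h1 := hf _ (ramRep_mem q)
    have h2 := hf _ (ramRep_mem q')
    beta_reduce at h
    rw [← h] at h2
    exact (existsUnique_ramRep (hr (f _ (ramRep_mem q)))).unique (hneg h1) (hneg h2)
  · intro i
    obtain ⟨q, hq, _⟩ := existsUnique_ramRep (hr i)
    exact ⟨q, (hf' _ (ramRep_mem q) i (hneg hq)).symm⟩
  · have h1 := hc (hf _ (ramRep_mem q))
    conv_lhs => rw [← sub_add_cancel (ramRep m c q.1) (r (f _ (ramRep_mem q))), charTr_add,
      charTr_eq_one h1, one_mul]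

lemma mul_mem_princ_mul {μ x : F} (hμ : μ ≠ 0) {c : Frac F} :
    μ * x ∈ ((princ μ hμ * c : Frac F) : FractionalIdeal (𝓞 F)⁰ F) ↔
      x ∈ (c : FractionalIdeal (𝓞 F)⁰ F) := by
  rw [Units.val_mul, coe_princ, FractionalIdeal.mem_singleton_mul]
  exact ⟨fun ⟨y, hy, e⟩ => mul_left_cancel₀ hμ e ▸ hy, fun h => ⟨x, h, rfl⟩⟩

lemma mul_mem_unitVecs {μ x : F} (hμ : μ ≠ 0) {m : (Ideal (𝓞 F))⁰} {c : Frac F} :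
    μ * x ∈ unitVecs m (princ μ hμ * c) ↔ x ∈ unitVecs m c := by
  rw [unitVecs, unitVecs, Set.mem_ofPred_eq, Set.mem_ofPred_eq, mul_assoc, Units.val_mul,
    Units.val_mul (princ μ hμ), coe_princ, ← FractionalIdeal.spanSingleton_mul_spanSingleton,
    ← mul_add]
  have h0 : FractionalIdeal.spanSingleton (𝓞 F)⁰ μ ≠ 0 :=
    FractionalIdeal.spanSingleton_ne_zero_iff.mpr hμ
  exact mul_right_inj' h0

/-- Multiplication by `μ` carries representatives for `𝔠` to representatives for `μ𝔠`. This turns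
the coset weights `e^{2πi Tr(μr)}` into a Ramanujan sum that depends on `μ𝔠` alone. -/
lemma ramanujanSum_princ_mul {μ : F} (hμ : μ ≠ 0) (m : (Ideal (𝓞 F))⁰) (c : Frac F)
    (hc : ((princ μ hμ * c : Frac F) : FractionalIdeal (𝓞 F)⁰ F) ≤
      (((different F)⁻¹ : Frac F) : FractionalIdeal (𝓞 F)⁰ F)) :
    ramanujanSum m (princ μ hμ * c) = ∑ᶠ q : RamGen m c, charTr F (μ * ramRep m c q.1) := by
  refine ramanujanSum_eq_of_reps hc _ (fun q => (mul_mem_unitVecs hμ).mpr (ramRep_mem q)) ?_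
  intro x hx
  obtain ⟨x, rfl⟩ : ∃ x', μ * x' = x := ⟨μ⁻¹ * x, by field_simp⟩
  simp only [← mul_sub, mul_mem_princ_mul]
  exact existsUnique_ramRep ((mul_mem_unitVecs hμ).mp hx)

/-! ### Fractional ideals as lattices in `F_∞` -/

/-- The image of a fractional ideal in `F_∞`. -/
def idealImage (c : Frac F) : AddSubgroup (mixedSpace F) :=
  ((c : FractionalIdeal (𝓞 F)⁰ F) : Submodule (𝓞 F) F).toAddSubgroup.map
    (mixedEmbedding F).toAddMonoidHom

lemma mem_idealImage {c : Frac F} {w : mixedSpace F} :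
    w ∈ idealImage c ↔ ∃ x ∈ (c : FractionalIdeal (𝓞 F)⁰ F), mixedEmbedding F x = w :=
  AddSubgroup.mem_map

lemma mixedEmbedding_injective' : Function.Injective (mixedEmbedding F) :=
  (mixedEmbedding F).injective

/-- A fractional ideal is in bijection with its image in `F_∞`. -/
def idealImageEquiv (c : Frac F) : (c : FractionalIdeal (𝓞 F)⁰ F) ≃ idealImage c :=
  Equiv.ofBijective (fun x => ⟨mixedEmbedding F x, mem_idealImage.mpr ⟨x, x.2, rfl⟩⟩)
    ⟨fun _ _ h => Subtype.ext (mixedEmbedding_injective' (congrArg Subtype.val h)),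
      fun ⟨_, hw⟩ => by
        obtain ⟨x, hx, rfl⟩ := mem_idealImage.mp hw
        exact ⟨⟨x, hx⟩, rfl⟩⟩

/-! ### Measures, countability and covolumes. -/

instance countable_numberField : Countable F := Finsupp.Countable.of_moduleFinite (R := ℚ)

instance borelSpace_vec : BorelSpace (Fin n → mixedSpace F) := Pi.borelSpace

instance sigmaFinite_mixedSpace : SigmaFinite (volume : Measure (mixedSpace F)) := inferInstance

instance isAddHaarMeasure_mixedSpace : (volume : Measure (mixedSpace F)).IsAddHaarMeasure :=
  inferInstance

instance measurableAdd_mixedSpace : MeasurableAdd (mixedSpace F) := inferInstance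

instance isAddHaarMeasure_vec : (volume : Measure (Fin n → mixedSpace F)).IsAddHaarMeasure :=
  Measure.pi.isAddHaarMeasure (fun _ : Fin n => (volume : Measure (mixedSpace F)))

instance (c : Frac F) : Countable (idealImage c) := (idealImageEquiv c).symm.injective.countable

instance (a : Fin (n + 1) → Frac F) : Countable (unipLattice a) := by
  have h : (unipLattice a : Set (Fin n → mixedSpace F)) ⊆ Set.range emb := by
    intro ξ hξ
    obtain ⟨x, _, rfl⟩ := mem_unipLattice.mp hξ
    exact ⟨x, rfl⟩
  exact (Set.countable_range _).mono h

/-- The covolume of a fractional ideal. -/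
def idealCovol (c : Frac F) : ℝ :=
  fnorm c * (2⁻¹ ^ nrComplexPlaces F * Real.sqrt |(discr F : ℝ)|)

lemma volume_fundamentalDomain (c : Frac F) :
    volume (ZSpan.fundamentalDomain (fractionalIdealLatticeBasis F c)) =
      ENNReal.ofReal (idealCovol c) := by
  rw [volume_fundamentalDomain_fractionalIdealLatticeBasis, volume_fundamentalDomain_latticeBasis,
    idealCovol, fnorm, ENNReal.ofReal_mul (by exact_mod_cast FractionalIdeal.absNorm_nonneg _),
    ENNReal.ofReal_mul (by positivity)]
  congr 2
  · rw [ENNReal.ofReal_pow (by norm_num), ENNReal.ofReal_inv_of_pos two_pos, ENNReal.ofReal_ofNat]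
  · rw [show Real.sqrt |(discr F : ℝ)| = ((NNReal.sqrt ‖discr F‖₊ : NNReal) : ℝ) by
      simp [Int.norm_eq_abs], ENNReal.ofReal_coe_nnreal]

lemma idealCovol_pos (c : Frac F) : 0 < idealCovol c := by
  have h := ZSpan.measure_fundamentalDomain_ne_zero (μ := volume) (fractionalIdealLatticeBasis F c)
  rw [volume_fundamentalDomain] at h
  simpa using h

lemma existsUnique_vadd_mem (c : Frac F) (w : mixedSpace F) :
    ∃! l : idealImage c, l +ᵥ w ∈ ZSpan.fundamentalDomain (fractionalIdealLatticeBasis F c) := by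
  have hmem {v : mixedSpace F} :
      v ∈ Submodule.span ℤ (Set.range (fractionalIdealLatticeBasis F c)) ↔ v ∈ idealImage c := by
    rw [mem_span_fractionalIdealLatticeBasis, mem_idealImage]
    rfl
  obtain ⟨l, hl, hl'⟩ := ZSpan.exist_unique_vadd_mem_fundamentalDomain
    (fractionalIdealLatticeBasis F c) w
  refine ⟨⟨l, hmem.mp l.2⟩, hl, fun l' h' => Subtype.ext ?_⟩
  exact congrArg (fun k : Submodule.span ℤ (Set.range (fractionalIdealLatticeBasis F c)) =>
    (k : mixedSpace F)) (hl' ⟨l', hmem.mpr l'.2⟩ h')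

/-- All fundamental domains have the same measure, and the parallelepiped of a lattice basis is one
with finite positive volume. -/
lemma volume_fundDomain {a : Fin (n + 1) → Frac F} {D : Set (Fin n → mixedSpace F)}
    (hD : IsFundDomain a D) : volume D ≠ ⊤ ∧ volume D ≠ 0 := by
  let a' : Fin n → Frac F := fun i => (a i.castSucc)⁻¹ * a (Fin.last n)
  have hL : (vecLattice a').toAddSubgroup = unipLattice a := by
    ext v
    rw [Submodule.mem_toAddSubgroup, mem_vecLattice, mem_unipLattice]
  have h1 := ZSpan.isAddFundamentalDomain' (vecBasis a') volume
  change IsAddFundamentalDomain (vecLattice a').toAddSubgroup _ _ at h1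
  rw [hL] at h1
  rw [hD.measure_eq h1]
  exact ⟨(ZSpan.fundamentalDomain_isBounded _).measure_lt_top.ne,
    ZSpan.measure_fundamentalDomain_ne_zero _⟩

/-! ### Integrals of the Fourier type over a fundamental domain -/

/-- The linear form `ξ ↦ ∑ x_i ξ_i` on `F_∞^n`. -/
def rowForm (x : Fin n → F) : (Fin n → mixedSpace F) →ₗ[ℝ] mixedSpace F :=
  ∑ i, (LinearMap.mulLeft ℝ (emb x i)).comp (LinearMap.proj i)

lemma rowForm_apply (x : Fin n → F) (ξ : Fin n → mixedSpace F) :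
    rowForm x ξ = ∑ i, emb x i * ξ i := by
  simp [rowForm]

lemma rowForm_surjective {x : Fin n → F} (hx : x ≠ 0) : Function.Surjective (rowForm x) := by
  obtain ⟨i, hi⟩ := Function.ne_iff.mp hx
  have hi' : x i ≠ 0 := hi
  intro w
  refine ⟨Pi.single i (mixedEmbedding F (x i)⁻¹ * w), ?_⟩
  rw [rowForm_apply, Finset.sum_eq_single i]
  · rw [Pi.single_eq_same, ← mul_assoc, emb, ← map_mul, mul_inv_cancel₀ hi', map_one, one_mul]
  · intro j _ hj
    rw [Pi.single_eq_of_ne hj, mul_zero]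
  · simp

/-- On `N` the `i`-th product lies in `x_i 𝔞_i⁻¹ 𝔞_{n+1}`, which is part of the content times
`𝔞_{n+1}`. -/
lemma rowForm_mem {a : Fin (n + 1) → Frac F} {x : Fin n → F} {c : Frac F}
    (hc : contentInv (fun i : Fin n => a i.castSucc) x * (a (Fin.last n) : Frac F) = c)
    {ξ : Fin n → mixedSpace F} (hξ : ξ ∈ unipLattice a) : rowForm x ξ ∈ idealImage c := by
  obtain ⟨w, hw, rfl⟩ := mem_unipLattice.mp hξ
  refine mem_idealImage.mpr ⟨∑ i, x i * w i, Submodule.sum_mem _ fun i _ => ?_, ?_⟩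
  · change x i * w i ∈ (c : FractionalIdeal (𝓞 F)⁰ F)
    have h1 : FractionalIdeal.spanSingleton (𝓞 F)⁰ (x i) *
        (((a i.castSucc)⁻¹ * a (Fin.last n) : Frac F) : FractionalIdeal (𝓞 F)⁰ F) ≤ c := by
      rw [← hc, Units.val_mul, ← mul_assoc]
      gcongr
      exact (sum_le_iff (F := F) Finset.univ (fun i => FractionalIdeal.spanSingleton (𝓞 F)⁰ (x i) *
        ((a i.castSucc)⁻¹ : Frac F)) _).mp le_rfl i (Finset.mem_univ i)
    exact h1 (FractionalIdeal.mul_mem_mul (FractionalIdeal.mem_spanSingleton_self _ _)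
      (mem_sumLattice.mp hw i))
  · rw [rowForm_apply, map_sum]
    exact Finset.sum_congr rfl fun i _ => map_mul _ _ _

section Unfold

variable {a : Fin (n + 1) → Frac F} {D : Set (Fin n → mixedSpace F)} {x : Fin n → F} {c : Frac F}

theorem unfold_ideal {B : Type*} [NormedAddCommGroup B] [NormedSpace ℝ B]
    (hD : IsFundDomain a D) (hx : x ≠ 0)
    (hc : contentInv (fun i : Fin n => a i.castSucc) x * (a (Fin.last n) : Frac F) = c)
    {f : mixedSpace F → B} (hf : Integrable f) (t : mixedSpace F) :
    (∀ l : (c : FractionalIdeal (𝓞 F)⁰ F),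
      IntegrableOn (fun ξ => f (rowForm x ξ + t + mixedEmbedding F l)) D) ∧
    HasSum (fun l : (c : FractionalIdeal (𝓞 F)⁰ F) =>
      ∫ ξ in D, f (rowForm x ξ + t + mixedEmbedding F l))
      (((volume D).toReal / idealCovol c) • ∫ w, f w) := by
  obtain ⟨h1, h2⟩ := unfold_hasSum (ρ := volume) (Λ := idealImage c) hD (volume_fundDomain hD).1
    (rowForm x) (rowForm_surjective hx) (fun ξ hξ => rowForm_mem hc hξ)
    (ZSpan.fundamentalDomain_measurableSet (fractionalIdealLatticeBasis F c))
    (existsUnique_vadd_mem c) (ZSpan.measure_fundamentalDomain_ne_zero _)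
    (ZSpan.fundamentalDomain_isBounded _).measure_lt_top.ne hf t
  refine ⟨fun l => h1 (idealImageEquiv c l), ?_⟩
  rw [volume_fundamentalDomain, ENNReal.toReal_div,
    ENNReal.toReal_ofReal (idealCovol_pos c).le] at h2
  exact (idealImageEquiv c).hasSum_iff.mpr h2

/-- The additive character `ξ ↦ e^{-2πi⟨ν,ξ⟩}`. -/
def charV (ν ξ : Fin n → mixedSpace F) : ℂ :=
  Complex.exp (-(2 * Real.pi * Complex.I * (pairing ν ξ : ℂ)))

lemma norm_charV (ν ξ : Fin n → mixedSpace F) : ‖charV ν ξ‖ = 1 := norm_char _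

lemma pairing_add_right (ν ξ η : Fin n → mixedSpace F) :
    pairing ν (ξ + η) = pairing ν ξ + pairing ν η := by
  simp only [pairing, Pi.add_apply, mul_add, traceInf_add, Finset.sum_add_distrib]

lemma charV_add (ν ξ η : Fin n → mixedSpace F) : charV ν (ξ + η) = charV ν ξ * charV ν η := by
  rw [charV, charV, charV, ← Complex.exp_add, pairing_add_right]
  push_cast
  ring_nf

lemma continuous_charV (ν : Fin n → mixedSpace F) : Continuous (charV ν) := by
  have := continuous_traceInf (F := F)
  unfold charV pairing
  fun_prop

lemma pairing_comm (x y : Fin n → mixedSpace F) : pairing x y = pairing y x := by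
  simp only [pairing, mul_comm]

lemma charV_eq_one {ν ξ : Fin n → mixedSpace F} (hν : ν ∈ dualLattice a)
    (hξ : ξ ∈ unipLattice a) : charV ν ξ = 1 := by
  obtain ⟨k, hk⟩ := hν ξ hξ
  rw [charV, pairing_comm, hk, Complex.exp_eq_one_iff]
  exact ⟨-k, by push_cast; ring⟩

lemma charInf_add (x y : mixedSpace F) : charInf (x + y) = charInf x * charInf y := by
  rw [charInf, charInf, charInf, ← Complex.exp_add, traceInf_add]
  push_cast
  ring_nf

lemma charInf_neg_mixedEmbedding (y : F) : charInf (-mixedEmbedding F y) = charTr F y := by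
  rw [charInf, charTr, traceInf_neg, traceInf_mixedEmbedding]
  push_cast
  ring_nf

lemma charV_smul (μ : F) (x : Fin n → F) (ξ : Fin n → mixedSpace F) :
    charV (emb (μ • x)) ξ = charInf (mixedEmbedding F μ * rowForm x ξ) := by
  rw [charV, charInf, pairing, rowForm_apply, Finset.mul_sum, traceInf_sum, emb_smul]
  simp only [Pi.smul_apply, smul_eq_mul, mul_assoc]

lemma mul_mem_different_inv
    (hc : contentInv (fun i : Fin n => a i.castSucc) x * (a (Fin.last n) : Frac F) = c) {μ : F}
    (hμ : μ • x ∈ sumLattice (dualIdeals a)) {l : F} (hl : l ∈ (c : FractionalIdeal (𝓞 F)⁰ F)) :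
    μ * l ∈ (((different F)⁻¹ : Frac F) : FractionalIdeal (𝓞 F)⁰ F) := by
  rw [smul_mem_sumLattice, contentInv_dualIdeals, Units.val_mul, ← mul_assoc (contentInv _ _),
    hc] at hμ
  rw [mem_frac_iff, inv_inv, ← FractionalIdeal.spanSingleton_mul_spanSingleton]
  refine le_trans ?_ hμ
  rw [mul_assoc]
  gcongr
  rwa [FractionalIdeal.spanSingleton_le_iff_mem]

lemma hasSum_prod_of_fintype {Q C : Type*} [Fintype Q] {B : Type*} [NormedAddCommGroup B]
    {g : Q → C → B} {S : Q → B} (h : ∀ q, HasSum (g q) (S q)) :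
    HasSum (fun p : Q × C => g p.1 p.2) (∑ q, S q) := by
  have h1 (q : Q) : HasSum (fun p : Q × C => if p.1 = q then g q p.2 else 0) (S q) := by
    have hinj : Function.Injective (fun l : C => (q, l)) := fun l l' e => congrArg Prod.snd e
    refine (hinj.hasSum_iff ?_).mp ?_
    · rintro ⟨q', l⟩ hq
      refine if_neg ?_
      rintro rfl
      exact hq ⟨l, rfl⟩
    · simpa [Function.comp_def] using h q
  convert hasSum_sum (s := Finset.univ) fun q _ => h1 q using 2 with p
  simp

/-- If `u` is not a multiple of `x`, some `2 × 2` minor `δ` of the pair is non-zero, and a vector in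
these two coordinates is killed by `x` but not by `u`. -/
lemma exists_charV_ne_one {u : Fin n → F} (hx : x ≠ 0) (hu : ¬ ∃ μ : F, u = μ • x) :
    ∃ v : Fin n → mixedSpace F, rowForm x v = 0 ∧ charV (emb u) v ≠ 1 := by
  obtain ⟨i, hi⟩ := Function.ne_iff.mp hx
  have hi' : x i ≠ 0 := hi
  obtain ⟨j, hj⟩ : ∃ j, u j * x i - u i * x j ≠ 0 := by
    by_contra! h
    refine hu ⟨u i / x i, funext fun j => ?_⟩
    rw [Pi.smul_apply, smul_eq_mul]
    field_simp
    linear_combination h j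
  have hij : i ≠ j := by
    rintro rfl
    exact hj (sub_self _)
  set δ : F := u j * x i - u i * x j with hδ
  have hd : (Module.finrank ℚ F : ℝ) ≠ 0 := by exact_mod_cast Module.finrank_pos.ne'
  -- The scalar makes the pairing with `u` equal to `Tr(1)/(2d) = 1/2`, where the character takes
  -- the value `-1`.
  let w : mixedSpace F := (2 * (Module.finrank ℚ F : ℝ))⁻¹ • mixedEmbedding F δ⁻¹
  let v : Fin n → mixedSpace F := Pi.single j (mixedEmbedding F (x i) * w) -
    Pi.single i (mixedEmbedding F (x j) * w)
  have hsum (y : Fin n → F) : ∑ k, emb y k * v k =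
      mixedEmbedding F (y j * x i - y i * x j) * w := by
    simp only [v, Pi.sub_apply, mul_sub, Finset.sum_sub_distrib]
    rw [Finset.sum_eq_single j (fun k _ hk => by rw [Pi.single_eq_of_ne hk, mul_zero]) (by simp),
      Finset.sum_eq_single i (fun k _ hk => by rw [Pi.single_eq_of_ne hk, mul_zero]) (by simp),
      Pi.single_eq_same, Pi.single_eq_same, map_sub, map_mul, map_mul]
    simp only [emb]
    ring
  refine ⟨v, ?_, ?_⟩
  · rw [rowForm_apply, hsum, mul_comm (x j), sub_self, map_zero, zero_mul]
  · have h1 : pairing (emb u) v = 1 / 2 := by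
      rw [pairing, ← traceInf_sum, hsum, ← hδ, mul_smul_comm, ← map_mul, mul_inv_cancel₀ hj,
        traceInf_smul, traceInf_mixedEmbedding,
        show (1 : F) = algebraMap ℚ F 1 from (map_one _).symm, Algebra.trace_algebraMap]
      rw [nsmul_eq_mul, mul_one, Rat.cast_natCast]
      field_simp
    rw [charV, h1]
    have : -(2 * (Real.pi : ℂ) * Complex.I * ((1 / 2 : ℝ) : ℂ)) = -(Real.pi * Complex.I) := by
      push_cast
      ring
    rw [this, Complex.exp_neg, Complex.exp_pi_mul_I]
    norm_num

variable {f : mixedSpace F → ℂ}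

lemma hasSum_ideal_norm (hD : IsFundDomain a D) (hx : x ≠ 0)
    (hc : contentInv (fun i : Fin n => a i.castSucc) x * (a (Fin.last n) : Frac F) = c)
    (hf : Integrable f) (ν : Fin n → mixedSpace F) (t : mixedSpace F) :
    (∀ l : (c : FractionalIdeal (𝓞 F)⁰ F),
      IntegrableOn (fun ξ => f (rowForm x ξ + t + mixedEmbedding F l) * charV ν ξ) D) ∧
    HasSum (fun l : (c : FractionalIdeal (𝓞 F)⁰ F) =>
      ∫ ξ in D, ‖f (rowForm x ξ + t + mixedEmbedding F l) * charV ν ξ‖)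
      ((volume D).toReal / idealCovol c * ∫ w, ‖f w‖) := by
  constructor
  · intro l
    refine ((unfold_ideal hD hx hc hf t).1 l).mul_bdd (c := 1)
      (continuous_charV ν).aestronglyMeasurable ?_
    exact Filter.Eventually.of_forall fun ξ => (norm_charV _ _).le
  · simp_rw [norm_mul, norm_charV, mul_one]
    exact (unfold_ideal hD hx hc hf.norm t).2

/-- For `ν = μx` the character factors through the linear form and is trivial on `𝔠`, because `μ𝔠 ⊂
𝔡⁻¹`. It can thus be absorbed into `f` before unfolding, and the shift by `t` costs a phase. -/
lemma hasSum_ideal_of_eq (hD : IsFundDomain a D) (hx : x ≠ 0)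
    (hc : contentInv (fun i : Fin n => a i.castSucc) x * (a (Fin.last n) : Frac F) = c) {μ : F}
    (hμ : μ • x ∈ sumLattice (dualIdeals a))
    (hf : Integrable fun w => f w * charInf (mixedEmbedding F μ * w)) (t : mixedSpace F) :
    HasSum (fun l : (c : FractionalIdeal (𝓞 F)⁰ F) =>
      ∫ ξ in D, f (rowForm x ξ + t + mixedEmbedding F l) * charV (emb (μ • x)) ξ)
      (charInf (-(mixedEmbedding F μ * t)) * (((volume D).toReal / idealCovol c : ℝ) *
        ∫ w, f w * charInf (mixedEmbedding F μ * w))) := by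
  have h := (unfold_ideal hD hx hc hf t).2.mul_left (charInf (-(mixedEmbedding F μ * t)))
  rw [Complex.real_smul] at h
  refine h.congr_fun fun l => ?_
  rw [← integral_const_mul]
  congr 1 with ξ
  have h1 : charInf (-(mixedEmbedding F (μ * l.1))) = 1 := by
    rw [charInf_neg_mixedEmbedding, charTr_eq_one (mul_mem_different_inv hc hμ l.2)]
  have h2 : charInf (-(mixedEmbedding F μ * t)) *
      charInf (mixedEmbedding F μ * (rowForm x ξ + t + mixedEmbedding F l)) =
      charV (emb (μ • x)) ξ := by
    rw [← charInf_add, charV_smul, ← mul_one (charInf _), ← h1, ← charInf_add, map_mul]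
    congr 1
    ring
  rw [← h2]
  ring

/-- The sum over `𝔠` is an `N`-periodic function of `ξ`. Translation by a vector in the kernel of
the form multiplies it by a number other than `1`, yet does not change its integral over a
fundamental domain. -/
lemma hasSum_ideal_of_ne (hD : IsFundDomain a D) (hx : x ≠ 0)
    (hc : contentInv (fun i : Fin n => a i.castSucc) x * (a (Fin.last n) : Frac F) = c)
    {u : Fin n → F} (hu : u ∈ sumLattice (dualIdeals a)) (hu' : ¬ ∃ μ : F, u = μ • x)
    (hf : Integrable f) (t : mixedSpace F) :
    HasSum (fun l : (c : FractionalIdeal (𝓞 F)⁰ F) =>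
      ∫ ξ in D, f (rowForm x ξ + t + mixedEmbedding F l) * charV (emb u) ξ) 0 := by
  obtain ⟨h1, h2⟩ := hasSum_ideal_norm hD hx hc hf (emb u) t
  have : Countable (c : FractionalIdeal (𝓞 F)⁰ F) := (idealImageEquiv c).injective.countable
  have h3 := hasSum_integral_of_summable_integral_norm h1 h2.summable
  obtain ⟨v, hv, hv'⟩ := exists_charV_ne_one hx hu'
  set H : (Fin n → mixedSpace F) → ℂ := fun ξ => ∑' l : (c : FractionalIdeal (𝓞 F)⁰ F),
    f (rowForm x ξ + t + mixedEmbedding F l) * charV (emb u) ξ with hH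
  have hinv (y) (hy : y ∈ unipLattice a) (ξ) : H (y + ξ) = H ξ := by
    obtain ⟨k, hk, hk'⟩ := mem_idealImage.mp (rowForm_mem hc hy)
    simp only [hH]
    refine Eq.trans (tsum_congr fun l => ?_) ((Equiv.addLeft (⟨k, hk⟩ :
      ((c : FractionalIdeal (𝓞 F)⁰ F) : Submodule (𝓞 F) F))).tsum_eq
      (fun l : (c : FractionalIdeal (𝓞 F)⁰ F) =>
        f (rowForm x ξ + t + mixedEmbedding F l) * charV (emb u) ξ))
    rw [charV_add, charV_eq_one (mem_dualLattice.mpr ⟨u, hu, rfl⟩) hy, one_mul, map_add, ← hk']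
    congr 2
    change _ = rowForm x ξ + t + mixedEmbedding F (k + l)
    rw [map_add]
    abel
  have hv2 (ξ) : H (v + ξ) = charV (emb u) v * H ξ := by
    simp only [hH]
    rw [← tsum_mul_left]
    refine tsum_congr fun l => ?_
    rw [charV_add, map_add, hv, zero_add]
    ring
  have h4 := setIntegral_add_eq hD H hinv v
  simp_rw [hv2] at h4
  rw [integral_const_mul] at h4
  have h5 : ∫ ξ in D, H ξ = 0 := by
    have : (charV (emb u) v - 1) * ∫ ξ in D, H ξ = 0 := by rw [sub_mul, h4, one_mul, sub_self]
    exact (mul_eq_zero.mp this).resolve_left (sub_ne_zero.mpr hv')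
  rwa [h5] at h3

lemma hasSum_unitVecs {B : Type*} [NormedAddCommGroup B] {m : (Ideal (𝓞 F))⁰} {g : F → B}
    {S : RamGen m c → B} (h : ∀ q, HasSum (fun l : (c : FractionalIdeal (𝓞 F)⁰ F) =>
      g (ramRep m c q.1 + l)) (S q)) :
    HasSum (fun y : unitVecs m c => g y) (∑ᶠ q, S q) := by
  have := Fintype.ofFinite (RamGen m c)
  rw [finsum_eq_sum_of_fintype]
  exact (unitVecsEquiv m c).hasSum_iff.mp (hasSum_prod_of_fintype h)

theorem hasSum_unitVecs_norm (hD : IsFundDomain a D) (hx : x ≠ 0)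
    (hc : contentInv (fun i : Fin n => a i.castSucc) x * (a (Fin.last n) : Frac F) = c)
    (m : (Ideal (𝓞 F))⁰) (hf : Integrable f) (ν : Fin n → mixedSpace F) (t : mixedSpace F) :
    (∀ y : unitVecs m c,
      IntegrableOn (fun ξ => f (rowForm x ξ + t + mixedEmbedding F y) * charV ν ξ) D) ∧
    HasSum (fun y : unitVecs m c =>
      ∫ ξ in D, ‖f (rowForm x ξ + t + mixedEmbedding F y) * charV ν ξ‖)
      (totient m * ((volume D).toReal / idealCovol c * ∫ w, ‖f w‖)) := by
  have hadd (y l : F) (ξ) : rowForm x ξ + t + mixedEmbedding F (y + l) =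
      rowForm x ξ + (t + mixedEmbedding F y) + mixedEmbedding F l := by
    rw [map_add]
    abel
  constructor
  · intro y
    have := (hasSum_ideal_norm hD hx hc hf ν (t + mixedEmbedding F y)).1
      ⟨0, FractionalIdeal.zero_mem _⟩
    simpa only [map_zero, add_zero, add_assoc] using this
  · have h := hasSum_unitVecs (m := m) (c := c) (g := fun y => ∫ ξ in D,
      ‖f (rowForm x ξ + t + mixedEmbedding F y) * charV ν ξ‖) fun q => by
      simp only [hadd]
      exact (hasSum_ideal_norm hD hx hc hf ν (t + mixedEmbedding F (ramRep m c q.1))).2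
    have := Fintype.ofFinite (RamGen m c)
    rwa [finsum_eq_sum_of_fintype, Finset.sum_const, Finset.card_univ, ← Nat.card_eq_fintype_card,
      card_ramGen, nsmul_eq_mul] at h

/-- Each generator class is a coset `r + 𝔠`, and moving `r` into the shift `t` produces the weight
`e^{2πi Tr(μr)}`. -/
theorem hasSum_unitVecs_of_eq (hD : IsFundDomain a D) (hx : x ≠ 0)
    (hc : contentInv (fun i : Fin n => a i.castSucc) x * (a (Fin.last n) : Frac F) = c)
    (m : (Ideal (𝓞 F))⁰) {μ : F} (hμ : μ • x ∈ sumLattice (dualIdeals a))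
    (hf : Integrable fun w => f w * charInf (mixedEmbedding F μ * w)) (t : mixedSpace F) :
    HasSum (fun y : unitVecs m c =>
      ∫ ξ in D, f (rowForm x ξ + t + mixedEmbedding F y) * charV (emb (μ • x)) ξ)
      ((∑ᶠ q : RamGen m c, charTr F (μ * ramRep m c q.1)) *
        (charInf (-(mixedEmbedding F μ * t)) * (((volume D).toReal / idealCovol c : ℝ) *
        ∫ w, f w * charInf (mixedEmbedding F μ * w)))) := by
  have hadd (y l : F) (ξ) : rowForm x ξ + t + mixedEmbedding F (y + l) =
      rowForm x ξ + (t + mixedEmbedding F y) + mixedEmbedding F l := by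
    rw [map_add]
    abel
  have h := hasSum_unitVecs (m := m) (c := c) (g := fun y => ∫ ξ in D,
    f (rowForm x ξ + t + mixedEmbedding F y) * charV (emb (μ • x)) ξ) fun q => by
      simp only [hadd]
      exact hasSum_ideal_of_eq hD hx hc hμ hf (t + mixedEmbedding F (ramRep m c q.1))
  have := Fintype.ofFinite (RamGen m c)
  rw [finsum_eq_sum_of_fintype] at h ⊢
  rw [Finset.sum_mul, ← Finset.sum_congr rfl fun q _ => ?_]
  · exact h
  rw [mul_add, neg_add, charInf_add, ← map_mul, charInf_neg_mixedEmbedding]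
  ring

theorem hasSum_unitVecs_of_ne (hD : IsFundDomain a D) (hx : x ≠ 0)
    (hc : contentInv (fun i : Fin n => a i.castSucc) x * (a (Fin.last n) : Frac F) = c)
    (m : (Ideal (𝓞 F))⁰) {u : Fin n → F} (hu : u ∈ sumLattice (dualIdeals a))
    (hu' : ¬ ∃ μ : F, u = μ • x) (hf : Integrable f) (t : mixedSpace F) :
    HasSum (fun y : unitVecs m c =>
      ∫ ξ in D, f (rowForm x ξ + t + mixedEmbedding F y) * charV (emb u) ξ) 0 := by
  have hadd (y l : F) (ξ) : rowForm x ξ + t + mixedEmbedding F (y + l) =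
      rowForm x ξ + (t + mixedEmbedding F y) + mixedEmbedding F l := by
    rw [map_add]
    abel
  have h := hasSum_unitVecs (m := m) (c := c) (g := fun y => ∫ ξ in D,
    f (rowForm x ξ + t + mixedEmbedding F y) * charV (emb u) ξ) fun q => by
      simp only [hadd]
      exact hasSum_ideal_of_ne hD hx hc hu hu' hf (t + mixedEmbedding F (ramRep m c q.1))
  rwa [finsum_zero] at h

end Unfold

/-! ### Decomposition of primitive vectors according to the last coordinate -/

/-- The vector `(x, y)`. -/
abbrev snocVec (x : Fin n → F) (y : F) : Fin (n + 1) → F := Fin.snoc (α := fun _ => F) x y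

lemma snocVec_eta (x : Fin (n + 1) → F) :
    snocVec (fun i => x i.castSucc) (x (Fin.last n)) = x := Fin.snoc_init_self x

lemma snocVec_inj {x x' : Fin n → F} {y y' : F} :
    snocVec x y = snocVec x' y' ↔ x = x' ∧ y = y' := Fin.snoc_inj

lemma smul_snocVec (α : F) (x : Fin n → F) (y : F) :
    α • snocVec x y = snocVec (α • x) (α * y) := by
  funext i
  refine Fin.lastCases ?_ (fun j => ?_) i <;> simp [snocVec]

lemma contentInv_snocVec (a : Fin (n + 1) → Frac F) (x : Fin n → F) (y : F) :
    contentInv a (snocVec x y) = contentInv (fun i => a i.castSucc) x +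
      FractionalIdeal.spanSingleton (𝓞 F)⁰ y * ((a (Fin.last n))⁻¹ : Frac F) := by
  rw [contentInv, Fin.sum_univ_castSucc, contentInv]
  simp [snocVec]

lemma snocVec_zero_mem {a : Fin (n + 1) → Frac F} {b : Frac F}
    (hb : (1 : F) ∈ (b : FractionalIdeal (𝓞 F)⁰ F)) {y : F} :
    snocVec 0 y ∈ primVec (sumLattice a) b ↔
      ∃ hy : y ≠ 0, princ y hy = a (Fin.last n) * b⁻¹ := by
  have h0 : contentInv (fun i : Fin n => a i.castSucc) 0 = 0 := by simp [contentInv]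
  have h1 : snocVec (0 : Fin n → F) y ≠ 0 ↔ y ≠ 0 := by
    rw [not_iff_not]
    constructor
    · intro h
      have := congrFun h (Fin.last n)
      simpa [snocVec] using this
    · rintro rfl
      funext i
      refine Fin.lastCases ?_ (fun j => ?_) i <;> simp [snocVec]
  rw [mem_primVec, h1, contentInv_snocVec, h0, zero_add]
  constructor
  · rintro ⟨hy, -, h⟩
    refine ⟨hy, ?_⟩
    have h2 : princ y hy * (a (Fin.last n))⁻¹ = b⁻¹ := Units.ext h
    rw [← h2, mul_comm, inv_mul_cancel_right]
  · rintro ⟨hy, h⟩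
    refine ⟨hy, hb, ?_⟩
    rw [← coe_princ y hy, h, ← Units.val_mul, mul_comm, inv_mul_cancel_left]

lemma contentInv_eq_of_mem {a : Fin n → Frac F} {b : Frac F} {m : (Ideal (𝓞 F))⁰} {x : Fin n → F}
    (hx : x ∈ primVec (sumLattice a) (b * (toFrac m)⁻¹)) :
    contentInv a x = ((b⁻¹ * toFrac m : Frac F) : FractionalIdeal (𝓞 F)⁰ F) := by
  rw [(mem_primVec.mp hx).2.2, mul_inv, inv_inv]

lemma one_mem_mul_toFrac_inv {b : Frac F} (hb : (1 : F) ∈ (b : FractionalIdeal (𝓞 F)⁰ F))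
    (m : (Ideal (𝓞 F))⁰) :
    (1 : F) ∈ ((b * (toFrac m)⁻¹ : Frac F) : FractionalIdeal (𝓞 F)⁰ F) :=
  le_mul_toFrac_inv m b hb

/-- The ideal `𝔟⁻¹𝔪𝔞_{n+1}`: the image of `N` under `ξ ↦ ∑ x_i ξ_i`, for `x` of content
`𝔟𝔪⁻¹`. -/
def stepIdeal (a : Fin (n + 1) → Frac F) (b : Frac F) (m : (Ideal (𝓞 F))⁰) : Frac F :=
  b⁻¹ * toFrac m * a (Fin.last n)

lemma contentInv_mul_eq_stepIdeal {a : Fin (n + 1) → Frac F} {b : Frac F} {m : (Ideal (𝓞 F))⁰}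
    {x : Fin n → F}
    (hx : x ∈ primVec (sumLattice fun i : Fin n => a i.castSucc) (b * (toFrac m)⁻¹)) :
    contentInv (fun i : Fin n => a i.castSucc) x * (a (Fin.last n) : Frac F) =
      (stepIdeal a b m : Frac F) := by
  rw [contentInv_eq_of_mem hx, stepIdeal, ← Units.val_mul]

/-- Multiplying the content equation of `(x, y)` by `𝔞_{n+1}` turns it into `𝔠 + (y) = 𝔠𝔪⁻¹`, the
condition that `y` generates the quotient `𝔠𝔪⁻¹/𝔠`. -/
lemma snocVec_mem_iff {a : Fin (n + 1) → Frac F} {b : Frac F}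
    (hb : (1 : F) ∈ (b : FractionalIdeal (𝓞 F)⁰ F)) {m : (Ideal (𝓞 F))⁰} {x : Fin n → F}
    (hx : x ∈ primVec (sumLattice fun i : Fin n => a i.castSucc) (b * (toFrac m)⁻¹)) {y : F} :
    snocVec x y ∈ primVec (sumLattice a) b ↔ y ∈ unitVecs m (stepIdeal a b m) := by
  have h1 : snocVec x y ≠ 0 := by
    intro h
    refine hx.2.1 (funext fun i => ?_)
    have := congrFun h i.castSucc
    simpa [snocVec] using this
  have h2 : stepIdeal a b m * (toFrac m)⁻¹ = b⁻¹ * a (Fin.last n) := by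
    rw [stepIdeal, mul_right_comm, mul_inv_cancel_right]
  have h3 : ((a (Fin.last n) : Frac F) : FractionalIdeal (𝓞 F)⁰ F) ≠ 0 := Units.ne_zero _
  rw [mem_primVec, contentInv_snocVec, unitVecs, Set.mem_ofPred_eq, h2,
    ← contentInv_mul_eq_stepIdeal hx, Units.val_mul, ← mul_left_inj' h3, add_mul, mul_assoc _ _
    (a (Fin.last n) : FractionalIdeal (𝓞 F)⁰ F), Units.inv_mul, mul_one,
    add_comm (FractionalIdeal.spanSingleton (𝓞 F)⁰ y)]
  exact ⟨fun h => h.2.2, fun h => ⟨h1, hb, h⟩⟩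

/-- The content ideal of the head is contained in `𝔟⁻¹`, and `𝔪` is the integral quotient of the
two. -/
lemma exists_mem_primVec_castSucc {a : Fin (n + 1) → Frac F} {b : Frac F} {x : Fin n → F} {y : F}
    (h : snocVec x y ∈ primVec (sumLattice a) b) (hx : x ≠ 0) :
    ∃ m : (Ideal (𝓞 F))⁰,
      x ∈ primVec (sumLattice fun i : Fin n => a i.castSucc) (b * (toFrac m)⁻¹) := by
  obtain ⟨-, hb, h⟩ := mem_primVec.mp h
  rw [contentInv_snocVec] at h
  have h1 : contentInv (fun i : Fin n => a i.castSucc) x ≤ ((b⁻¹ : Frac F) :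
      FractionalIdeal (𝓞 F)⁰ F) := by
    rw [← h]
    exact le_self_add
  set k : Frac F := Units.mk0 _ (contentInv_ne_zero (a := fun i : Fin n => a i.castSucc) hx)
  have h2 : ((k * b : Frac F) : FractionalIdeal (𝓞 F)⁰ F) ≤ 1 := by
    calc ((k * b : Frac F) : FractionalIdeal (𝓞 F)⁰ F) ≤
        ((b⁻¹ : Frac F) : FractionalIdeal (𝓞 F)⁰ F) * (b : FractionalIdeal (𝓞 F)⁰ F) := by
          rw [Units.val_mul]
          gcongr
          exact h1
      _ = 1 := Units.inv_mul b
  obtain ⟨m, hm⟩ := (exists_toFrac_iff _).mpr h2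
  refine ⟨m, mem_primVec.mpr ⟨hx, one_mem_mul_toFrac_inv hb m, ?_⟩⟩
  rw [← hm]
  simp [k]

/-! ### The orbits of primitive vectors, sorted by their head. -/

/-- A representative of an orbit of primitive vectors. -/
def repVec {L : Submodule (𝓞 F) (Fin n → F)} {b : Frac F} (q : primOrbits L b) : Fin n → F :=
  q.2.choose

lemma repVec_mem {L : Submodule (𝓞 F) (Fin n → F)} {b : Frac F} (q : primOrbits L b) :
    repVec q ∈ primVec L b := q.2.choose_spec.1

lemma toOrbit_repVec {L : Submodule (𝓞 F) (Fin n → F)} {b : Frac F} (q : primOrbits L b) :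
    toOrbit (repVec q) = q.1 := q.2.choose_spec.2

section Decomposition

variable (a : Fin (n + 1) → Frac F) (b : Frac F)

/-- The possible vectors `(x_1, …, x_n)` modulo units, sorted by their content `𝔟𝔪⁻¹`. -/
abbrev HeadIndex : Type _ :=
  Σ m : (Ideal (𝓞 F))⁰, primOrbits (sumLattice fun i : Fin n => a i.castSucc) (b * (toFrac m)⁻¹)

/-- The index set of the decomposition of `𝓞_F^× \ L_𝔟` according to the last coordinate. -/
abbrev DecompIndex : Type _ :=
  PLift (idealClass b = idealClass (a (Fin.last n))) ⊕
    Σ p : HeadIndex a b, unitVecs p.1 (stepIdeal a b p.1)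

variable {a b}

lemma exists_princ_eq (h : idealClass b = idealClass (a (Fin.last n))) :
    ∃ (y : F) (hy : y ≠ 0), princ y hy = a (Fin.last n) * b⁻¹ := by
  obtain ⟨y, hy, e⟩ := (idealClass_eq_iff _ _).mp h.symm
  exact ⟨y, hy, by rw [e, mul_inv_cancel_right]⟩

/-- The vectors that represent the decomposition. -/
def decompVec : DecompIndex a b → Fin (n + 1) → F
  | Sum.inl h => snocVec 0 (exists_princ_eq h.down).choose
  | Sum.inr ⟨p, y⟩ => snocVec (repVec p.2) y

lemma decompVec_mem (hb : (1 : F) ∈ (b : FractionalIdeal (𝓞 F)⁰ F)) (i : DecompIndex a b) :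
    decompVec i ∈ primVec (sumLattice a) b := by
  rcases i with h | ⟨p, y⟩
  · exact (snocVec_zero_mem hb).mpr (exists_princ_eq h.down).choose_spec
  · exact (snocVec_mem_iff hb (repVec_mem p.2)).mpr y.2

lemma unit_smul_snocVec (u : (𝓞 F)ˣ) (x : Fin n → F) (y : F) :
    u • snocVec x y = snocVec (u • x) (((u : 𝓞 F) : F) * y) := by
  rw [unit_smul_eq, smul_snocVec, unit_smul_eq]

lemma eq_one_of_unit_smul_eq {u : (𝓞 F)ˣ} {x : Fin n → F} (hx : x ≠ 0) (h : u • x = x) : u = 1 := by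
  obtain ⟨i, hi⟩ := Function.ne_iff.mp hx
  have hi' : x i ≠ 0 := hi
  have h1 := congrFun h i
  rw [unit_smul_eq, Pi.smul_apply, smul_eq_mul] at h1
  have h2 : ((u : 𝓞 F) : F) = 1 := mul_right_cancel₀ hi' (h1.trans (one_mul _).symm)
  exact Units.ext (RingOfIntegers.coe_injective (h2.trans (map_one _).symm))

lemma toOrbit_eq_of_mem {m m' : (Ideal (𝓞 F))⁰} {a : Fin n → Frac F}
    (q : primOrbits (sumLattice a) (b * (toFrac m)⁻¹))
    (q' : primOrbits (sumLattice a) (b * (toFrac m')⁻¹)) (h : q.1 = q'.1) :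
    (⟨m, q⟩ : Σ m : (Ideal (𝓞 F))⁰, primOrbits (sumLattice a) (b * (toFrac m)⁻¹)) = ⟨m', q'⟩ := by
  have h1 : toOrbit (repVec q) = toOrbit (repVec q') := by
    rw [toOrbit_repVec, toOrbit_repVec, h]
  obtain ⟨u, hu⟩ := toOrbit_eq_iff.mp h1
  have h2 := contentInv_eq_of_mem (repVec_mem q)
  rw [← hu, contentInv_unit_smul, contentInv_eq_of_mem (repVec_mem q')] at h2
  obtain rfl : m = m' := toFrac_injective (mul_left_cancel (Units.ext h2)).symm
  rw [Subtype.ext h]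

/-- The decomposition of `𝓞_F^× \ L_𝔟` according to the last coordinate. -/
def decompEquiv (hb : (1 : F) ∈ (b : FractionalIdeal (𝓞 F)⁰ F)) :
    DecompIndex a b ≃ primOrbits (sumLattice a) b :=
  Equiv.ofBijective
    (fun i => ⟨toOrbit (decompVec i), toOrbit_mem_primOrbits.mpr (decompVec_mem hb i)⟩) <| by
    constructor
    · intro i j hij
      obtain ⟨u, hu⟩ := toOrbit_eq_iff.mp (congrArg Subtype.val hij)
      rcases i with ⟨h⟩ | ⟨⟨m, q⟩, y⟩ <;> rcases j with ⟨h'⟩ | ⟨⟨m', q'⟩, y'⟩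
      · exact congrArg Sum.inl (Subsingleton.elim _ _)
      · rw [decompVec, decompVec, unit_smul_snocVec, snocVec_inj] at hu
        exact absurd ((smul_eq_zero_iff_eq u).mp hu.1) (repVec_mem q').2.1
      · rw [decompVec, decompVec, unit_smul_snocVec, snocVec_inj, smul_zero] at hu
        exact absurd hu.1.symm (repVec_mem q).2.1
      · rw [decompVec, decompVec, unit_smul_snocVec, snocVec_inj] at hu
        obtain ⟨hu1, hu2⟩ := hu
        have h1 : q.1 = q'.1 := by
          rw [← toOrbit_repVec, ← toOrbit_repVec]
          exact toOrbit_eq_iff.mpr ⟨u, hu1⟩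
        have h2 := toOrbit_eq_of_mem q q' h1
        obtain ⟨rfl, h3⟩ := Sigma.mk.inj h2
        obtain rfl := eq_of_heq h3
        -- Fixing a representative of the non-zero head uses up the unit group, so `y` is an element
        -- and not merely a class modulo units.
        rw [eq_one_of_unit_smul_eq (repVec_mem q).2.1 hu1] at hu2
        have hu3 : (y' : F) = y := (one_mul _).symm.trans hu2
        rw [Subtype.ext hu3]
    · rintro ⟨q, x, hx, rfl⟩
      obtain ⟨x, y, rfl⟩ : ∃ x' y, snocVec x' y = x := ⟨_, _, snocVec_eta x⟩
      by_cases hx0 : x = 0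
      · subst hx0
        obtain ⟨hy, e⟩ := (snocVec_zero_mem hb).mp hx
        have h : idealClass b = idealClass (a (Fin.last n)) :=
          ((idealClass_eq_iff _ _).mpr ⟨y, hy, by rw [e, inv_mul_cancel_right]⟩).symm
        refine ⟨Sum.inl ⟨h⟩, Subtype.ext (toOrbit_eq_iff.mpr ?_)⟩
        obtain ⟨hy', e'⟩ := (exists_princ_eq h).choose_spec
        obtain ⟨u, hu⟩ := (princ_eq_iff hy hy').mp (e.trans e'.symm)
        refine ⟨u, ?_⟩
        rw [unit_smul_snocVec, smul_zero, decompVec, ← hu, Units.smul_def, Algebra.smul_def]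
      · obtain ⟨m, hm⟩ := exists_mem_primVec_castSucc hx hx0
        let q : primOrbits (sumLattice fun i : Fin n => a i.castSucc) (b * (toFrac m)⁻¹) :=
          ⟨toOrbit x, toOrbit_mem_primOrbits.mpr hm⟩
        obtain ⟨u, hu⟩ := toOrbit_eq_iff.mp (toOrbit_repVec q)
        -- The unit that carries the head to its chosen representative has to act on the last
        -- coordinate too.
        have h1 : snocVec (repVec q) (((u : 𝓞 F) : F) * y) ∈ primVec (sumLattice a) b := by
          rw [← hu, ← unit_smul_snocVec, unit_smul_mem_primVec]
          exact hx
        refine ⟨Sum.inr ⟨⟨m, q⟩, ⟨_, (snocVec_mem_iff hb (repVec_mem q)).mp h1⟩⟩,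
          Subtype.ext (toOrbit_eq_iff.mpr ⟨u, ?_⟩)⟩
        rw [unit_smul_snocVec, decompVec, hu]

/-! ### The terms of the Eisenstein series in Iwasawa coordinates -/

/-- The shape of an upper triangular matrix with corner `1`. -/
structure IsCorner (g : Matrix (Fin (n + 1)) (Fin (n + 1)) (mixedSpace F))
    (g₁ : Matrix (Fin n) (Fin n) (mixedSpace F)) (xn : Fin n → mixedSpace F) : Prop where
  block : ∀ i j, g (Fin.castSucc i) (Fin.castSucc j) = g₁ i j
  column : ∀ i, g (Fin.castSucc i) (Fin.last n) = xn i
  row : ∀ j, g (Fin.last n) (Fin.castSucc j) = 0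
  corner : g (Fin.last n) (Fin.last n) = 1
  det_eq : g.det = g₁.det

lemma isCorner_iwasawa {X : Matrix (Fin (n + 1)) (Fin (n + 1)) (mixedSpace F)}
    (hXdiag : ∀ i, X i i = 1) (hXlower : ∀ i j, j < i → X i j = 0)
    (y : Fin n → InfinitePlace F → ℝ) :
    IsCorner (iwasawa X y) (iwasawa₁ X y) (fun i => X i.castSucc (Fin.last n)) where
  block i j := by simp [iwasawa, iwasawa₁, Matrix.mul_diagonal]
  column i := by simp [iwasawa, Matrix.mul_diagonal]
  row j := by
    simp [iwasawa, Matrix.mul_diagonal, hXlower (Fin.last n) j.castSucc (Fin.castSucc_lt_last j)]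
  corner := by simp [iwasawa, Matrix.mul_diagonal, hXdiag]
  det_eq := by
    have h1 : X.det = 1 := by
      rw [Matrix.det_of_isUpperTriangular]
      · simp [hXdiag]
      · exact fun i j hij => hXlower i j hij
    have h2 : (X.submatrix Fin.castSucc Fin.castSucc : Matrix (Fin n) (Fin n) _).det = 1 := by
      rw [Matrix.det_of_isUpperTriangular]
      · simp [hXdiag]
      · exact fun i j hij => hXlower _ _ (Fin.castSucc_lt_castSucc_iff.mpr hij)
    rw [iwasawa, iwasawa₁, Matrix.det_mul, Matrix.det_mul, h1, h2, Matrix.det_diagonal,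
      Matrix.det_diagonal, Fin.prod_univ_castSucc]
    simp

lemma vecMul_snoc {g : Matrix (Fin (n + 1)) (Fin (n + 1)) (mixedSpace F)}
    {g₁ : Matrix (Fin n) (Fin n) (mixedSpace F)} {xn : Fin n → mixedSpace F} (h : IsCorner g g₁ xn)
    (v : Fin n → mixedSpace F) (w : mixedSpace F) :
    Matrix.vecMul (Fin.snoc (α := fun _ => mixedSpace F) v w) g =
      Fin.snoc (α := fun _ => mixedSpace F) (Matrix.vecMul v g₁) (∑ i, v i * xn i + w) := by
  funext j
  refine Fin.lastCases ?_ (fun k => ?_) j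
  · simp [Matrix.vecMul, dotProduct, Fin.sum_univ_castSucc, h.column, h.corner]
  · simp [Matrix.vecMul, dotProduct, Fin.sum_univ_castSucc, h.block, h.row]

lemma isCorner_unip (ξ : Fin n → mixedSpace F) : IsCorner (unipMatrix ξ) 1 ξ where
  block i j := by
    simp only [unipMatrix, Fin.castSucc_inj, (Fin.castSucc_lt_last j).ne, if_false,
      Matrix.one_apply]
  column i := by simp [unipMatrix, (Fin.castSucc_lt_last i).ne]
  row j := by simp [unipMatrix, (Fin.castSucc_lt_last j).ne, (Fin.castSucc_lt_last j).ne']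
  corner := by simp [unipMatrix]
  det_eq := by rw [det_unipMatrix, Matrix.det_one]

lemma emb_snocVec (x : Fin n → F) (y : F) : emb (snocVec x y) =
    Fin.snoc (α := fun _ => mixedSpace F) (emb x) (mixedEmbedding F y) := by
  funext i
  refine Fin.lastCases ?_ (fun j => ?_) i <;> simp [snocVec, emb]

lemma rowNorm_snoc (σ : InfinitePlace F) (v : Fin n → mixedSpace F) (w : mixedSpace F) :
    rowNorm σ (Fin.snoc (α := fun _ => mixedSpace F) v w) =
      Real.sqrt (rowNorm σ v ^ 2 + normAtPlace σ w ^ 2) := by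
  rw [rowNorm, rowNorm, Real.sq_sqrt (Finset.sum_nonneg fun i _ => sq_nonneg _),
    Fin.sum_univ_castSucc]
  simp

/-- Right multiplication by `ξ` and then by `g` leaves the head row `x g₁` alone and only shifts the
last coordinate, whose diagonal entry in Iwasawa form is `1`. -/
lemma detAux_unip {g : GL (Fin (n + 1)) (mixedSpace F)} {g₁ : GL (Fin n) (mixedSpace F)}
    {xn : Fin n → mixedSpace F} (h : IsCorner g.1 g₁.1 xn) (ξ : Fin n → mixedSpace F)
    (x : Fin n → F) (y : F) :
    detAux (snocVec x y) (unip ξ * g) = ∏ σ : InfinitePlace F,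
      normAtPlace σ g₁.1.det ^ σ.mult / Real.sqrt (rowNorm σ (Matrix.vecMul (emb x) g₁.1) ^ 2 +
        normAtPlace σ (rowForm x ξ + rowForm x xn + mixedEmbedding F y) ^ 2) ^
          ((n + 1) * σ.mult) := by
  have h1 : Matrix.vecMul (emb (snocVec x y)) ((unip ξ * g :
      GL (Fin (n + 1)) (mixedSpace F)) : Matrix _ _ (mixedSpace F)) =
      Fin.snoc (α := fun _ => mixedSpace F) (Matrix.vecMul (emb x) g₁.1)
        (rowForm x ξ + rowForm x xn + mixedEmbedding F y) := by
    rw [Units.val_mul, ← Matrix.vecMul_vecMul, emb_snocVec]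
    change Matrix.vecMul (Matrix.vecMul _ (unipMatrix ξ)) _ = _
    rw [vecMul_snoc (isCorner_unip ξ), vecMul_snoc h, Matrix.vecMul_one, rowForm_apply,
      rowForm_apply]
    congr 1
    ring
  have h2 : (unip ξ * g : GL (Fin (n + 1)) (mixedSpace F)).1.det = g₁.1.det := by
    rw [Units.val_mul, Matrix.det_mul, h.det_eq]
    change (unipMatrix ξ).det * _ = _
    rw [det_unipMatrix, one_mul]
  rw [detAux, h1, h2]
  simp_rw [rowNorm_snoc]

/-- `∏_σ |det g_σ|^{n_σ s}`. -/
def detPow (g : GL (Fin n) (mixedSpace F)) (s : ℂ) : ℂ :=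
  ∏ σ : InfinitePlace F, ((normAtPlace σ g.1.det : ℝ) : ℂ) ^ (σ.mult * s)

/-- The norms `‖x g_σ‖`. -/
def rowNorms (g : GL (Fin n) (mixedSpace F)) (v : Fin n → mixedSpace F) (σ : InfinitePlace F) : ℝ :=
  rowNorm σ (Matrix.vecMul v g.1)

lemma ofReal_prod_cpow {ι : Type*} (t : Finset ι) (f : ι → ℝ) (hf : ∀ i, 0 ≤ f i) (s : ℂ) :
    ((∏ i ∈ t, f i : ℝ) : ℂ) ^ s = ∏ i ∈ t, (f i : ℂ) ^ s := by
  induction t using Finset.induction_on with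
  | empty => simp
  | insert i t hi ih =>
    rw [Finset.prod_insert hi, Finset.prod_insert hi,
      ofReal_cpow_mul (hf i) (Finset.prod_nonneg fun i _ => hf i), ih]

lemma prod_div_cpow (A B : InfinitePlace F → ℝ) (hA : ∀ σ, 0 ≤ A σ) (hB : ∀ σ, 0 ≤ B σ) (k : ℕ)
    (s : ℂ) : ((∏ σ : InfinitePlace F, A σ ^ σ.mult / B σ ^ (k * σ.mult) : ℝ) : ℂ) ^ s =
      (∏ σ : InfinitePlace F, (A σ : ℂ) ^ (σ.mult * s)) *
        ∏ σ : InfinitePlace F, (B σ : ℂ) ^ (-(σ.mult * (k * s))) := by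
  rw [ofReal_prod_cpow _ _ fun σ => div_nonneg (pow_nonneg (hA σ) _) (pow_nonneg (hB σ) _),
    ← Finset.prod_mul_distrib]
  refine Finset.prod_congr rfl fun σ _ => ?_
  rw [div_eq_mul_inv, ofReal_cpow_mul (pow_nonneg (hA σ) _) (inv_nonneg.mpr (pow_nonneg (hB σ) _)),
    ofReal_pow_cpow (hA σ), ← inv_pow, ofReal_pow_cpow (inv_nonneg.mpr (hB σ)), Complex.ofReal_inv,
    Complex.inv_cpow, Complex.cpow_neg]
  · congr 3
    push_cast
    ring
  · rw [Complex.arg_ofReal_of_nonneg (hB σ)]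
    exact Real.pi_pos.ne

lemma detFun_snoc {g : GL (Fin (n + 1)) (mixedSpace F)} {g₁ : GL (Fin n) (mixedSpace F)}
    {xn : Fin n → mixedSpace F} (h : IsCorner g.1 g₁.1 xn) (ξ : Fin n → mixedSpace F)
    (x : Fin n → F) (y : F) (s : ℂ) :
    (detFun (toOrbit (snocVec x y)) (unip ξ • (QuotientGroup.mk g : UpperSpace F (n + 1))) : ℂ) ^ s =
      detPow g₁ s * radProd (rowNorms g₁ (emb x)) ((n + 1) * s)
        (rowForm x ξ + rowForm x xn + mixedEmbedding F y) := by
  change ((detAux (snocVec x y) (unip ξ * g) : ℝ) : ℂ) ^ s = _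
  rw [detAux_unip h, prod_div_cpow _ _ (fun σ => normAtPlace_nonneg _ _)
    (fun σ => Real.sqrt_nonneg _), detPow, radProd]
  push_cast
  rfl

lemma detFun_repr (g : GL (Fin n) (mixedSpace F)) (x : Fin n → F) (s : ℂ) :
    (detFun (toOrbit x) (QuotientGroup.mk g : UpperSpace F n) : ℂ) ^ s =
      detPow g s * ∏ σ : InfinitePlace F, (rowNorms g (emb x) σ : ℂ) ^ (-(σ.mult * (n * s))) := by
  rw [detFun_mk, detAux, prod_div_cpow _ _ (fun σ => normAtPlace_nonneg _ _)
    (fun σ => rowNorm_nonneg _ _), detPow]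
  rfl

lemma detFun_snoc_zero {g : GL (Fin (n + 1)) (mixedSpace F)} {g₁ : GL (Fin n) (mixedSpace F)}
    {xn : Fin n → mixedSpace F} (h : IsCorner g.1 g₁.1 xn) (ξ : Fin n → mixedSpace F)
    {y : F} (hy : y ≠ 0) (s : ℂ) :
    (detFun (toOrbit (snocVec 0 y)) (unip ξ • (QuotientGroup.mk g : UpperSpace F (n + 1))) : ℂ) ^ s =
      detPow g₁ s * (fnorm (princ y hy) : ℂ) ^ (-((n + 1) * s)) := by
  have h0 : emb (0 : Fin n → F) = 0 := emb_eq_zero_iff.mpr rfl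
  rw [detFun_snoc h, rowForm_apply, rowForm_apply, h0, radProd, fnorm_princ,
    ofReal_prod_cpow _ _ fun σ => pow_nonneg (apply_nonneg σ y) _]
  congr 1
  refine Finset.prod_congr rfl fun σ _ => ?_
  simp only [rowNorms, Matrix.zero_vecMul, Pi.zero_apply, zero_mul, Finset.sum_const_zero, zero_add,
    normAtPlace_apply]
  have h1 : rowNorm σ (0 : Fin n → mixedSpace F) = 0 := by simp [rowNorm]
  rw [h1, zero_pow two_ne_zero, zero_add, Real.sqrt_sq (apply_nonneg σ y),
    ofReal_pow_cpow (apply_nonneg σ y)]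
  congr 1
  ring

end Decomposition

/-! ### Termwise integration of the Eisenstein series -/

/-- Pointwise convergence gives measurability, as a limit of finite sums; the sum of the `L¹` norms
bounds the integral. -/
lemma integrable_tsum_of_summable {α ι : Type*} [MeasurableSpace α] {μ : Measure α} [Countable ι]
    {f : ι → α → ℂ} (hf : ∀ i, Integrable (f i) μ) (hs : Summable fun i => ∫ x, ‖f i x‖ ∂μ)
    (hs' : ∀ x, Summable fun i => f i x) : Integrable (fun x => ∑' i, f i x) μ := by
  constructor
  · refine aestronglyMeasurable_of_tendsto_ae (Filter.atTop : Filter (Finset ι))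
      (f := fun s x => ∑ i ∈ s, f i x) (fun s => ?_)
      (Filter.Eventually.of_forall fun x => (hs' x).hasSum)
    exact Finset.aestronglyMeasurable_fun_sum s fun i _ => (hf i).1
  · have h1 : ∫⁻ x, ‖∑' i, f i x‖ₑ ∂μ ≤ ∫⁻ x, ∑' i, ‖f i x‖ₑ ∂μ := by
      refine lintegral_mono fun x => ?_
      exact enorm_tsum_le_tsum_enorm
    refine lt_of_le_of_lt h1 ?_
    rw [lintegral_tsum fun i => (hf i).1.enorm]
    have h2 (i : ι) : ∫⁻ x, ‖f i x‖ₑ ∂μ = ENNReal.ofReal (∫ x, ‖f i x‖ ∂μ) :=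
      (ofReal_integral_norm_eq_lintegral_enorm (hf i)).symm
    simp_rw [h2]
    rw [← ENNReal.ofReal_tsum_of_nonneg (fun i => integral_nonneg fun x => norm_nonneg _) hs]
    exact ENNReal.ofReal_lt_top

/-- The exact integral formula at the real exponent therefore serves as the `L¹` norm in all
convergence estimates. -/
lemma norm_radProd {A : InfinitePlace F → ℝ} (hA : ∀ σ, 0 < A σ) (κ : ℂ) (t : mixedSpace F) :
    ((‖radProd A κ t‖ : ℝ) : ℂ) = radProd A (κ.re : ℂ) t := by
  rw [radProd, radProd, norm_prod, Complex.ofReal_prod]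
  refine Finset.prod_congr rfl fun σ _ => ?_
  have h : 0 < Real.sqrt (A σ ^ 2 + normAtPlace σ t ^ 2) := by
    have := hA σ
    positivity
  rw [Complex.norm_cpow_eq_rpow_re_of_pos h, Complex.ofReal_cpow h.le]
  congr 1
  simp

/-- The constant of the integral of `radProd`. -/
def radConst (F : Type*) [Field F] [NumberField F] (κ : ℂ) : ℂ :=
  (Real.pi : ℂ) ^ (Module.finrank ℚ F / 2 : ℂ) * (gammaF F (κ - 1) / gammaF F κ)

lemma integral_norm_radProd {A : InfinitePlace F → ℝ} (hA : ∀ σ, 0 < A σ) {κ : ℂ}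
    (hκ : 1 < κ.re) : ∫ t, ‖radProd A κ t‖ = ‖radConst F κ.re‖ *
      ‖∏ σ : InfinitePlace F, (A σ : ℂ) ^ (-(σ.mult * ((κ.re : ℂ) - 1)))‖ := by
  have h1 := integral_radProd hA (κ := (κ.re : ℂ)) (by simpa using hκ)
  simp_rw [← norm_radProd hA] at h1
  have h2 := congrArg norm ((integral_complex_ofReal (f := fun t => ‖radProd A κ t‖)).symm.trans h1)
  rw [norm_mul, Complex.norm_real, Real.norm_of_nonneg
    (integral_nonneg fun t => norm_nonneg _)] at h2
  exact h2

lemma detPow_ne_zero (g : GL (Fin n) (mixedSpace F)) (s : ℂ) : detPow g s ≠ 0 := by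
  refine Finset.prod_ne_zero_iff.mpr fun σ _ => ?_
  have h1 : IsUnit g.1.det := (Matrix.isUnit_iff_isUnit_det _).mp g.isUnit
  have h2 : normAtPlace σ g.1.det ≠ 0 := (h1.map (normAtPlace σ)).ne_zero
  rw [Ne, Complex.cpow_eq_zero_iff]
  exact fun h => h2 (by exact_mod_cast h.1)

section Integration

variable {a : Fin (n + 1) → Frac F} {b : Frac F} {D : Set (Fin n → mixedSpace F)}
  {g : GL (Fin (n + 1)) (mixedSpace F)} {g₁ : GL (Fin n) (mixedSpace F)}
  {xn : Fin n → mixedSpace F} {s : ℂ}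

lemma rowNorms_pos (g₁ : GL (Fin n) (mixedSpace F)) {L : Submodule (𝓞 F) (Fin n → F)} {c : Frac F}
    (q : primOrbits L c) (σ : InfinitePlace F) : 0 < rowNorms g₁ (emb (repVec q)) σ :=
  rowNorm_pos g₁ (repVec_mem q).2.1 σ

lemma summable_head (hn : n ≠ 0) (z : UpperSpace F n) {t : ℝ} (ht : 1 < t) :
    Summable fun p : HeadIndex a b => detFun p.2.1 z ^ t := by
  have hinj : Function.Injective (fun p : HeadIndex a b =>
      (⟨p.2.1, primOrbits_subset _ _ p.2.2⟩ : latticeOrbits fun i : Fin n => a i.castSucc)) :=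
    fun p p' h => toOrbit_eq_of_mem p.2 p'.2 (Subtype.ext_iff.mp h)
  exact ((summable_detFun hn (fun i : Fin n => a i.castSucc) z ht).comp_injective hinj).congr
    fun p => rfl

lemma idealCovol_stepIdeal (m : (Ideal (𝓞 F))⁰) : idealCovol (stepIdeal a b m) =
    fnorm (toFrac m) * idealCovol (b⁻¹ * a (Fin.last n)) := by
  rw [idealCovol, idealCovol, stepIdeal, mul_right_comm, fnorm_mul _ (toFrac m)]
  ring

lemma one_lt_re (hs : 1 < s.re) : 1 < (((n : ℂ) + 1) * s).re := by
  have h : (((n : ℂ) + 1) * s).re = (n + 1) * s.re := by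
    rw [show ((n : ℂ) + 1) = ((n + 1 : ℝ) : ℂ) by push_cast; rfl, Complex.re_ofReal_mul]
  rw [h]
  have : (0 : ℝ) ≤ n := Nat.cast_nonneg n
  nlinarith

variable (g₁ s) in
/-- The radial function attached to a head vector. -/
def headRad (p : HeadIndex a b) : mixedSpace F → ℂ :=
  radProd (rowNorms g₁ (emb (repVec p.2))) ((n + 1) * s)

/-- Integrating out the last coordinate lowers the exponent by one, and what is left is a term of
the Eisenstein series of `L^{(1)}` at the exponent `(κ - 1)/n`. -/
lemma integral_norm_headRad (hn : n ≠ 0) (hs : 1 < s.re) (p : HeadIndex a b) :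
    ∫ t, ‖headRad g₁ s p t‖ = ‖radConst F ((((n : ℂ) + 1) * s).re : ℂ)‖ *
      ‖(detPow g₁ ((((((n : ℂ) + 1) * s).re - 1) / n : ℝ) : ℂ))‖⁻¹ *
      detFun p.2.1 (QuotientGroup.mk g₁ : UpperSpace F n) ^
        (((((n : ℂ) + 1) * s).re - 1) / n) := by
  have hn' : (n : ℂ) ≠ 0 := by exact_mod_cast hn
  rw [headRad, integral_norm_radProd (rowNorms_pos g₁ p.2) (one_lt_re hs), mul_assoc]
  congr 1
  set t : ℝ := ((((n : ℂ) + 1) * s).re - 1) / n with ht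
  have h1 := detFun_repr g₁ (repVec p.2) (t : ℂ)
  have h2 : (n : ℂ) * (t : ℂ) = ((((n : ℂ) + 1) * s).re : ℂ) - 1 := by
    rw [ht]
    push_cast
    field_simp
  rw [h2, toOrbit_repVec] at h1
  have h3 := congrArg norm h1
  rw [norm_detFun_cpow (primOrbits_subset _ _ p.2.2), Complex.ofReal_re, norm_mul] at h3
  rw [h3, inv_mul_cancel_left₀ (norm_ne_zero_iff.mpr (detPow_ne_zero _ _))]

lemma one_lt_exponent (hn : n ≠ 0) (hs : 1 < s.re) : 1 < ((((n : ℂ) + 1) * s).re - 1) / n := by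
  have h : (((n : ℂ) + 1) * s).re = (n + 1) * s.re := by
    rw [show ((n : ℂ) + 1) = ((n + 1 : ℝ) : ℂ) by push_cast; rfl, Complex.re_ofReal_mul]
  have hn' : (0 : ℝ) < n := by exact_mod_cast Nat.pos_of_ne_zero hn
  rw [h, lt_div_iff₀ hn']
  nlinarith

/-- The `φ(𝔪)` cosets are compensated by the factor `N𝔪` in the covolume of `𝔠`, so the sum is
bounded by the convergent series of rank `n`. -/
lemma summable_totient_headRad (hn : n ≠ 0) (hs : 1 < s.re) (V : ℝ) (hV : 0 ≤ V) :
    Summable fun p : HeadIndex a b => (totient p.1 : ℝ) *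
      (V / idealCovol (stepIdeal a b p.1) * ∫ t, ‖headRad g₁ s p t‖) := by
  set K : ℝ := ‖radConst F ((((n : ℂ) + 1) * s).re : ℂ)‖ *
      ‖(detPow g₁ ((((((n : ℂ) + 1) * s).re - 1) / n : ℝ) : ℂ))‖⁻¹ with hK
  refine Summable.of_nonneg_of_le (fun p => ?_) (fun p => ?_) ((summable_head (a := a) (b := b) hn
    (QuotientGroup.mk g₁) (one_lt_exponent hn hs)).mul_left
      (V / idealCovol (b⁻¹ * a (Fin.last n)) * K))
  · have := idealCovol_pos (stepIdeal a b p.1)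
    have : 0 ≤ ∫ t, ‖headRad g₁ s p t‖ := integral_nonneg fun t => norm_nonneg _
    positivity
  · rw [integral_norm_headRad hn hs, ← hK, idealCovol_stepIdeal]
    have h1 := totient_le p.1
    have h2 := fnorm_pos (toFrac p.1 : Frac F)
    have h3 := idealCovol_pos (b⁻¹ * a (Fin.last n))
    have h4 : 0 ≤ detFun p.2.1 (QuotientGroup.mk g₁ : UpperSpace F n) ^
        (((((n : ℂ) + 1) * s).re - 1) / n) := Real.rpow_nonneg (detFun_nonneg _ _) _
    have hK0 : 0 ≤ K := by positivity
    calc _ = ((totient p.1 : ℝ) / fnorm (toFrac p.1)) * (V / idealCovol (b⁻¹ * a (Fin.last n)) * K *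
          detFun p.2.1 (QuotientGroup.mk g₁ : UpperSpace F n) ^
            (((((n : ℂ) + 1) * s).re - 1) / n)) := by
          field_simp
      _ ≤ 1 * _ := by
          refine mul_le_mul_of_nonneg_right ((div_le_one h2).mpr h1) (by positivity)
      _ = _ := one_mul _

variable (a b g s) in
/-- The terms of the Eisenstein series. -/
def decompTerm (i : DecompIndex a b) (ξ : Fin n → mixedSpace F) : ℂ :=
  (detFun (toOrbit (decompVec i)) (unip ξ • (QuotientGroup.mk g : UpperSpace F (n + 1))) : ℂ) ^ s

lemma decompTerm_inl (h : IsCorner g.1 g₁.1 xn)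
    (e : PLift (idealClass b = idealClass (a (Fin.last n)))) (ξ : Fin n → mixedSpace F) :
    decompTerm a b g s (Sum.inl e) ξ =
      detPow g₁ s * (fnorm (a (Fin.last n) * b⁻¹) : ℂ) ^ (-((n + 1) * s)) := by
  obtain ⟨hy, hy'⟩ := (exists_princ_eq e.down).choose_spec
  rw [decompTerm, decompVec, detFun_snoc_zero h ξ hy, hy']

lemma decompTerm_inr (h : IsCorner g.1 g₁.1 xn) (p : HeadIndex a b)
    (y : unitVecs p.1 (stepIdeal a b p.1)) (ξ : Fin n → mixedSpace F) :
    decompTerm a b g s (Sum.inr ⟨p, y⟩) ξ = detPow g₁ s * headRad g₁ s p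
      (rowForm (repVec p.2) ξ + rowForm (repVec p.2) xn + mixedEmbedding F y) := by
  rw [decompTerm, decompVec, detFun_snoc h, headRad]

lemma integrable_headRad (hs : 1 < s.re) (p : HeadIndex a b) : Integrable (headRad g₁ s p) :=
  integrable_radProd (rowNorms_pos g₁ p.2) (one_lt_re hs)

lemma summable_decompTerm (hn : n ≠ 0) (hs : 1 < s.re) (hD : IsFundDomain a D)
    (h : IsCorner g.1 g₁.1 xn) (ν : Fin n → mixedSpace F) :
    (∀ i : DecompIndex a b, IntegrableOn (fun ξ => decompTerm a b g s i ξ * charV ν ξ) D) ∧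
    Summable fun i : DecompIndex a b => ∫ ξ in D, ‖decompTerm a b g s i ξ * charV ν ξ‖ := by
  have key (p : HeadIndex a b) := hasSum_unitVecs_norm hD (repVec_mem p.2).2.1
    (contentInv_mul_eq_stepIdeal (repVec_mem p.2)) p.1 (integrable_headRad (g₁ := g₁) hs p) ν
    (rowForm (repVec p.2) xn)
  have hfin : volume D ≠ ⊤ := (volume_fundDomain hD).1
  have : IsFiniteMeasure ((volume : Measure (Fin n → mixedSpace F)).restrict D) :=
    ⟨by rw [Measure.restrict_apply_univ]; exact hfin.lt_top⟩
  constructor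
  · rintro (e | ⟨p, y⟩)
    · simp_rw [decompTerm_inl h]
      refine Integrable.const_mul ?_ _
      exact (integrable_const (1 : ℝ)).mono' (continuous_charV ν).aestronglyMeasurable
        (Filter.Eventually.of_forall fun ξ => (norm_charV ν ξ).le)
    · simp_rw [decompTerm_inr h, mul_assoc]
      exact ((key p).1 y).const_mul _
  · refine Summable.sum _ Summable.of_finite ?_
    refine (summable_sigma_of_nonneg (f := (fun i : DecompIndex a b => ∫ ξ in D,
      ‖decompTerm a b g s i ξ * charV ν ξ‖) ∘ Sum.inr)
      fun p => integral_nonneg fun ξ => norm_nonneg _).mpr ?_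
    have h2 (p : HeadIndex a b) : HasSum (fun y : unitVecs p.1 (stepIdeal a b p.1) =>
        ((fun i : DecompIndex a b => ∫ ξ in D, ‖decompTerm a b g s i ξ * charV ν ξ‖) ∘ Sum.inr)
          ⟨p, y⟩) (‖detPow g₁ s‖ * ((totient p.1 : ℝ) * ((volume D).toReal /
          idealCovol (stepIdeal a b p.1) * ∫ t, ‖headRad g₁ s p t‖))) := by
      refine ((key p).2.mul_left ‖detPow g₁ s‖).congr_fun fun y => ?_
      rw [← integral_const_mul]
      simp only [Function.comp_apply]
      congr 1 with ξ
      rw [decompTerm_inr h, mul_assoc, norm_mul]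
    refine ⟨fun p => (h2 p).summable, ?_⟩
    simp_rw [fun p => (h2 p).tsum_eq]
    exact (summable_totient_headRad hn hs _ ENNReal.toReal_nonneg).mul_left _

lemma eisIdeal_unip (hb : (1 : F) ∈ (b : FractionalIdeal (𝓞 F)⁰ F)) (ξ : Fin n → mixedSpace F) :
    eisIdeal (sumLattice a) b (unip ξ • (QuotientGroup.mk g : UpperSpace F (n + 1))) s =
      ∑' i : DecompIndex a b, decompTerm a b g s i ξ := by
  rw [eisIdeal, ← (decompEquiv hb).tsum_eq]
  rfl

lemma summable_decompTerm_point (hb : (1 : F) ∈ (b : FractionalIdeal (𝓞 F)⁰ F)) (hs : 1 < s.re)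
    (ξ : Fin n → mixedSpace F) : Summable fun i : DecompIndex a b => decompTerm a b g s i ξ := by
  have h := summable_detFun (Nat.succ_ne_zero n) a
    (unip ξ • (QuotientGroup.mk g : UpperSpace F (n + 1))) hs
  have hinj : Function.Injective (fun i : DecompIndex a b =>
      (⟨(decompEquiv hb i).1, primOrbits_subset _ _ (decompEquiv hb i).2⟩ : latticeOrbits a)) :=
    fun i j hij => by
      have h' : (decompEquiv hb i).1 = (decompEquiv hb j).1 :=
        congrArg (fun q : latticeOrbits a => q.1) hij
      exact (decompEquiv hb).injective (Subtype.ext h')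
  refine Summable.of_norm ((h.comp_injective hinj).congr fun i => ?_)
  exact (norm_detFun_cpow (primOrbits_subset _ _ (decompEquiv hb i).2) _ s).symm

lemma countable_orbits : Countable (Orbits F n) := by
  have : Function.Surjective (toOrbit : (Fin n → F) → Orbits F n) := Quotient.mk_surjective
  exact this.countable

variable (g₁ s xn D) in
/-- The contribution of a head vector to a Fourier coefficient. -/
def headSum (ν : Fin n → mixedSpace F) (p : HeadIndex a b) : ℂ :=
  ∑' y : unitVecs p.1 (stepIdeal a b p.1), ∫ ξ in D, headRad g₁ s p
      (rowForm (repVec p.2) ξ + rowForm (repVec p.2) xn + mixedEmbedding F y) * charV ν ξ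

/-- Termwise integration over the orbit decomposition. The zero head has a constant coefficient, so
it meets only the integral of the character. -/
theorem integral_eisIdeal (hn : n ≠ 0) (hb : (1 : F) ∈ (b : FractionalIdeal (𝓞 F)⁰ F))
    (hs : 1 < s.re) (hD : IsFundDomain a D) (h : IsCorner g.1 g₁.1 xn)
    (ν : Fin n → mixedSpace F) :
    IntegrableOn (fun ξ => eisIdeal (sumLattice a) b
      (unip ξ • (QuotientGroup.mk g : UpperSpace F (n + 1))) s * charV ν ξ) D ∧
    ∫ ξ in D, eisIdeal (sumLattice a) b
      (unip ξ • (QuotientGroup.mk g : UpperSpace F (n + 1))) s * charV ν ξ =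
      detPow g₁ s * (classDelta (idealClass b) (idealClass (a (Fin.last n))) *
        (fnorm (a (Fin.last n) * b⁻¹) : ℂ) ^ (-((n + 1) * s)) * (∫ ξ in D, charV ν ξ) +
      ∑' p : HeadIndex a b, headSum D g₁ xn s ν p) := by
  have hcount : Countable (DecompIndex a b) := by
    have := countable_orbits (F := F) (n := n + 1)
    exact (decompEquiv hb).injective.countable
  obtain ⟨h1, h2⟩ := summable_decompTerm (b := b) hn hs hD h ν
  have hpt (ξ : Fin n → mixedSpace F) :
      Summable fun i : DecompIndex a b => decompTerm a b g s i ξ * charV ν ξ :=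
    (summable_decompTerm_point hb hs ξ).mul_right _
  have hE (ξ : Fin n → mixedSpace F) : eisIdeal (sumLattice a) b
      (unip ξ • (QuotientGroup.mk g : UpperSpace F (n + 1))) s * charV ν ξ =
      ∑' i : DecompIndex a b, decompTerm a b g s i ξ * charV ν ξ := by
    rw [eisIdeal_unip hb, tsum_mul_right]
  simp_rw [hE]
  refine ⟨integrable_tsum_of_summable h1 h2 hpt, ?_⟩
  have h3 := hasSum_integral_of_summable_integral_norm h1 h2
  rw [← h3.tsum_eq]
  have hs1 : Summable ((fun i : DecompIndex a b => ∫ ξ in D, decompTerm a b g s i ξ * charV ν ξ) ∘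
    Sum.inl) := Summable.of_finite
  have hs2 : Summable ((fun i : DecompIndex a b => ∫ ξ in D, decompTerm a b g s i ξ * charV ν ξ) ∘
    Sum.inr) := h3.summable.comp_injective Sum.inr_injective
  rw [(hs1.hasSum.sum hs2.hasSum).tsum_eq, mul_add]
  congr 1
  · simp only [Function.comp_apply, decompTerm_inl h]
    rw [classDelta]
    split_ifs with hc
    · rw [tsum_eq_single (PLift.up hc) fun b' hb' => absurd (Subsingleton.elim _ _) hb',
        integral_const_mul]
      ring
    · have : IsEmpty (PLift (idealClass b = idealClass (a (Fin.last n)))) := ⟨fun e => hc e.down⟩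
      rw [tsum_empty]
      ring
  · rw [hs2.tsum_sigma, ← tsum_mul_left]
    refine tsum_congr fun p => ?_
    rw [headSum, ← tsum_mul_left]
    refine tsum_congr fun y => ?_
    simp only [Function.comp_apply, decompTerm_inr h, mul_assoc]
    rw [integral_const_mul]

theorem headSum_of_eq (hs : 1 < s.re) (hD : IsFundDomain a D) (p : HeadIndex a b) {μ : F}
    (hμ : μ • repVec p.2 ∈ sumLattice (dualIdeals a)) :
    headSum D g₁ xn s (emb (μ • repVec p.2)) p =
      (∑ᶠ q : RamGen p.1 (stepIdeal a b p.1), charTr F (μ * ramRep p.1 (stepIdeal a b p.1) q.1)) *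
        (charInf (-(mixedEmbedding F μ * rowForm (repVec p.2) xn)) *
        (((volume D).toReal / idealCovol (stepIdeal a b p.1) : ℝ) *
        ∫ w, headRad g₁ s p w * charInf (mixedEmbedding F μ * w))) :=
  (hasSum_unitVecs_of_eq hD (repVec_mem p.2).2.1 (contentInv_mul_eq_stepIdeal (repVec_mem p.2)) p.1
    hμ (integrable_radProd_mul_charInf (rowNorms_pos g₁ p.2) (one_lt_re hs) _)
    (rowForm (repVec p.2) xn)).tsum_eq

theorem headSum_of_ne (hs : 1 < s.re) (hD : IsFundDomain a D) (p : HeadIndex a b) {u : Fin n → F}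
    (hu : u ∈ sumLattice (dualIdeals a)) (hu' : ¬ ∃ μ : F, u = μ • repVec p.2) :
    headSum D g₁ xn s (emb u) p = 0 :=
  (hasSum_unitVecs_of_ne hD (repVec_mem p.2).2.1 (contentInv_mul_eq_stepIdeal (repVec_mem p.2)) p.1
    hu hu' (integrable_headRad hs p) (rowForm (repVec p.2) xn)).tsum_eq

end Integration

/-! ### The constant term -/

lemma fnorm_ne_zero (c : Frac F) : (fnorm c : ℂ) ≠ 0 := by exact_mod_cast (fnorm_pos c).ne'

lemma fnorm_mul_cpow (b c : Frac F) (s : ℂ) :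
    (fnorm (b * c) : ℂ) ^ s = (fnorm b : ℂ) ^ s * (fnorm c : ℂ) ^ s := by
  rw [fnorm_mul, ofReal_cpow_mul (fnorm_pos b).le (fnorm_pos c).le]

lemma fnorm_inv_cpow (c : Frac F) (s : ℂ) : (fnorm c⁻¹ : ℂ) ^ s = (fnorm c : ℂ) ^ (-s) := by
  have h : (fnorm c⁻¹ : ℂ) ^ s * (fnorm c : ℂ) ^ s = 1 := by
    rw [← fnorm_mul_cpow, inv_mul_cancel, fnorm_one, Complex.ofReal_one, Complex.one_cpow]
  rw [Complex.cpow_neg]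
  exact eq_inv_of_mul_eq_one_left h

section Constant

variable {a : Fin (n + 1) → Frac F} {b : Frac F} {D : Set (Fin n → mixedSpace F)}
  {g : GL (Fin (n + 1)) (mixedSpace F)} {g₁ : GL (Fin n) (mixedSpace F)}
  {xn : Fin n → mixedSpace F} {s s₁ : ℂ}

theorem fourierCoeff_eisClass (hn : n ≠ 0) (hb : (1 : F) ∈ (b : FractionalIdeal (𝓞 F)⁰ F))
    (hs : 1 < s.re) (hD : IsFundDomain a D) (h : IsCorner g.1 g₁.1 xn)
    (ν : Fin n → mixedSpace F) :
    FourierIntegrable D (fun z => eisClass (sumLattice a) (idealClass b) z s) ν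
      (QuotientGroup.mk g) ∧
    fourierCoeff D (fun z => eisClass (sumLattice a) (idealClass b) z s) ν (QuotientGroup.mk g) =
      partialZeta (idealClass b⁻¹) (((n : ℂ) + 1) * s) * ((fnorm b : ℂ) ^ (-(((n : ℂ) + 1) * s)) *
        (detPow g₁ s * (classDelta (idealClass b) (idealClass (a (Fin.last n))) *
        (fnorm (a (Fin.last n) * b⁻¹) : ℂ) ^ (-((n + 1) * s)) *
          (((volume D).toReal : ℂ)⁻¹ * ∫ ξ in D, charV ν ξ) +
      ∑' p : HeadIndex a b, ((volume D).toReal : ℂ)⁻¹ * headSum D g₁ xn s ν p))) := by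
  obtain ⟨h1, h2⟩ := integral_eisIdeal hn hb hs hD h ν
  have h3 (ξ : Fin n → mixedSpace F) : fourierIntegrand
      (fun z => eisClass (sumLattice a) (idealClass b) z s) ν (QuotientGroup.mk g) ξ =
      (partialZeta (idealClass b⁻¹) (((n : ℂ) + 1) * s) * (fnorm b : ℂ) ^ (-(((n : ℂ) + 1) * s))) *
      (eisIdeal (sumLattice a) b (unip ξ • (QuotientGroup.mk g : UpperSpace F (n + 1))) s *
        charV ν ξ) := by
    rw [fourierIntegrand, eisClass_eq hb, idealNorm_eq, Nat.cast_add, Nat.cast_one, charV]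
    ring
  constructor
  · rw [FourierIntegrable, funext h3]
    exact h1.const_mul _
  · rw [fourierCoeff, funext h3, integral_const_mul, h2, tsum_mul_left]
    ring

lemma finsum_charTr_zero (m : (Ideal (𝓞 F))⁰) (c : Frac F) :
    ∑ᶠ q : RamGen m c, charTr F (0 * ramRep m c q.1) = totient m := by
  have := Fintype.ofFinite (RamGen m c)
  have h0 : charTr F (0 : F) = 1 := by simp [charTr]
  simp only [zero_mul, h0]
  rw [finsum_eq_sum_of_fintype, Finset.sum_const, Finset.card_univ, ← Nat.card_eq_fintype_card,
    card_ramGen, nsmul_eq_mul, mul_one]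

lemma volume_toReal_ne_zero (hD : IsFundDomain a D) : ((volume D).toReal : ℂ) ≠ 0 := by
  obtain ⟨h1, h2⟩ := volume_fundDomain hD
  exact_mod_cast (ENNReal.toReal_pos h2 h1).ne'

lemma integral_headRad (hs : 1 < s.re) (hs₁ : (n : ℂ) * s₁ = ((n : ℂ) + 1) * s - 1)
    (p : HeadIndex a b) : ∫ t, headRad g₁ s p t = radConst F (((n : ℂ) + 1) * s) *
      ((detPow g₁ s₁)⁻¹ * (detFun p.2.1 (QuotientGroup.mk g₁ : UpperSpace F n) : ℂ) ^ s₁) := by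
  have h1 := detFun_repr g₁ (repVec p.2) s₁
  rw [hs₁, toOrbit_repVec] at h1
  rw [headRad, integral_radProd (rowNorms_pos g₁ p.2) (one_lt_re hs), h1,
    inv_mul_cancel_left₀ (detPow_ne_zero _ _), radConst]

/-- The frequency `0` is the multiple `0 · x` of every head, so the proportional case applies with
`μ = 0`, and all the coset weights are `1`. -/
lemma headSum_zero (hs : 1 < s.re) (hs₁ : (n : ℂ) * s₁ = ((n : ℂ) + 1) * s - 1)
    (hD : IsFundDomain a D) (p : HeadIndex a b) :
    ((volume D).toReal : ℂ)⁻¹ * headSum D g₁ xn s 0 p = (radConst F (((n : ℂ) + 1) * s) *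
      (idealCovol (b⁻¹ * a (Fin.last n)) : ℂ)⁻¹ * (detPow g₁ s₁)⁻¹) *
      ((totient p.1 : ℂ) / (fnorm (toFrac p.1 : Frac F) : ℂ) *
        (detFun p.2.1 (QuotientGroup.mk g₁ : UpperSpace F n) : ℂ) ^ s₁) := by
  have h0 : (0 : F) • repVec p.2 ∈ sumLattice (dualIdeals a) := by
    rw [zero_smul]
    exact Submodule.zero_mem _
  have h1 := headSum_of_eq (g₁ := g₁) (xn := xn) hs hD p h0
  rw [zero_smul, emb_eq_zero_iff.mpr rfl] at h1
  rw [h1, finsum_charTr_zero, map_zero, idealCovol_stepIdeal]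
  simp only [zero_mul, neg_zero, charInf_zero, mul_one, one_mul]
  rw [integral_headRad hs hs₁]
  have h2 := volume_toReal_ne_zero hD
  push_cast
  field_simp

lemma summable_totient_detFun (hn : n ≠ 0) (hs₁ : 1 < s₁.re) (z : UpperSpace F n) :
    Summable fun p : HeadIndex a b => (totient p.1 : ℂ) / (fnorm (toFrac p.1 : Frac F) : ℂ) *
      (detFun p.2.1 z : ℂ) ^ s₁ := by
  refine Summable.of_norm_bounded (summable_head (a := a) (b := b) hn z hs₁) fun p => ?_
  rw [norm_mul, norm_detFun_cpow (primOrbits_subset _ _ p.2.2), norm_div, Complex.norm_natCast,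
    Complex.norm_real, Real.norm_of_nonneg (fnorm_pos _).le]
  have h1 := totient_le p.1
  have h2 := fnorm_pos (toFrac p.1 : Frac F)
  have h4 : 0 ≤ detFun p.2.1 z ^ s₁.re := Real.rpow_nonneg (detFun_nonneg _ _) _
  calc _ ≤ 1 * detFun p.2.1 z ^ s₁.re :=
        mul_le_mul_of_nonneg_right ((div_le_one h2).mpr h1) h4
    _ = _ := one_mul _

/-- The powers of `N𝔪` combine to `N𝔪^{-κ} N𝔪^{κ-1} = N𝔪⁻¹`, the factor coming from the covolume. -/
lemma constant_summand (κ : ℂ) (m : (Ideal (𝓞 F))⁰) (z : UpperSpace F n) :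
    (totient m : ℂ) / idealNorm (toFrac m) ^ κ * (idealNorm (b * (toFrac m)⁻¹) ^ (-(κ - 1)) *
      eisIdeal (sumLattice fun i : Fin n => a i.castSucc) (b * (toFrac m)⁻¹) z s₁) =
    (fnorm b : ℂ) ^ (-(κ - 1)) * ∑' q : primOrbits (sumLattice fun i : Fin n => a i.castSucc)
      (b * (toFrac m)⁻¹), (totient m : ℂ) / (fnorm (toFrac m : Frac F) : ℂ) *
        (detFun q.1 z : ℂ) ^ s₁ := by
  rw [tsum_mul_left, ← eisIdeal, idealNorm_eq, idealNorm_eq, fnorm_mul_cpow, fnorm_inv_cpow, neg_neg,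
    Complex.cpow_sub _ _ (fnorm_ne_zero _), Complex.cpow_one]
  have h1 := fnorm_ne_zero (toFrac m : Frac F)
  have h2 : (fnorm (toFrac m : Frac F) : ℂ) ^ κ ≠ 0 := by
    rw [Ne, Complex.cpow_eq_zero_iff]
    exact fun h => h1 h.1
  field_simp

theorem summable_constant (hn : n ≠ 0) (hs₁ : 1 < s₁.re) (z : UpperSpace F n) (κ : ℂ) :
    Summable fun m : (Ideal (𝓞 F))⁰ => (totient m : ℂ) / idealNorm (toFrac m) ^ κ *
      (idealNorm (b * (toFrac m)⁻¹) ^ (-(κ - 1)) *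
        eisIdeal (sumLattice fun i : Fin n => a i.castSucc) (b * (toFrac m)⁻¹) z s₁) := by
  simp_rw [constant_summand]
  exact (summable_totient_detFun (a := a) (b := b) hn hs₁ z).sigma.mul_left _

theorem tsum_constant (hn : n ≠ 0) (hs₁ : 1 < s₁.re) (z : UpperSpace F n) (κ : ℂ) :
    ∑' m : (Ideal (𝓞 F))⁰, (totient m : ℂ) / idealNorm (toFrac m) ^ κ *
      (idealNorm (b * (toFrac m)⁻¹) ^ (-(κ - 1)) *
        eisIdeal (sumLattice fun i : Fin n => a i.castSucc) (b * (toFrac m)⁻¹) z s₁) =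
    (fnorm b : ℂ) ^ (-(κ - 1)) * ∑' p : HeadIndex a b, (totient p.1 : ℂ) /
      (fnorm (toFrac p.1 : Frac F) : ℂ) * (detFun p.2.1 z : ℂ) ^ s₁ := by
  simp_rw [constant_summand, tsum_mul_left (a := (fnorm b : ℂ) ^ (-(κ - 1)))]
  rw [(summable_totient_detFun (a := a) (b := b) hn hs₁ z).tsum_sigma]

theorem fourierCoeff_zero (hn : n ≠ 0) (hb : (1 : F) ∈ (b : FractionalIdeal (𝓞 F)⁰ F))
    (hs : 1 < s.re) (hs₁ : (n : ℂ) * s₁ = ((n : ℂ) + 1) * s - 1) (hs₁' : 1 < s₁.re)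
    (hD : IsFundDomain a D) (h : IsCorner g.1 g₁.1 xn) :
    fourierCoeff D (fun z => eisClass (sumLattice a) (idealClass b) z s) 0 (QuotientGroup.mk g) =
      partialZeta (idealClass b⁻¹) (((n : ℂ) + 1) * s) *
      (classDelta (idealClass b) (idealClass (a (Fin.last n))) *
        idealNorm (a (Fin.last n)) ^ (-(((n : ℂ) + 1) * s)) * detPow g₁ s +
      (2 : ℂ) ^ (nrComplexPlaces F : ℂ) * (Real.pi : ℂ) ^ ((Module.finrank ℚ F : ℂ) / 2) /
        (((Real.sqrt |(discr F : ℝ)| : ℝ) : ℂ) * idealNorm (a (Fin.last n))) *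
        (gammaF F (((n : ℂ) + 1) * s - 1) / gammaF F (((n : ℂ) + 1) * s)) *
        detPow g₁ ((1 - s) / n) *
      ∑' m : (Ideal (𝓞 F))⁰, (totient m : ℂ) / idealNorm (toFrac m) ^ (((n : ℂ) + 1) * s) *
      (idealNorm (b * (toFrac m)⁻¹) ^ (-(((n : ℂ) + 1) * s - 1)) *
        eisIdeal (sumLattice fun i : Fin n => a i.castSucc) (b * (toFrac m)⁻¹)
          (QuotientGroup.mk g₁) s₁)) := by
  have hn' : (n : ℂ) ≠ 0 := by exact_mod_cast hn
  rw [(fourierCoeff_eisClass hn hb hs hD h 0).2, tsum_constant hn hs₁']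
  simp_rw [headSum_zero hs hs₁ hD, tsum_mul_left]
  set κ : ℂ := ((n : ℂ) + 1) * s with hκ
  congr 1
  have hV : ((volume D).toReal : ℂ)⁻¹ * ∫ ξ in D, charV (0 : Fin n → mixedSpace F) ξ = 1 := by
    have h0 (ξ : Fin n → mixedSpace F) : charV 0 ξ = 1 := by
      simp [charV, pairing, traceInf_zero]
    simp_rw [h0]
    rw [integral_const, Measure.real, Measure.restrict_apply_univ, Complex.real_smul, mul_one,
      inv_mul_cancel₀ (volume_toReal_ne_zero hD)]
  rw [hV, mul_one, mul_add, mul_add]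
  congr 1
  · rw [fnorm_mul_cpow, fnorm_inv_cpow, idealNorm_eq, neg_neg, Complex.cpow_neg _ κ]
    have h1 : (fnorm b : ℂ) ^ κ ≠ 0 := by
      rw [Ne, Complex.cpow_eq_zero_iff]
      exact fun h => fnorm_ne_zero b h.1
    field_simp
  -- The exponents add up, since `(1 - s)/n + ((n + 1)s - 1)/n = s`.
  · have hdet : detPow g₁ ((1 - s) / n) * detPow g₁ s₁ = detPow g₁ s := by
      rw [detPow, detPow, detPow, ← Finset.prod_mul_distrib]
      refine Finset.prod_congr rfl fun σ _ => ?_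
      have h1 : IsUnit g₁.1.det := (Matrix.isUnit_iff_isUnit_det _).mp g₁.isUnit
      have h2 : normAtPlace σ g₁.1.det ≠ 0 := (h1.map (normAtPlace σ)).ne_zero
      rw [← Complex.cpow_add _ _ (by exact_mod_cast h2), ← mul_add]
      congr 2
      field_simp
      linear_combination hs₁
    rw [← hdet, radConst, idealCovol, idealNorm_eq, fnorm_mul, fnorm_inv, neg_sub,
      show 1 - κ = -κ + 1 by ring, Complex.cpow_add _ _ (fnorm_ne_zero b), Complex.cpow_one,
      Complex.cpow_natCast]
    have h1 := detPow_ne_zero g₁ s₁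
    have h2 := fnorm_ne_zero b
    have h3 := fnorm_ne_zero (a (Fin.last n))
    push_cast
    rw [inv_pow]
    field_simp

end Constant

/-! ### The non-constant Fourier coefficients -/

section Nonconstant

variable {a : Fin (n + 1) → Frac F} {b : Frac F} {D : Set (Fin n → mixedSpace F)}
  {g : GL (Fin (n + 1)) (mixedSpace F)} {g₁ : GL (Fin n) (mixedSpace F)}
  {xn : Fin n → mixedSpace F} {s : ℂ} {k : (Ideal (𝓞 F))⁰} {u : Fin n → F}

/-- Translation by a vector that pairs to `1/2` with `u` changes the sign of the character but not
the integral. This removes the zero head from the non-constant coefficients. -/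
lemma integral_charV_eq_zero (hD : IsFundDomain a D) (hu : u ∈ sumLattice (dualIdeals a))
    (hu0 : u ≠ 0) : ∫ ξ in D, charV (emb u) ξ = 0 := by
  have hd : (Module.finrank ℚ F : ℝ) ≠ 0 := by exact_mod_cast Module.finrank_pos.ne'
  obtain ⟨v, hv⟩ := rowForm_surjective hu0 ((2 * (Module.finrank ℚ F : ℝ))⁻¹ • 1)
  have h1 : charV (emb u) v = -1 := by
    have h2 := charV_smul 1 u v
    rw [one_smul, map_one, one_mul, hv, charInf, traceInf_smul,
      show (1 : mixedSpace F) = mixedEmbedding F (algebraMap ℚ F 1) by simp,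
      traceInf_mixedEmbedding, Algebra.trace_algebraMap, nsmul_eq_mul, mul_one, Rat.cast_natCast,
      show (2 * (Module.finrank ℚ F : ℝ))⁻¹ * (Module.finrank ℚ F : ℝ) = 1 / 2 by field_simp,
      show -(2 * (Real.pi : ℂ) * Complex.I * ((1 / 2 : ℝ) : ℂ)) = -(Real.pi * Complex.I) by
        push_cast; ring, Complex.exp_neg, Complex.exp_pi_mul_I] at h2
    rw [h2]
    norm_num
  have h3 := setIntegral_add_eq hD (charV (emb u)) (fun x hx ξ => by
    rw [charV_add, charV_eq_one (mem_dualLattice.mpr ⟨u, hu, rfl⟩) hx, one_mul]) v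
  simp_rw [charV_add, h1] at h3
  rw [integral_const_mul] at h3
  have h4 : (2 : ℂ) * ∫ ξ in D, charV (emb u) ξ = 0 := by linear_combination -h3
  exact (mul_eq_zero.mp h4).resolve_left two_ne_zero

lemma contentInv_head (hu : u ∈ primVec (sumLattice (dualIdeals a)) (toFrac k)⁻¹) :
    contentInv (fun i : Fin n => a i.castSucc) u =
      ((toFrac k * (different F)⁻¹ * (a (Fin.last n))⁻¹ : Frac F) : FractionalIdeal (𝓞 F)⁰ F) := by
  have h1 := (mem_primVec_toFrac_inv.mp hu).2
  rw [contentInv_dualIdeals] at h1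
  have h2 : Units.mk0 _ (contentInv_ne_zero (a := fun i : Fin n => a i.castSucc) hu.2.1) *
      (a (Fin.last n) * different F) = toFrac k := Units.ext h1
  rw [← h2, mul_assoc _ (different F)⁻¹, ← mul_inv_rev, mul_inv_cancel_right]
  rfl

/-- Compare the contents of `u` and of the head in `L^{(1)}`. The ideal `μ𝔠` governing the Ramanujan
sum depends on `u` only through its content in `N^∨`. -/
lemma princ_mul_stepIdeal (hu : u ∈ primVec (sumLattice (dualIdeals a)) (toFrac k)⁻¹)
    (p : HeadIndex a b) {μ : F} (hμ : μ ≠ 0) (h : u = μ • repVec p.2) :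
    princ μ hμ * stepIdeal a b p.1 = toFrac k * (different F)⁻¹ := by
  have h1 := contentInv_head hu
  rw [h, contentInv_smul, contentInv_eq_of_mem (repVec_mem p.2), ← coe_princ μ hμ,
    ← Units.val_mul] at h1
  have h2 := Units.ext h1
  rw [stepIdeal, ← mul_assoc, h2, inv_mul_cancel_right]

lemma idealClass_head (hu : u ∈ primVec (sumLattice (dualIdeals a)) (toFrac k)⁻¹)
    (p : HeadIndex a b) {μ : F} (hμ : μ ≠ 0) (h : u = μ • repVec p.2) :
    ClassGroup.mk0 p.1 =
      idealClass (b * (a (Fin.last n))⁻¹ * toFrac k * (different F)⁻¹) := by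
  rw [← idealClass_toFrac, idealClass_eq_iff]
  refine ⟨μ⁻¹, inv_ne_zero hμ, ?_⟩
  have h1 := princ_mul_stepIdeal hu p hμ h
  have h2 : princ μ⁻¹ (inv_ne_zero hμ) * princ μ hμ = 1 := by
    rw [← princ_mul]
    refine Units.ext ?_
    rw [coe_princ, inv_mul_cancel₀ hμ, FractionalIdeal.spanSingleton_one, Units.val_one]
  rw [mul_assoc _ (toFrac k), ← h1, stepIdeal]
  calc (toFrac p.1 : Frac F) = princ μ⁻¹ (inv_ne_zero hμ) * princ μ hμ * toFrac p.1 *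
        (b * b⁻¹) * (a (Fin.last n) * (a (Fin.last n))⁻¹) := by
        rw [h2, mul_inv_cancel, mul_inv_cancel, one_mul, mul_one, mul_one]
    _ = _ := by
        simp only [mul_assoc, mul_comm, mul_left_comm]

/-- The class condition supplies the `α` for which `αu` has content `𝔟𝔪⁻¹` in `L^{(1)}`; passing to
the chosen representative of its orbit costs a unit. -/
lemma exists_head (hb : (1 : F) ∈ (b : FractionalIdeal (𝓞 F)⁰ F))
    (hu : u ∈ primVec (sumLattice (dualIdeals a)) (toFrac k)⁻¹) {m : (Ideal (𝓞 F))⁰}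
    (hm : ClassGroup.mk0 m = idealClass (b * (a (Fin.last n))⁻¹ * toFrac k * (different F)⁻¹)) :
    ∃ (q : primOrbits (sumLattice fun i : Fin n => a i.castSucc) (b * (toFrac m)⁻¹)) (μ : F),
      μ ≠ 0 ∧ u = μ • repVec q := by
  rw [← idealClass_toFrac, idealClass_eq_iff] at hm
  obtain ⟨α, hα, hm⟩ := hm
  have h1 : α • u ∈ primVec (sumLattice fun i : Fin n => a i.castSucc) (b * (toFrac m)⁻¹) := by
    refine mem_primVec.mpr ⟨smul_ne_zero hα hu.2.1, one_mem_mul_toFrac_inv hb m, ?_⟩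
    rw [contentInv_smul, contentInv_head hu, ← coe_princ α hα, ← Units.val_mul, mul_inv, inv_inv, hm]
    congr 1
    calc princ α hα * (toFrac k * (different F)⁻¹ * (a (Fin.last n))⁻¹) =
        (b⁻¹ * b) * (princ α hα * (toFrac k * (different F)⁻¹ * (a (Fin.last n))⁻¹)) := by
          rw [inv_mul_cancel, one_mul]
      _ = _ := by simp only [mul_assoc, mul_comm, mul_left_comm]
  let q : primOrbits (sumLattice fun i : Fin n => a i.castSucc) (b * (toFrac m)⁻¹) :=
    ⟨toOrbit (α • u), toOrbit_mem_primOrbits.mpr h1⟩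
  obtain ⟨v, hv⟩ := toOrbit_eq_iff.mp (toOrbit_repVec q)
  have hv0 : (((v : 𝓞 F) : F) * α) ≠ 0 := mul_ne_zero (by simp) hα
  refine ⟨q, (((v : 𝓞 F) : F) * α)⁻¹, inv_ne_zero hv0, ?_⟩
  rw [← hv, unit_smul_eq, smul_smul (((v : 𝓞 F) : F)) α u, inv_smul_smul₀ hv0]

/-- Both scalars generate the same principal ideal, because `μ𝔠` is determined by `u`; hence they
differ by a unit, and so do the two heads. -/
lemma head_unique (hu : u ∈ primVec (sumLattice (dualIdeals a)) (toFrac k)⁻¹)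
    {m : (Ideal (𝓞 F))⁰}
    {q q' : primOrbits (sumLattice fun i : Fin n => a i.castSucc) (b * (toFrac m)⁻¹)} {μ μ' : F}
    (h : u = μ • repVec q) (h' : u = μ' • repVec q') : q = q' := by
  have hμ : μ ≠ 0 := by
    rintro rfl
    exact hu.2.1 (h.trans (zero_smul _ _))
  have hμ' : μ' ≠ 0 := by
    rintro rfl
    exact hu.2.1 (h'.trans (zero_smul _ _))
  have h1 := (princ_mul_stepIdeal hu ⟨m, q⟩ hμ h).trans (princ_mul_stepIdeal hu ⟨m, q'⟩ hμ' h').symm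
  obtain ⟨v, hv⟩ := (princ_eq_iff hμ hμ').mp (mul_right_cancel h1)
  refine Subtype.ext ?_
  rw [← toOrbit_repVec, ← toOrbit_repVec, toOrbit_eq_iff]
  refine ⟨v, ?_⟩
  have h2 : μ • repVec q = μ • (v • repVec q') := by
    rw [← h, h', ← hv, unit_smul_eq, smul_smul]
    congr 1
    rw [Units.smul_def, Algebra.smul_def, mul_comm]
  exact (smul_right_injective _ hμ h2).symm

/-- The first factor `2^{r₂}` comes from the covolume. The exponent of `2` is then `r₁ + r₂(1 + (κ -
1)) + r₂ = d + r₂(κ - 1)`. -/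
lemma prod_places_const (κ : ℂ) :
    (2 : ℂ) ^ nrComplexPlaces F * ∏ σ : InfinitePlace F, (2 * (Real.pi : ℂ) ^ (σ.mult / 2 : ℂ) *
      ((Real.pi * σ.mult : ℝ) : ℂ) ^ (σ.mult * (κ - 1) / 2 : ℂ)) =
    (2 : ℂ) ^ ((Module.finrank ℚ F : ℂ) + nrComplexPlaces F * (κ - 1)) *
      (Real.pi : ℂ) ^ ((Module.finrank ℚ F : ℂ) * κ / 2) := by
  have hpi : (Real.pi : ℂ) ≠ 0 := by exact_mod_cast Real.pi_ne_zero
  have hr : ∀ σ : {w : InfinitePlace F // IsReal w}, (2 * (Real.pi : ℂ) ^ ((σ.1.mult : ℂ) / 2) *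
      ((Real.pi * σ.1.mult : ℝ) : ℂ) ^ ((σ.1.mult : ℂ) * (κ - 1) / 2)) =
      2 * (Real.pi : ℂ) ^ (κ / 2) := by
    intro σ
    rw [mult_isReal, Nat.cast_one, Nat.cast_one, mul_one, mul_assoc, ← Complex.cpow_add _ _ hpi]
    congr 2
    ring
  have hc : ∀ σ : {w : InfinitePlace F // IsComplex w}, (2 * (Real.pi : ℂ) ^ ((σ.1.mult : ℂ) / 2) *
      ((Real.pi * σ.1.mult : ℝ) : ℂ) ^ ((σ.1.mult : ℂ) * (κ - 1) / 2)) =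
      2 * (2 : ℂ) ^ (κ - 1) * (Real.pi : ℂ) ^ κ := by
    intro σ
    rw [mult_isComplex, ofReal_cpow_mul Real.pi_pos.le (by positivity), Nat.cast_ofNat,
      Nat.cast_ofNat, Complex.ofReal_ofNat, div_self two_ne_zero, mul_div_cancel_left₀ _ two_ne_zero,
      Complex.cpow_one, Complex.cpow_sub _ _ hpi, Complex.cpow_one]
    field_simp
  rw [prod_eq_prod_mul_prod, Finset.prod_congr rfl fun σ _ => hr σ,
    Finset.prod_congr rfl fun σ _ => hc σ, Finset.prod_const, Finset.prod_const,
    Finset.card_univ, Finset.card_univ]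
  change _ * ((2 * (Real.pi : ℂ) ^ (κ / 2)) ^ nrRealPlaces F *
    (2 * (2 : ℂ) ^ (κ - 1) * (Real.pi : ℂ) ^ κ) ^ nrComplexPlaces F) = _
  have hd : (Module.finrank ℚ F : ℂ) = nrRealPlaces F + 2 * nrComplexPlaces F := by
    rw [← card_add_two_mul_card_eq_rank F]
    push_cast
    rfl
  rw [hd, show ((nrRealPlaces F : ℂ) + 2 * nrComplexPlaces F) * κ / 2 =
    nrRealPlaces F * (κ / 2) + nrComplexPlaces F * κ by ring,
    show ((nrRealPlaces F : ℂ) + 2 * nrComplexPlaces F) + nrComplexPlaces F * (κ - 1) =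
    nrRealPlaces F * 1 + nrComplexPlaces F * (1 + 1 + (κ - 1)) by ring,
    Complex.cpow_add _ _ two_ne_zero, Complex.cpow_add _ _ hpi, Complex.cpow_nat_mul,
    Complex.cpow_nat_mul, Complex.cpow_nat_mul, Complex.cpow_nat_mul,
    Complex.cpow_add _ _ two_ne_zero, Complex.cpow_add _ _ two_ne_zero, Complex.cpow_one]
  simp only [mul_pow]
  ring

lemma rowNorms_smul (g₁ : GL (Fin n) (mixedSpace F)) (μ : F) (x : Fin n → F) (σ : InfinitePlace F) :
    rowNorms g₁ (emb (μ • x)) σ = σ μ * rowNorms g₁ (emb x) σ := by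
  rw [rowNorms, emb_smul, Matrix.smul_vecMul, rowNorm_smul, normAtPlace_apply, rowNorms]

/-- Everything is rewritten in terms of `u = μx`: the Bessel argument `|μ|‖x‖` is `‖u‖`, and
`|μ|/‖x‖ = |μ|²/‖u‖`, so the powers of `|μ|_σ` collect to `N(μ)^{κ-1}`. -/
lemma integral_headRad_charInf (hs : 1 < s.re) (p : HeadIndex a b) {μ : F} (hμ : μ ≠ 0)
    (h : u = μ • repVec p.2) :
    (2 : ℂ) ^ nrComplexPlaces F * ∫ w, headRad g₁ s p w * charInf (mixedEmbedding F μ * w) =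
      (2 : ℂ) ^ ((Module.finrank ℚ F : ℂ) + nrComplexPlaces F * (((n : ℂ) + 1) * s - 1)) *
      (Real.pi : ℂ) ^ ((Module.finrank ℚ F : ℂ) * (((n : ℂ) + 1) * s) / 2) *
      (fnorm (princ μ hμ) : ℂ) ^ (((n : ℂ) + 1) * s - 1) *
      (besselKF (((n : ℂ) + 1) * s - 1) (fun σ => 2 * Real.pi * σ.mult * rowNorms g₁ (emb u) σ) /
        gammaF F (((n : ℂ) + 1) * s)) *
      (∏ σ : InfinitePlace F,
        (rowNorms g₁ (emb u) σ : ℂ) ^ ((σ.mult / 2 : ℂ) * (((n : ℂ) + 1) * s - 1)))⁻¹ := by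
  have hA := rowNorms_pos g₁ p.2
  have hμσ (σ : InfinitePlace F) : 0 < σ μ := pos_iff.mpr hμ
  rw [headRad, integral_radProd_char hA (one_lt_re hs) fun σ => by
    rw [normAtPlace_apply]
    exact (hμσ σ).ne']
  set κ : ℂ := ((n : ℂ) + 1) * s with hκ
  rw [← prod_places_const, fnorm_princ, ofReal_prod_cpow _ _ fun σ => pow_nonneg (hμσ σ).le _,
    besselKF, gammaF, ← Finset.prod_div_distrib, ← Finset.prod_inv_distrib, mul_assoc, mul_assoc,
    mul_assoc, ← Finset.prod_mul_distrib, ← Finset.prod_mul_distrib, ← Finset.prod_mul_distrib]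
  congr 1
  refine Finset.prod_congr rfl fun σ _ => ?_
  have hAσ := hA σ
  have hr : rowNorms g₁ (emb u) σ = σ μ * rowNorms g₁ (emb (repVec p.2)) σ := by
    rw [h, rowNorms_smul]
  have hr0 : 0 < rowNorms g₁ (emb u) σ := by
    rw [hr]
    exact mul_pos (hμσ σ) hAσ
  have h1 : Real.pi * (σ.mult * normAtPlace σ (mixedEmbedding F μ)) /
      rowNorms g₁ (emb (repVec p.2)) σ =
      Real.pi * σ.mult * ((σ μ ^ 2) * (rowNorms g₁ (emb u) σ)⁻¹) := by
    rw [normAtPlace_apply, hr]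
    have := (hμσ σ).ne'
    field_simp
  have h2 : 2 * rowNorms g₁ (emb (repVec p.2)) σ *
      (Real.pi * (σ.mult * normAtPlace σ (mixedEmbedding F μ))) =
      2 * Real.pi * σ.mult * rowNorms g₁ (emb u) σ := by
    rw [normAtPlace_apply, hr]
    ring
  rw [h1, h2, ofReal_cpow_mul (x := Real.pi * σ.mult) (y := σ μ ^ 2 * (rowNorms g₁ (emb u) σ)⁻¹)
      (by positivity) (by positivity),
    ofReal_cpow_mul (x := σ μ ^ 2) (y := (rowNorms g₁ (emb u) σ)⁻¹) (by positivity) (by positivity),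
    ofReal_pow_cpow (hμσ σ).le,
    ofReal_pow_cpow (hμσ σ).le, Complex.ofReal_inv, Complex.inv_cpow]
  · rw [show ((2 : ℕ) : ℂ) * (σ.mult * (κ - 1) / 2) = σ.mult * (κ - 1) by push_cast; ring,
      show (σ.mult * (κ - 1) / 2 : ℂ) = σ.mult / 2 * (κ - 1) by ring]
    ring
  · rw [Complex.arg_ofReal_of_nonneg hr0.le]
    exact Real.pi_pos.ne

variable (g₁ xn s) in
/-- The `K`-Bessel factor in the non-constant terms. -/
def besselTerm (ν : Fin n → mixedSpace F) : ℂ :=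
  Complex.exp (2 * Real.pi * Complex.I * (pairing ν xn : ℂ)) *
    (besselKF (((n : ℂ) + 1) * s - 1) (fun σ => 2 * Real.pi * σ.mult * rowNorms g₁ ν σ) /
      gammaF F (((n : ℂ) + 1) * s)) *
    ∏ σ : InfinitePlace F, ((normAtPlace σ g₁.1.det : ℝ) : ℂ) ^ (σ.mult * s) /
      (rowNorms g₁ ν σ : ℂ) ^ ((σ.mult / 2 : ℂ) * (((n : ℂ) + 1) * s - 1))

variable (F) in
/-- The constant in the non-constant terms. -/
def besselConst (c : Frac F) (κ : ℂ) : ℂ :=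
  (2 : ℂ) ^ ((Module.finrank ℚ F : ℂ) + nrComplexPlaces F * (κ - 1)) *
    (Real.pi : ℂ) ^ ((Module.finrank ℚ F : ℂ) * κ / 2) /
    (((Real.sqrt |(discr F : ℝ)| : ℝ) : ℂ) * idealNorm c ^ κ)

lemma charInf_neg_smul (μ : F) (x : Fin n → F) (ξ : Fin n → mixedSpace F) :
    charInf (-(mixedEmbedding F μ * rowForm x ξ)) =
      Complex.exp (2 * Real.pi * Complex.I * (pairing (emb (μ • x)) ξ : ℂ)) := by
  rw [charInf, traceInf_neg, pairing, rowForm_apply, Finset.mul_sum, traceInf_sum, emb_smul]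
  simp only [Pi.smul_apply, smul_eq_mul, mul_assoc]
  push_cast
  ring_nf

-- Substituting `(μ) = 𝔫𝔡⁻¹𝔠⁻¹` with `𝔠 = 𝔟⁻¹𝔪𝔞_{n+1}` removes `μ`: the powers of `N𝔟` cancel, and
-- exactly `N𝔪^{-κ}` and `N𝔞_{n+1}^{-κ}` survive.
set_option maxHeartbeats 1000000 in
theorem headSum_eq_bessel (hs : 1 < s.re) (hD : IsFundDomain a D)
    (hu : u ∈ primVec (sumLattice (dualIdeals a)) (toFrac k)⁻¹) (p : HeadIndex a b) {μ : F}
    (hμ : μ ≠ 0) (h : u = μ • repVec p.2) :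
    (fnorm b : ℂ) ^ (-(((n : ℂ) + 1) * s)) * (detPow g₁ s *
      (((volume D).toReal : ℂ)⁻¹ * headSum D g₁ xn s (emb u) p)) =
    besselConst F (a (Fin.last n)) (((n : ℂ) + 1) * s) *
      (idealNorm (toFrac k * (different F)⁻¹) ^ (((n : ℂ) + 1) * s - 1) *
      (ramanujanSum p.1 (toFrac k * (different F)⁻¹) /
        idealNorm (toFrac p.1) ^ (((n : ℂ) + 1) * s)) * besselTerm g₁ xn s (emb u)) := by
  have hstep := princ_mul_stepIdeal hu p hμ h
  have hint := integral_headRad_charInf (g₁ := g₁) hs p hμ h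
  have hμ' : μ • repVec p.2 ∈ sumLattice (dualIdeals a) := h ▸ hu.1
  have hle : ((princ μ hμ * stepIdeal a b p.1 : Frac F) : FractionalIdeal (𝓞 F)⁰ F) ≤
      (((different F)⁻¹ : Frac F) : FractionalIdeal (𝓞 F)⁰ F) := by
    rw [hstep, Units.val_mul]
    calc _ ≤ 1 * (((different F)⁻¹ : Frac F) : FractionalIdeal (𝓞 F)⁰ F) := by
          gcongr
          exact toFrac_le_one k
      _ = _ := one_mul _
  have h1 := headSum_of_eq (g₁ := g₁) (xn := xn) hs hD p hμ'
  rw [← ramanujanSum_princ_mul hμ _ _ hle, hstep, charInf_neg_smul, ← h] at h1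
  have hprinc : princ μ hμ = toFrac k * (different F)⁻¹ * (stepIdeal a b p.1)⁻¹ := by
    rw [← hstep, mul_inv_cancel_right]
  set κ : ℂ := ((n : ℂ) + 1) * s with hκ
  have hnorm : (fnorm (princ μ hμ) : ℂ) ^ (κ - 1) = (fnorm (toFrac k * (different F)⁻¹) : ℂ) ^ (κ - 1) *
      ((fnorm b : ℂ) ^ (κ - 1) * (fnorm (toFrac p.1 : Frac F) : ℂ) ^ (-(κ - 1)) *
        (fnorm (a (Fin.last n)) : ℂ) ^ (-(κ - 1))) := by
    rw [hprinc, fnorm_mul_cpow (toFrac k * (different F)⁻¹) _, fnorm_inv_cpow, stepIdeal,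
      fnorm_mul_cpow (b⁻¹ * toFrac p.1) _, fnorm_mul_cpow b⁻¹ _, fnorm_inv_cpow b, neg_neg]
  have hcpow (c : Frac F) (w : ℂ) : (fnorm c : ℂ) ^ w ≠ 0 := by
    rw [Ne, Complex.cpow_eq_zero_iff]
    exact fun h => fnorm_ne_zero c h.1
  have hV := volume_toReal_ne_zero hD
  have h2 : (2 : ℂ) ^ nrComplexPlaces F ≠ 0 := pow_ne_zero _ two_ne_zero
  have hI : ∫ w, headRad g₁ s p w * charInf (mixedEmbedding F μ * w) =
      ((2 : ℂ) ^ nrComplexPlaces F)⁻¹ * ((2 : ℂ) ^ nrComplexPlaces F *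
        ∫ w, headRad g₁ s p w * charInf (mixedEmbedding F μ * w)) := by
    rw [inv_mul_cancel_left₀ h2]
  rw [h1, hI, hint, hnorm, besselTerm, besselConst, Finset.prod_div_distrib, ← detPow, idealCovol,
    idealNorm_eq, idealNorm_eq, idealNorm_eq, stepIdeal, fnorm_mul, fnorm_mul, fnorm_inv,
    Complex.cpow_neg _ κ, Complex.cpow_neg _ (κ - 1), Complex.cpow_neg _ (κ - 1),
    Complex.cpow_sub _ _ (fnorm_ne_zero b), Complex.cpow_sub _ _ (fnorm_ne_zero (a (Fin.last n))),
    Complex.cpow_sub _ _ (fnorm_ne_zero (toFrac p.1 : Frac F)), Complex.cpow_one, Complex.cpow_one,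
    Complex.cpow_one]
  have e1 := hcpow b κ
  have e2 := hcpow (toFrac p.1) κ
  have e3 := hcpow (a (Fin.last n)) κ
  have e4 := fnorm_ne_zero b
  have e5 := fnorm_ne_zero (toFrac p.1 : Frac F)
  have e6 := fnorm_ne_zero (a (Fin.last n))
  push_cast
  rw [inv_pow, ← hκ]
  generalize gammaF F κ = G
  generalize (∏ σ : InfinitePlace F, (rowNorms g₁ (emb u) σ : ℂ) ^ ((σ.mult / 2 : ℂ) * (κ - 1))) = R
  generalize besselKF (κ - 1) (fun σ => 2 * Real.pi * σ.mult * rowNorms g₁ (emb u) σ) = K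
  generalize (2 : ℂ) ^ ((Module.finrank ℚ F : ℂ) + nrComplexPlaces F * (κ - 1)) = C₁
  generalize (Real.pi : ℂ) ^ ((Module.finrank ℚ F : ℂ) * κ / 2) = C₂
  field_simp

lemma summable_headSum (hn : n ≠ 0) (hs : 1 < s.re) (hD : IsFundDomain a D)
    (ν : Fin n → mixedSpace F) : Summable fun p : HeadIndex a b => headSum D g₁ xn s ν p := by
  refine Summable.of_norm_bounded (summable_totient_headRad (g₁ := g₁) (a := a) (b := b) hn hs
    (volume D).toReal ENNReal.toReal_nonneg) fun p => ?_
  obtain ⟨-, h⟩ := hasSum_unitVecs_norm hD (repVec_mem p.2).2.1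
    (contentInv_mul_eq_stepIdeal (repVec_mem p.2)) p.1 (integrable_headRad (g₁ := g₁) hs p) ν
    (rowForm (repVec p.2) xn)
  exact tsum_of_norm_bounded h fun y => norm_integral_le_integral_norm _

/-- The summand `τ(𝔪, 𝔫𝔡⁻¹) / N𝔪^κ`. -/
def tauTerm (k : (Ideal (𝓞 F))⁰) (κ : ℂ) (m : (Ideal (𝓞 F))⁰) : ℂ :=
  ramanujanSum m (toFrac k * (different F)⁻¹) / idealNorm (toFrac m) ^ κ

lemma smul_ne_zero_of_primVec (hu : u ∈ primVec (sumLattice (dualIdeals a)) (toFrac k)⁻¹) {μ : F}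
    {x : Fin n → F} (e : u = μ • x) : μ ≠ 0 := by
  rintro rfl
  exact hu.2.1 (e.trans (zero_smul _ _))

lemma tsum_headSum_of_ne (hs : 1 < s.re) (hD : IsFundDomain a D)
    (hu : u ∈ primVec (sumLattice (dualIdeals a)) (toFrac k)⁻¹) {m : (Ideal (𝓞 F))⁰}
    (hm : ClassGroup.mk0 m ≠ idealClass (b * (a (Fin.last n))⁻¹ * toFrac k * (different F)⁻¹)) :
    ∑' q : primOrbits (sumLattice fun i : Fin n => a i.castSucc) (b * (toFrac m)⁻¹),
      headSum D g₁ xn s (emb u) (⟨m, q⟩ : HeadIndex a b) = 0 := by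
  have h (q : primOrbits (sumLattice fun i : Fin n => a i.castSucc) (b * (toFrac m)⁻¹)) :
      headSum D g₁ xn s (emb u) (⟨m, q⟩ : HeadIndex a b) = 0 :=
    headSum_of_ne hs hD _ hu.1 fun ⟨μ, e⟩ =>
      hm (idealClass_head hu ⟨m, q⟩ (smul_ne_zero_of_primVec hu e) e)
  rw [tsum_congr h, tsum_zero]

lemma tsum_headSum_of_eq (hb : (1 : F) ∈ (b : FractionalIdeal (𝓞 F)⁰ F)) (hs : 1 < s.re)
    (hD : IsFundDomain a D)
    (hu : u ∈ primVec (sumLattice (dualIdeals a)) (toFrac k)⁻¹) {m : (Ideal (𝓞 F))⁰}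
    (hm : ClassGroup.mk0 m = idealClass (b * (a (Fin.last n))⁻¹ * toFrac k * (different F)⁻¹)) :
    (fnorm b : ℂ) ^ (-(((n : ℂ) + 1) * s)) * (detPow g₁ s * (((volume D).toReal : ℂ)⁻¹ *
      ∑' q : primOrbits (sumLattice fun i : Fin n => a i.castSucc) (b * (toFrac m)⁻¹),
        headSum D g₁ xn s (emb u) (⟨m, q⟩ : HeadIndex a b))) =
      besselConst F (a (Fin.last n)) (((n : ℂ) + 1) * s) *
      (idealNorm (toFrac k * (different F)⁻¹) ^ (((n : ℂ) + 1) * s - 1) *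
      tauTerm k (((n : ℂ) + 1) * s) m * besselTerm g₁ xn s (emb u)) := by
  obtain ⟨q, μ, hμ, e⟩ := exists_head hb hu hm
  have h (q' : primOrbits (sumLattice fun i : Fin n => a i.castSucc) (b * (toFrac m)⁻¹))
      (hq' : q' ≠ q) : headSum D g₁ xn s (emb u) (⟨m, q'⟩ : HeadIndex a b) = 0 :=
    headSum_of_ne hs hD _ hu.1 fun ⟨μ', e'⟩ => hq' (head_unique hu e' e)
  rw [tsum_eq_single q h]
  exact headSum_eq_bessel hs hD hu ⟨m, q⟩ hμ e

theorem fourierCoeff_eq_bessel (hn : n ≠ 0) (hb : (1 : F) ∈ (b : FractionalIdeal (𝓞 F)⁰ F))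
    (hs : 1 < s.re) (hD : IsFundDomain a D) (h : IsCorner g.1 g₁.1 xn)
    (hu : u ∈ primVec (sumLattice (dualIdeals a)) (toFrac k)⁻¹) :
    fourierCoeff D (fun z => eisClass (sumLattice a) (idealClass b) z s) (emb u)
      (QuotientGroup.mk g) =
    partialZeta (idealClass b⁻¹) (((n : ℂ) + 1) * s) *
      (besselConst F (a (Fin.last n)) (((n : ℂ) + 1) * s) *
      (idealNorm (toFrac k * (different F)⁻¹) ^ (((n : ℂ) + 1) * s - 1) *
      (∑' m : {m : (Ideal (𝓞 F))⁰ // ClassGroup.mk0 m =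
        idealClass (b * (a (Fin.last n))⁻¹ * toFrac k * (different F)⁻¹)},
        tauTerm k (((n : ℂ) + 1) * s) m.1) * besselTerm g₁ xn s (emb u))) := by
  rw [(fourierCoeff_eisClass hn hb hs hD h (emb u)).2, integral_charV_eq_zero hD hu.1 hu.2.1,
    mul_zero, mul_zero, zero_add, tsum_mul_left]
  have hsum : ∑' p : HeadIndex a b, headSum D g₁ xn s (emb u) p = ∑' (m : (Ideal (𝓞 F))⁰)
      (q : primOrbits (sumLattice fun i : Fin n => a i.castSucc) (b * (toFrac m)⁻¹)),
        headSum D g₁ xn s (emb u) (⟨m, q⟩ : HeadIndex a b) :=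
    (summable_headSum (b := b) (g₁ := g₁) (xn := xn) hn hs hD (emb u)).tsum_sigma
  rw [hsum]
  congr 1
  rw [← tsum_subtype_eq_of_support_subset (s := {m : (Ideal (𝓞 F))⁰ | ClassGroup.mk0 m =
    idealClass (b * (a (Fin.last n))⁻¹ * toFrac k * (different F)⁻¹)}) fun m hm =>
      by_contra fun hcl => hm (tsum_headSum_of_ne hs hD hu hcl), ← tsum_mul_left, ← tsum_mul_left,
    ← tsum_mul_left]
  refine (tsum_congr fun m => tsum_headSum_of_eq hb hs hD hu m.2).trans ?_
  rw [tsum_mul_left, tsum_mul_right, tsum_mul_left]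
  rfl

end Nonconstant

/-! ### Summability of the non-constant terms -/

/-- The Bessel bound contributes `r^{-m Re(w)/2}` and the denominator the same power again. The
decay is weakened to `e^{-r}`, which is allowed because `πm ≥ 1`. -/
lemma exists_besselK_div_le {m : ℕ} (hm : 0 < m) {w : ℂ} (hw : 0 < w.re) :
    ∃ C : ℝ, 0 ≤ C ∧ ∀ r : ℝ, 0 < r →
      ‖besselK (m * w / 2) (2 * Real.pi * m * r)‖ / ‖(r : ℂ) ^ ((m / 2 : ℂ) * w)‖ ≤
        C * ((r ^ m) ^ (-w.re) * Real.exp (-r)) := by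
  have hm' : (1 : ℝ) ≤ m := by exact_mod_cast hm
  have hre : ((m : ℂ) * w / 2).re = m / 2 * w.re := by
    rw [show (m : ℂ) * w / 2 = ((m / 2 : ℝ) : ℂ) * w by push_cast; ring, Complex.re_ofReal_mul]
  have hre' : ((m / 2 : ℂ) * w).re = m / 2 * w.re := by
    rw [← hre]
    congr 1
    ring
  have hpos : 0 < (m : ℝ) / 2 * w.re := by positivity
  set e : ℝ := m / 2 * w.re with he
  have hpi := Real.pi_gt_three
  have hG := Real.Gamma_pos_of_pos hpos
  refine ⟨(1 / 2 * 4 ^ e * Real.Gamma e) * (2 * Real.pi * m) ^ (-e), by positivity, fun r hr => ?_⟩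
  have h1 := norm_besselK_le (s := m * w / 2) (by rw [hre]; exact hpos)
    (x := 2 * Real.pi * m * r) (by positivity)
  rw [hre, Real.mul_rpow (by positivity) hr.le] at h1
  rw [Complex.norm_cpow_eq_rpow_re_of_pos hr, hre', div_le_iff₀ (Real.rpow_pos_of_pos hr _)]
  refine h1.trans ?_
  have h2 : (r ^ m) ^ (-w.re) * r ^ e = r ^ (-e) := by
    rw [← Real.rpow_natCast r m, ← Real.rpow_mul hr.le, ← Real.rpow_add hr]
    congr 1
    rw [he]
    ring
  have h3 : Real.exp (-(2 * Real.pi * m * r) / 2) ≤ Real.exp (-r) := by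
    refine Real.exp_le_exp.mpr ?_
    have : 1 * r ≤ Real.pi * m * r := by
      gcongr
      nlinarith
    linarith
  calc _ ≤ 1 / 2 * 4 ^ e * Real.Gamma e * ((2 * Real.pi * m) ^ (-e) * r ^ (-e)) *
        Real.exp (-r) := by gcongr
    _ = _ := by
      rw [← h2]
      ring

section Summability

variable {a : Fin (n + 1) → Frac F} {b : Frac F} {D : Set (Fin n → mixedSpace F)}
  {g : GL (Fin (n + 1)) (mixedSpace F)}
  (g₁ : GL (Fin n) (mixedSpace F)) (xn : Fin n → mixedSpace F) {s : ℂ}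

lemma exists_norm_besselTerm_le (hs : 1 < s.re) :
    ∃ C : ℝ, 0 ≤ C ∧ ∀ v : Fin n → mixedSpace F, (∀ σ, 0 < rowNorms g₁ v σ) →
      ‖besselTerm g₁ xn s v‖ ≤ C * ((∏ σ : InfinitePlace F, rowNorms g₁ v σ ^ σ.mult) ^
        (-((((n : ℂ) + 1) * s).re - 1)) * Real.exp (-∑ σ, rowNorms g₁ v σ)) := by
  have hκ := one_lt_re (n := n) hs
  set κ : ℂ := ((n : ℂ) + 1) * s with hκdef
  have hre : (κ - 1).re = κ.re - 1 := by simp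
  choose C hC h using fun σ : InfinitePlace F =>
    exists_besselK_div_le (m := σ.mult) mult_pos (w := κ - 1) (by rw [hre]; linarith)
  refine ⟨‖gammaF F κ‖⁻¹ * ‖detPow g₁ s‖ * ∏ σ, C σ, ?_, fun v hv => ?_⟩
  · have := Finset.prod_nonneg fun σ (_ : σ ∈ Finset.univ) => hC σ
    positivity
  · have h1 : ‖Complex.exp (2 * Real.pi * Complex.I * (pairing v xn : ℂ))‖ = 1 := by
      rw [show 2 * (Real.pi : ℂ) * Complex.I * (pairing v xn : ℂ) =
        ((2 * Real.pi * pairing v xn : ℝ) : ℂ) * Complex.I by push_cast; ring,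
        Complex.norm_exp_ofReal_mul_I]
    have h2 : ∏ σ : InfinitePlace F, (‖besselK (σ.mult * (κ - 1) / 2)
        (2 * Real.pi * σ.mult * rowNorms g₁ v σ)‖ /
        ‖(rowNorms g₁ v σ : ℂ) ^ ((σ.mult / 2 : ℂ) * (κ - 1))‖) ≤
        (∏ σ, C σ) * ((∏ σ : InfinitePlace F, rowNorms g₁ v σ ^ σ.mult) ^ (-(κ.re - 1)) *
          Real.exp (-∑ σ, rowNorms g₁ v σ)) := by
      refine (Finset.prod_le_prod (fun σ _ => by positivity) fun σ _ => h σ _ (hv σ)).trans ?_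
      rw [Finset.prod_mul_distrib, Finset.prod_mul_distrib, hre,
        Real.finsetProd_rpow _ _ fun σ _ => pow_nonneg (hv σ).le _, ← Finset.sum_neg_distrib,
        Real.exp_sum]
    rw [besselTerm, ← hκdef, Finset.prod_div_distrib, ← detPow, norm_mul, norm_mul, h1, one_mul, norm_div,
      norm_div, besselKF, norm_prod, norm_prod]
    rw [Finset.prod_div_distrib] at h2
    calc _ = ‖gammaF F κ‖⁻¹ * ‖detPow g₁ s‖ * ((∏ σ : InfinitePlace F, ‖besselK (σ.mult * (κ - 1) / 2)
        (2 * Real.pi * σ.mult * rowNorms g₁ v σ)‖) /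
        ∏ σ : InfinitePlace F, ‖(rowNorms g₁ v σ : ℂ) ^ ((σ.mult / 2 : ℂ) * (κ - 1))‖) := by ring
      _ ≤ _ := by
        rw [mul_assoc _ (∏ σ, C σ)]
        gcongr

lemma rowNorms_emb_pos {u : Fin n → F} (hu : u ≠ 0) (σ : InfinitePlace F) :
    0 < rowNorms g₁ (emb u) σ := rowNorm_pos g₁ hu σ

/-- The ideal `u_i 𝔞_i⁻¹` lies inside the content ideal `𝔨`, so the quotient is integral and has
norm at least one. -/
lemma fnorm_toFrac_le {a : Fin n → Frac F} {k : (Ideal (𝓞 F))⁰} {u : Fin n → F}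
    (hu : u ∈ primVec (sumLattice a) (toFrac k)⁻¹) {i : Fin n} (hi : u i ≠ 0) :
    fnorm (toFrac k : Frac F) ≤ fnorm (princ (u i) hi) * (fnorm (a i))⁻¹ := by
  have h1 := (mem_primVec_toFrac_inv.mp hu).2
  have h2 : ((princ (u i) hi * (a i)⁻¹ : Frac F) : FractionalIdeal (𝓞 F)⁰ F) ≤
      ((toFrac k : Frac F) : FractionalIdeal (𝓞 F)⁰ F) := by
    rw [← h1, contentInv, Units.val_mul, coe_princ]
    exact (sum_le_iff (F := F) Finset.univ (fun i => FractionalIdeal.spanSingleton (𝓞 F)⁰ (u i) *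
      ((a i)⁻¹ : Frac F)) _).mp le_rfl i (Finset.mem_univ _)
  obtain ⟨j, hj⟩ := (exists_toFrac_iff _).mpr ((le_iff_mul_inv_le_one _ _).mp h2)
  have h3 := one_le_fnorm_toFrac j
  rw [← hj, fnorm_mul, fnorm_mul, fnorm_inv, fnorm_inv, ← div_eq_mul_inv,
    one_le_div (fnorm_pos _)] at h3
  exact h3

lemma exists_fnorm_toFrac_le (a : Fin n → Frac F) :
    ∃ C : ℝ, 0 < C ∧ ∀ (k : (Ideal (𝓞 F))⁰) (u : Fin n → F),
      u ∈ primVec (sumLattice a) (toFrac k)⁻¹ → fnorm (toFrac k : Frac F) ≤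
        C * ∏ σ : InfinitePlace F, rowNorms g₁ (emb u) σ ^ σ.mult := by
  obtain ⟨C, hC, h⟩ := exists_normAtPlace_le g₁
  have hA : 0 ≤ ∑ i, (fnorm (a i))⁻¹ := Finset.sum_nonneg fun i _ => (inv_pos.mpr (fnorm_pos _)).le
  have hB : 0 < ∏ σ : InfinitePlace F, C ^ σ.mult := Finset.prod_pos fun σ _ => pow_pos hC _
  refine ⟨(∏ σ : InfinitePlace F, C ^ σ.mult) * (1 + ∑ i, (fnorm (a i))⁻¹), by positivity,
    fun k u hu => ?_⟩
  obtain ⟨i, hi⟩ := Function.ne_iff.mp hu.2.1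
  have h1 : fnorm (princ (u i) hi) ≤ (∏ σ : InfinitePlace F, C ^ σ.mult) *
      ∏ σ : InfinitePlace F, rowNorms g₁ (emb u) σ ^ σ.mult := by
    rw [fnorm_princ, ← Finset.prod_mul_distrib]
    refine Finset.prod_le_prod (fun σ _ => by positivity) fun σ _ => ?_
    rw [← mul_pow]
    refine pow_le_pow_left₀ (apply_nonneg σ _) ?_ _
    have := h (emb u) σ i
    rwa [emb, normAtPlace_apply] at this
  have h2 : (fnorm (a i))⁻¹ ≤ 1 + ∑ i, (fnorm (a i))⁻¹ := by
    have := Finset.single_le_sum (f := fun i => (fnorm (a i))⁻¹)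
      (fun i _ => (inv_pos.mpr (fnorm_pos (a i))).le) (Finset.mem_univ i)
    linarith
  calc _ ≤ fnorm (princ (u i) hi) * (fnorm (a i))⁻¹ := fnorm_toFrac_le hu hi
    _ ≤ ((∏ σ : InfinitePlace F, C ^ σ.mult) *
      ∏ σ : InfinitePlace F, rowNorms g₁ (emb u) σ ^ σ.mult) * (1 + ∑ i, (fnorm (a i))⁻¹) :=
        mul_le_mul h1 h2 (inv_pos.mpr (fnorm_pos _)).le ((fnorm_pos _).le.trans h1)
    _ = _ := by ring

lemma exists_norm_le_sum_rowNorms :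
    ∃ C : ℝ, 0 < C ∧ ∀ v : Fin n → mixedSpace F, ‖v‖ ≤ C * ∑ σ, rowNorms g₁ v σ := by
  obtain ⟨C, hC, h⟩ := exists_normAtPlace_le g₁
  refine ⟨C, hC, fun v => ?_⟩
  have h0 (σ : InfinitePlace F) : 0 ≤ rowNorms g₁ v σ := rowNorm_nonneg _ _
  refine norm_le_of_normAtPlace_le (mul_nonneg hC.le (Finset.sum_nonneg fun σ _ => h0 σ))
    fun i σ => (h v σ i).trans ?_
  refine mul_le_mul_of_nonneg_left ?_ hC.le
  exact Finset.single_le_sum (f := fun σ => rowNorms g₁ v σ) (fun σ _ => h0 σ) (Finset.mem_univ σ)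

/-- From `y^R/R! ≤ e^y`: exponential decay in the row norms becomes arbitrary polynomial decay in
the lattice vector. -/
lemma exp_neg_le_rpow {x C y : ℝ} (hC : 0 < C) (hx : 0 < x) (hxy : x ≤ C * y) (R : ℕ) :
    Real.exp (-y) ≤ (R.factorial * C ^ R : ℝ) * x ^ (-(R : ℝ)) := by
  have hy : 0 < y := pos_of_mul_pos_right (hx.trans_le hxy) hC.le
  have h1 := Real.pow_div_factorial_le_exp y hy.le R
  have h2 : (0 : ℝ) < R.factorial := by exact_mod_cast R.factorial_pos
  rw [Real.rpow_neg hx.le, Real.rpow_natCast, ← div_eq_mul_inv, Real.exp_neg, le_div_iff₀ (by positivity),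
    inv_mul_le_iff₀ (Real.exp_pos _)]
  rw [div_le_iff₀ h2] at h1
  calc x ^ R ≤ (C * y) ^ R := pow_le_pow_left₀ hx.le hxy _
    _ = C ^ R * y ^ R := mul_pow _ _ _
    _ ≤ C ^ R * (Real.exp y * R.factorial) := by gcongr
    _ = _ := by ring

/-- With `P` the product of the row norms, `N𝔨 ≤ C P`. The growing factor `N𝔨^{κ-1}` is thus
absorbed by the `P^{-(κ-1)}` of the Bessel term, and the exponential remains for convergence. -/
lemma exists_fnorm_mul_besselTerm_le (a : Fin n → Frac F) (hs : 1 < s.re) (R : ℕ) :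
    ∃ C : ℝ, 0 ≤ C ∧ ∀ (k : (Ideal (𝓞 F))⁰) (u : Fin n → F),
      u ∈ primVec (sumLattice a) (toFrac k)⁻¹ →
      fnorm (toFrac k : Frac F) ^ ((((n : ℂ) + 1) * s).re - 1) * ‖besselTerm g₁ xn s (emb u)‖ ≤
        C * ‖emb u‖ ^ (-(R : ℝ)) := by
  obtain ⟨C₁, hC₁, h₁⟩ := exists_norm_besselTerm_le g₁ xn hs
  obtain ⟨C₂, hC₂, h₂⟩ := exists_fnorm_toFrac_le g₁ a
  obtain ⟨C₃, hC₃, h₃⟩ := exists_norm_le_sum_rowNorms g₁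
  have hκ := one_lt_re (n := n) hs
  set t : ℝ := (((n : ℂ) + 1) * s).re - 1 with ht
  have ht0 : 0 ≤ t := by linarith
  refine ⟨C₂ ^ t * C₁ * (R.factorial * C₃ ^ R), by positivity, fun k u hu => ?_⟩
  have hr := rowNorms_emb_pos g₁ hu.2.1
  have hP : 0 < ∏ σ : InfinitePlace F, rowNorms g₁ (emb u) σ ^ σ.mult :=
    Finset.prod_pos fun σ _ => pow_pos (hr σ) _
  set P := ∏ σ : InfinitePlace F, rowNorms g₁ (emb u) σ ^ σ.mult with hPdef
  have hu0 : 0 < ‖emb u‖ := norm_pos_iff.mpr fun h => hu.2.1 (emb_eq_zero_iff.mp h)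
  have h4 : P ^ t * P ^ (-t) = 1 := by
    rw [← Real.rpow_add hP, add_neg_cancel, Real.rpow_zero]
  calc fnorm (toFrac k : Frac F) ^ t * ‖besselTerm g₁ xn s (emb u)‖
      ≤ (C₂ * P) ^ t * (C₁ * (P ^ (-t) * Real.exp (-∑ σ, rowNorms g₁ (emb u) σ))) := by
        refine mul_le_mul (Real.rpow_le_rpow (fnorm_pos _).le (h₂ k u hu) ht0) (h₁ _ hr)
          (norm_nonneg _) (by positivity)
    _ = C₂ ^ t * C₁ * Real.exp (-∑ σ, rowNorms g₁ (emb u) σ) := by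
        rw [Real.mul_rpow hC₂.le hP.le]
        linear_combination C₂ ^ t * C₁ * Real.exp (-∑ σ, rowNorms g₁ (emb u) σ) * h4
    _ ≤ C₂ ^ t * C₁ * ((R.factorial * C₃ ^ R) * ‖emb u‖ ^ (-(R : ℝ))) := by
        gcongr
        exact exp_neg_le_rpow hC₃ hu0 (h₃ _) R
    _ = _ := by ring

lemma summable_fnorm_mul_besselTerm (a : Fin (n + 1) → Frac F) (hs : 1 < s.re) :
    Summable fun p : (k : (Ideal (𝓞 F))⁰) × dualPrimVec a (toFrac k)⁻¹ =>
      fnorm (toFrac p.1 : Frac F) ^ ((((n : ℂ) + 1) * s).re - 1) * ‖besselTerm g₁ xn s p.2.1‖ := by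
  obtain ⟨C, hC, h⟩ := exists_fnorm_mul_besselTerm_le g₁ xn (dualIdeals a) hs
    -- One more than the rank of the lattice is enough decay for a convergent lattice sum.
    (n * Module.finrank ℚ F + 1)
  have hmem (p : (k : (Ideal (𝓞 F))⁰) × dualPrimVec a (toFrac k)⁻¹) :
      p.2.1 ∈ vecLattice (dualIdeals a) := mem_vecLattice.mpr (mem_dualLattice.mp p.2.2.1)
  have hinj : Function.Injective fun p : (k : (Ideal (𝓞 F))⁰) × dualPrimVec a (toFrac k)⁻¹ =>
      (⟨p.2.1, hmem p⟩ : vecLattice (dualIdeals a)) := by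
    intro p q hpq
    refine (dualEquiv a).injective (Subtype.ext ?_)
    exact congrArg (fun v : vecLattice (dualIdeals a) => v.1) hpq
  refine Summable.of_nonneg_of_le (fun p => ?_) (fun p => ?_)
    (((summable_norm_vecLattice (dualIdeals a) (r := -((n * Module.finrank ℚ F + 1 : ℕ) : ℝ))
      (by push_cast; linarith)).comp_injective hinj).mul_left C)
  · exact mul_nonneg (Real.rpow_nonneg (fnorm_pos _).le _) (norm_nonneg _)
  · obtain ⟨x, hx, e⟩ := mem_dualPrimVec.mp p.2.2
    have h1 := h p.1 x hx
    rw [e] at h1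
    exact h1

lemma summable_besselTerm (a : Fin (n + 1) → Frac F) (hs : 1 < s.re) :
    Summable fun p : (k : (Ideal (𝓞 F))⁰) × dualPrimVec a (toFrac k)⁻¹ =>
      besselTerm g₁ xn s p.2.1 := by
  refine Summable.of_norm_bounded (summable_fnorm_mul_besselTerm g₁ xn a hs) fun p => ?_
  refine le_mul_of_one_le_left (norm_nonneg _) (Real.one_le_rpow (one_le_fnorm_toFrac _) ?_)
  have := one_lt_re (n := n) hs
  linarith

lemma norm_tauTerm_le (k m : (Ideal (𝓞 F))⁰) (κ : ℂ) :
    ‖tauTerm k κ m‖ ≤ fnorm (toFrac m : Frac F) ^ (-(κ.re - 1)) := by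
  have h := fnorm_pos (toFrac m : Frac F)
  rw [tauTerm, norm_div, norm_idealNorm_cpow, div_le_iff₀ (Real.rpow_pos_of_pos h _),
    ← Real.rpow_add h, show -(κ.re - 1) + κ.re = 1 by ring, Real.rpow_one]
  exact (norm_ramanujanSum_le _ _).trans (totient_le m)

lemma summable_tauTerm (k : (Ideal (𝓞 F))⁰) {κ : ℂ} (hκ : 1 < κ.re - 1) (p : (Ideal (𝓞 F))⁰ → Prop) :
    Summable fun m : {m // p m} => tauTerm k κ m.1 :=
  Summable.of_norm_bounded ((summable_fnorm_toFrac F hκ).subtype p) fun m => norm_tauTerm_le k m.1 κ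

lemma norm_tsum_tauTerm_le (k : (Ideal (𝓞 F))⁰) {κ : ℂ} (hκ : 1 < κ.re - 1)
    (p : (Ideal (𝓞 F))⁰ → Prop) :
    ‖∑' m : {m // p m}, tauTerm k κ m.1‖ ≤
      ∑' m : (Ideal (𝓞 F))⁰, fnorm (toFrac m : Frac F) ^ (-(κ.re - 1)) := by
  have hs := summable_fnorm_toFrac F hκ
  refine (tsum_of_norm_bounded (hs.subtype p).hasSum fun m => norm_tauTerm_le k m.1 κ).trans ?_
  exact hs.tsum_subtype_le _ _ fun m => Real.rpow_nonneg (fnorm_pos _).le _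

lemma one_lt_re_sub (hn : n ≠ 0) (hs : 1 < s.re) : 1 < (((n : ℂ) + 1) * s).re - 1 := by
  have h := one_lt_exponent hn hs
  have hn' : (1 : ℝ) ≤ n := by exact_mod_cast Nat.one_le_iff_ne_zero.mpr hn
  rw [lt_div_iff₀ (by linarith)] at h
  linarith

lemma summable_nonconstant (hn : n ≠ 0) (a : Fin (n + 1) → Frac F) (hs : 1 < s.re)
    (p : (Ideal (𝓞 F))⁰ → (Ideal (𝓞 F))⁰ → Prop) :
    Summable fun q : (k : (Ideal (𝓞 F))⁰) × dualPrimVec a (toFrac k)⁻¹ =>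
      idealNorm (toFrac q.1 * (different F)⁻¹) ^ (((n : ℂ) + 1) * s - 1) *
      (∑' m : {m // p q.1 m}, tauTerm q.1 (((n : ℂ) + 1) * s) m.1) * besselTerm g₁ xn s q.2.1 := by
  have hκ := one_lt_re_sub hn hs
  refine Summable.of_norm_bounded ((summable_fnorm_mul_besselTerm g₁ xn a hs).mul_left
    ((fnorm (different F))⁻¹ ^ ((((n : ℂ) + 1) * s).re - 1) *
    ∑' m : (Ideal (𝓞 F))⁰, fnorm (toFrac m : Frac F) ^ (-((((n : ℂ) + 1) * s).re - 1)))) fun q => ?_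
  rw [norm_mul, norm_mul, norm_idealNorm_cpow, Complex.sub_re, Complex.one_re, fnorm_mul, fnorm_inv,
    Real.mul_rpow (fnorm_pos _).le (inv_pos.mpr (fnorm_pos _)).le]
  have h1 := norm_tsum_tauTerm_le q.1 hκ (p q.1)
  have h2 := fnorm_pos (toFrac q.1 : Frac F)
  have h3 := fnorm_pos (different F)
  calc _ ≤ fnorm (toFrac q.1 : Frac F) ^ ((((n : ℂ) + 1) * s).re - 1) *
        (fnorm (different F))⁻¹ ^ ((((n : ℂ) + 1) * s).re - 1) *
        (∑' m : (Ideal (𝓞 F))⁰, fnorm (toFrac m : Frac F) ^ (-((((n : ℂ) + 1) * s).re - 1))) *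
        ‖besselTerm g₁ xn s q.2.1‖ := by gcongr
    _ = _ := by ring

/-- Sorting the non-zero frequencies by content is an absolutely convergent rearrangement. The sum
over `𝔪` depends on the content alone, so it leaves the inner sum over `ν`. -/
theorem tsum_fourierCoeff (hn : n ≠ 0) (hb : (1 : F) ∈ (b : FractionalIdeal (𝓞 F)⁰ F))
    (hs : 1 < s.re) (hD : IsFundDomain a D) (h : IsCorner g.1 g₁.1 xn) :
    (Summable fun ν : {ν // ν ∈ dualLattice a ∧ ν ≠ 0} => fourierCoeff D
      (fun z => eisClass (sumLattice a) (idealClass b) z s) ν.1 (QuotientGroup.mk g)) ∧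
    (Summable fun k : (Ideal (𝓞 F))⁰ =>
      idealNorm (toFrac k * (different F)⁻¹) ^ (((n : ℂ) + 1) * s - 1) *
      (∑' m : {m : (Ideal (𝓞 F))⁰ // ClassGroup.mk0 m =
        idealClass (b * (a (Fin.last n))⁻¹ * toFrac k * (different F)⁻¹)},
        tauTerm k (((n : ℂ) + 1) * s) m.1) *
      ∑' ν : dualPrimVec a (toFrac k)⁻¹, besselTerm g₁ xn s ν.1) ∧
    ∑' ν : {ν // ν ∈ dualLattice a ∧ ν ≠ 0}, fourierCoeff D
      (fun z => eisClass (sumLattice a) (idealClass b) z s) ν.1 (QuotientGroup.mk g) =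
    partialZeta (idealClass b⁻¹) (((n : ℂ) + 1) * s) *
      (besselConst F (a (Fin.last n)) (((n : ℂ) + 1) * s) * ∑' k : (Ideal (𝓞 F))⁰,
      idealNorm (toFrac k * (different F)⁻¹) ^ (((n : ℂ) + 1) * s - 1) *
      (∑' m : {m : (Ideal (𝓞 F))⁰ // ClassGroup.mk0 m =
        idealClass (b * (a (Fin.last n))⁻¹ * toFrac k * (different F)⁻¹)},
        tauTerm k (((n : ℂ) + 1) * s) m.1) *
      ∑' ν : dualPrimVec a (toFrac k)⁻¹, besselTerm g₁ xn s ν.1) := by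
  have hsum := summable_nonconstant g₁ xn hn a hs fun k m => ClassGroup.mk0 m =
    idealClass (b * (a (Fin.last n))⁻¹ * toFrac k * (different F)⁻¹)
  have hval (q : (k : (Ideal (𝓞 F))⁰) × dualPrimVec a (toFrac k)⁻¹) : fourierCoeff D
      (fun z => eisClass (sumLattice a) (idealClass b) z s) (dualEquiv a q).1 (QuotientGroup.mk g) =
      partialZeta (idealClass b⁻¹) (((n : ℂ) + 1) * s) *
      (besselConst F (a (Fin.last n)) (((n : ℂ) + 1) * s) *
      (idealNorm (toFrac q.1 * (different F)⁻¹) ^ (((n : ℂ) + 1) * s - 1) *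
      (∑' m : {m : (Ideal (𝓞 F))⁰ // ClassGroup.mk0 m =
        idealClass (b * (a (Fin.last n))⁻¹ * toFrac q.1 * (different F)⁻¹)},
        tauTerm q.1 (((n : ℂ) + 1) * s) m.1) * besselTerm g₁ xn s q.2.1)) := by
    obtain ⟨x, hx, e⟩ := mem_dualPrimVec.mp q.2.2
    have h1 : (dualEquiv a q).1 = emb x := e.symm
    rw [h1, ← e]
    exact fourierCoeff_eq_bessel hn hb hs hD h hx
  refine ⟨?_, ?_, ?_⟩
  · rw [← (dualEquiv a).summable_iff]
    exact ((hsum.mul_left _).mul_left _).congr fun q => (hval q).symm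
  · refine hsum.sigma.congr fun k => ?_
    dsimp only
    rw [tsum_mul_left]
  · rw [← (dualEquiv a).tsum_eq, tsum_congr hval, tsum_mul_left, tsum_mul_left, hsum.tsum_sigma]
    simp_rw [tsum_mul_left]

end Summability

end EisFourier
end

/-! ### Assembly: the theorem for rank `n = m + 1`. -/

theorem mainTheorem4 (F : Type*) [Field F] [NumberField F] (m : ℕ) (hm : 1 ≤ m)
    (a : Fin (m + 1) → Frac F)
    (b : Frac F) (hb : (1 : F) ∈ (b : FractionalIdeal (𝓞 F)⁰ F))
    (D : Set (Fin m → mixedSpace F)) (hD : IsFundDomain a D)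
    (X : Matrix (Fin (m + 1)) (Fin (m + 1)) (mixedSpace F))
    (hXdiag : ∀ i, X i i = 1) (hXlower : ∀ i j, j < i → X i j = 0)
    (y : Fin m → InfinitePlace F → ℝ) (hy : ∀ i σ, 0 < y i σ)
    (g : GL (Fin (m + 1)) (mixedSpace F))
    (hg : (g : Matrix (Fin (m + 1)) (Fin (m + 1)) (mixedSpace F)) = iwasawa X y)
    (g₁ : GL (Fin m) (mixedSpace F))
    (hg₁ : (g₁ : Matrix (Fin m) (Fin m) (mixedSpace F)) = iwasawa₁ X y)
    (s : ℂ) (hs : 1 < s.re) :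
    let n : ℂ := (m : ℂ) + 1
    let s₁ : ℂ := (n * s - 1) / (n - 1)
    let L : Submodule (𝓞 F) (Fin (m + 1) → F) := sumLattice a
    let L₁ : Submodule (𝓞 F) (Fin m → F) := sumLattice fun i => a i.castSucc
    let an : Frac F := a (Fin.last m)
    let z : UpperSpace F (m + 1) := QuotientGroup.mk g
    let z₁ : UpperSpace F m := QuotientGroup.mk g₁
    let E : UpperSpace F (m + 1) → ℂ := fun z' => eisClass L (idealClass b) z' s
    let I : (Fin m → mixedSpace F) → ℂ := fun ν => fourierCoeff D E ν z
    let d : ℂ := (Module.finrank ℚ F : ℂ)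
    let r₂ : ℂ := (nrComplexPlaces F : ℂ)
    let rootDisc : ℂ := ((Real.sqrt |(discr F : ℝ)| : ℝ) : ℂ)
    let absdet : InfinitePlace F → ℂ := fun σ =>
      ((normAtPlace σ (g₁ : Matrix (Fin m) (Fin m) (mixedSpace F)).det : ℝ) : ℂ)
    let rnorm : (Fin m → mixedSpace F) → InfinitePlace F → ℝ := fun ν σ =>
      rowNorm σ (Matrix.vecMul ν (g₁ : Matrix (Fin m) (Fin m) (mixedSpace F)))
    let xn : Fin m → mixedSpace F := fun i => X i.castSucc (Fin.last m)
    let ζ : ℂ := partialZeta (idealClass b⁻¹) (n * s)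
    let δ : ℂ := classDelta (idealClass b) (idealClass an) * idealNorm an ^ (-(n * s)) *
      ∏ σ : InfinitePlace F, absdet σ ^ (σ.mult * s)
    let c₀ : ℂ := (2 : ℂ) ^ r₂ * (Real.pi : ℂ) ^ (d / 2) / (rootDisc * idealNorm an) *
      (gammaF F (n * s - 1) / gammaF F (n * s)) *
      ∏ σ : InfinitePlace F, absdet σ ^ (σ.mult * ((1 - s) / (n - 1)))
    let q : (Ideal (𝓞 F))⁰ → ℂ := fun 𝔪 =>
      idealNorm (b * (toFrac 𝔪)⁻¹) ^ (-(n * s - 1)) * eisIdeal L₁ (b * (toFrac 𝔪)⁻¹) z₁ s₁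
    let c : ℂ := (2 : ℂ) ^ (d + r₂ * (n * s - 1)) * (Real.pi : ℂ) ^ (d * (n * s) / 2) /
      (rootDisc * idealNorm an ^ (n * s))
    let T : (𝔫 : (Ideal (𝓞 F))⁰) → {𝔪 : (Ideal (𝓞 F))⁰ // ClassGroup.mk0 𝔪 =
        idealClass (b * an⁻¹ * toFrac 𝔫 * (different F)⁻¹)} → ℂ := fun 𝔫 𝔪 =>
      ramanujanSum 𝔪.1 (toFrac 𝔫 * (different F)⁻¹) / idealNorm (toFrac 𝔪.1) ^ (n * s)
    let B : (Fin m → mixedSpace F) → ℂ := fun ν =>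
      Complex.exp (2 * Real.pi * Complex.I * (pairing ν xn : ℂ)) *
      (besselKF (n * s - 1) (fun σ => 2 * Real.pi * σ.mult * rnorm ν σ) / gammaF F (n * s)) *
      ∏ σ : InfinitePlace F,
        absdet σ ^ (σ.mult * s) / (rnorm ν σ : ℂ) ^ ((σ.mult / 2 : ℂ) * (n * s - 1))
    -- convergence of the series and integrals that occur on the left-hand sides
    ((∀ z', EisConverges L (idealClass b) z' s) ∧
      (∀ A : ClassGroup (𝓞 F), EisConverges L₁ A z₁ s₁) ∧
      (∀ A : ClassGroup (𝓞 F), Summable (zetaTerm A (n * s)) ∧ Summable (zetaTerm A (n * s - 1))) ∧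
      (∀ ν ∈ dualLattice a, FourierIntegrable D E ν z)) ∧
    -- the constant term
    (Summable (fun 𝔪 : (Ideal (𝓞 F))⁰ =>
        (totient 𝔪 : ℂ) / idealNorm (toFrac 𝔪) ^ (n * s) * q 𝔪) ∧
      (∀ 𝔪 : (Ideal (𝓞 F))⁰, eisClass L₁ (idealClass (b * (toFrac 𝔪)⁻¹)) z₁ s₁ =
        partialZeta (idealClass (b⁻¹ * toFrac 𝔪)) (n * s - 1) * q 𝔪) ∧
      I 0 = ζ * (δ + c₀ * ∑' 𝔪 : (Ideal (𝓞 F))⁰,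
        (totient 𝔪 : ℂ) / idealNorm (toFrac 𝔪) ^ (n * s) * q 𝔪) ∧
      (ζ ≠ 0 →
        (∀ 𝔪 : (Ideal (𝓞 F))⁰, partialZeta (idealClass (b⁻¹ * toFrac 𝔪)) (n * s - 1) ≠ 0) →
        I 0 / ζ = δ + c₀ * ∑' 𝔪 : (Ideal (𝓞 F))⁰,
          (totient 𝔪 : ℂ) / idealNorm (toFrac 𝔪) ^ (n * s) *
          (eisClass L₁ (idealClass (b * (toFrac 𝔪)⁻¹)) z₁ s₁ /
            partialZeta (idealClass (b⁻¹ * toFrac 𝔪)) (n * s - 1)))) ∧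
    -- the non-constant terms
    (Summable (fun ν : {ν // ν ∈ dualLattice a ∧ ν ≠ 0} => I ν.1) ∧
      (∀ 𝔫 : (Ideal (𝓞 F))⁰, Summable (T 𝔫)) ∧
      (∀ 𝔫 : (Ideal (𝓞 F))⁰, Summable fun ν : dualPrimVec a (toFrac 𝔫)⁻¹ => B ν.1) ∧
      Summable (fun 𝔫 : (Ideal (𝓞 F))⁰ =>
        idealNorm (toFrac 𝔫 * (different F)⁻¹) ^ (n * s - 1) * (∑' 𝔪, T 𝔫 𝔪) *
        ∑' ν : dualPrimVec a (toFrac 𝔫)⁻¹, B ν.1) ∧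
      ∑' ν : {ν // ν ∈ dualLattice a ∧ ν ≠ 0}, I ν.1 = ζ * (c * ∑' 𝔫 : (Ideal (𝓞 F))⁰,
        idealNorm (toFrac 𝔫 * (different F)⁻¹) ^ (n * s - 1) * (∑' 𝔪, T 𝔫 𝔪) *
        ∑' ν : dualPrimVec a (toFrac 𝔫)⁻¹, B ν.1)) := by
  intro n s₁ L L₁ an z z₁ E I d r₂ rootDisc absdet rnorm xn ζ δ c₀ q c T B
  have hm0 : m ≠ 0 := Nat.one_le_iff_ne_zero.mp hm
  have hmC : (m : ℂ) ≠ 0 := by exact_mod_cast hm0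
  have hn1 : n - 1 = (m : ℂ) := add_sub_cancel_right _ _
  have h : IsCorner g.1 g₁.1 xn := by
    rw [hg, hg₁]
    exact isCorner_iwasawa hXdiag hXlower y
  -- The evaluation point of the lower rank series is used in the division-free form `(n - 1)s₁ = ns
  -- - 1`.
  have hs₁ : (m : ℂ) * s₁ = ((m : ℂ) + 1) * s - 1 := by
    simp only [s₁, hn1]
    rw [mul_div_cancel₀ _ hmC]
  have hs₁' : 1 < s₁.re := by
    have h1 : s₁ = (((m : ℂ) + 1) * s - 1) / ((m : ℝ) : ℂ) := by
      simp only [s₁, hn1]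
      rfl
    rw [h1, Complex.div_ofReal_re, Complex.sub_re, Complex.one_re]
    exact one_lt_exponent hm0 hs
  have hκ : 1 < (n * s - 1).re := by
    rw [Complex.sub_re, Complex.one_re]
    exact one_lt_re_sub hm0 hs
  have hE (𝔪 : (Ideal (𝓞 F))⁰) : eisClass L₁ (idealClass (b * (toFrac 𝔪)⁻¹)) z₁ s₁ =
      partialZeta (idealClass (b⁻¹ * toFrac 𝔪)) (n * s - 1) * q 𝔪 := by
    have h1 := eisClass_eq (a := fun i => a i.castSucc) (one_mem_mul_toFrac_inv hb 𝔪) z₁ s₁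
    rw [hs₁, mul_inv, inv_inv] at h1
    exact h1
  have hI0 : I 0 = ζ * (δ + c₀ * ∑' 𝔪 : (Ideal (𝓞 F))⁰,
      (totient 𝔪 : ℂ) / idealNorm (toFrac 𝔪) ^ (n * s) * q 𝔪) := by
    have h1 := fourierCoeff_zero hm0 hb hs hs₁ hs₁' hD h
    rw [show (1 - s) / (m : ℂ) = (1 - s) / (n - 1) by rw [hn1]] at h1
    exact h1
  obtain ⟨hN1, hN2, hN3⟩ := tsum_fourierCoeff (b := b) g₁ xn hm0 hb hs hD h
  refine ⟨⟨fun z' => eisConverges m.succ_ne_zero a _ z' hs,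
    fun A => eisConverges hm0 _ A z₁ hs₁',
    fun A => ⟨summable_zetaTerm A (one_lt_re hs), summable_zetaTerm A hκ⟩,
    fun ν _ => (fourierCoeff_eisClass hm0 hb hs hD h ν).1⟩,
    ⟨summable_constant hm0 hs₁' z₁ (n * s), hE, hI0, fun hζ hζ' => ?_⟩,
    hN1, fun 𝔫 => summable_tauTerm 𝔫 (one_lt_re_sub hm0 hs) _,
    fun 𝔫 => (summable_besselTerm g₁ xn a hs).sigma_factor 𝔫, hN2, hN3⟩
  -- The literal quotient form: non-vanishing cancels `ζ` once globally, then one lower partial zeta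
  -- value for each `𝔪`.
  rw [hI0, mul_div_cancel_left₀ _ hζ]
  simp only [hE]
  congr 2
  refine tsum_congr fun 𝔪 => ?_
  rw [mul_div_cancel_left₀ _ (hζ' 𝔪)]
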